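/- Let $a>0$, $t_0>0$, and let $\omega\in C([t_0,\infty),L^2(\mathbb R))$ solve $$i\omega_t+\omega_{xx}+\frac{a^2}{2t}(\omega+\overline\omega)=0,\qquad t\ge t_0,$$ in the sense of distributions. Write $\hat f(\xi)=\int e^{-ix\xi}f(x)\,dx$ (extended to $L^2$), and $J(t)=x+2it\partial_x$, so that $\widehat{J(t)\omega(t)}=(i\partial_\xi-2t\xi)\hat\omega(t,\xi)$. Set $\alpha(\tau)=\sqrt{1-a^2/\tau}$, $$\Psi(\tau)=\tau-\tfrac{a^2}{2}\log\tau-\int_\tau^\infty\Big(\alpha(s)-1+\tfrac{a^2}{2s}\Big)ds,\qquad \tilde\Psi(\tau)=\tau-\tfrac{a^2}{2}\log\tau,$$ and, for $\xi\ne0$ and $t\xi^2>a^2$, define $Y_2,Z_2$ at $(t\xi^2,\xi)$ by $$\widehat{\Re\omega}(t,\xi)=e^{i\Psi(t\xi^2)}Y_2+e^{-i\Psi(t\xi^2)}Z_2,\qquad \widehat{\Im\omega}(t,\xi)=i\alpha(t\xi^2)\big(e^{i\Psi(t\xi^2)}Y_2-e^{-i\Psi(t\xi^2)}Z_2\big).$$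 Fix any representative of $\hat\omega(t_0,\cdot)$. Then the $\hat\omega(t,\cdot)$, $t\geq t_0$, have representatives, equal to the given one at $t_0$ and continuous in $t$ for each $\xi\neq0$, with the following properties. (i) For every $\xi\ne0$ the limits $Y^+(\xi)=\lim_{t\to\infty}Y_2(t\xi^2,\xi)$ and $Z^+(\xi)=\lim_{t\to\infty}Z_2(t\xi^2,\xi)$ exist, and there is a function $\hat u_+$ (the Fourier transform of the asymptotic state) with $$\lim_{t\to\infty}\Big(\hat\omega(t,\xi)-e^{-it\xi^2}e^{i\frac{a^2}{2}\log t}\,\hat u_+(\xi)\Big)=0,$$ $$Z^+(\xi)=\tfrac12e^{-ia^2\log|\xi|}\hat u_+(\xi),\qquad Y^+(\xi)=\tfrac12e^{ia^2\log|\xi|}\overline{\hat u_+(-\xi)}\qquad(\xi\ne0).$$ (ii) Let $\xi\neq0$ be such that $\hat\omega(t_0,\cdot)$, or else $\hat u_+$, is differentiable at $\xi$ and at $-\xi$. Then $\hat\omega(t,\cdot)$, for every $t\ge t_0$, and $Z^+$ are differentiable at $\xi$, and $$\lim_{t\to\infty}\left(\widehat{J(t)\omega(t)}(\xi)-2ie^{-i\tilde\Psi(t\xi^2)}\partial_\xi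 Z^+(\xi)+\frac{2a^2}{\xi}\Big(e^{i\tilde\Psi(t\xi^2)}Y^+(\xi)+e^{-i\tilde\Psi(t\xi^2)}Z^+(\xi)\Big)\right)=0,$$ where $\widehat{J(t)\omega(t)}(\xi)=i\partial_\xi\hat\omega(t,\xi)-2t\xi\,\hat\omega(t,\xi)$. If the representative of $\hat\omega(t_0,\cdot)$ is continuous on $\mathbb R\setminus\{0\}$, this expression is for almost every $\xi$ the $L^2$ Fourier transform of $J(t)\omega(t)$ at each time $t\ge t_0$ at which $J(t)\omega(t)\in L^2$. (iii) If $J(t)\omega(t)$ stays bounded in $L^2$ as $t\to\infty$ (it is in $L^2$ for all large $t$, with norms bounded uniformly in $t$), then the zero Fourier mode of the asymptotic state vanishes: $\hat u_+$ agrees almost everywhere with a continuous function on $\mathbb R$ that is $0$ at $\xi=0$. -/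

import Mathlib

open MeasureTheory Filter Topology Set
open scoped SchwartzMap FourierTransform ComplexConjugate

noncomputable section

/-- `ω ∈ C([t₀, ∞), L²(ℝ))` solves `i ω_t + ω_xx + (a² / (2 t)) (ω + conj ω) = 0` on `[t₀, ∞)`
in the sense of tempered distributions in `x`. Such an `ω` is `t ↦ S(t, t₀) ω(t₀)`. -/
structure IsLinearSolution (a t₀ : ℝ) (ω : ℝ → ℝ → ℂ) : Prop where
  memLp : ∀ t, t₀ ≤ t → MemLp (ω t) 2 volume
  continuous_L2 : ∀ t, t₀ ≤ t →
    Tendsto (fun s => eLpNorm (ω s - ω t) 2 volume) (𝓝[Ici t₀] t) (𝓝 0)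
  equation : ∀ φ : 𝓢(ℝ, ℂ), ∀ t, t₀ ≤ t →
    HasDerivWithinAt (fun s => ∫ x, ω s x * φ x)
      (Complex.I * ((∫ x, ω t x * deriv (deriv φ) x) +
        ((a ^ 2 / (2 * t) : ℝ) : ℂ) * ∫ x, (ω t x + conj (ω t x)) * φ x))
      (Ici t₀) t

/-- `F` represents the `L²` Fourier transform of `f ∈ L²(ℝ)`, in the convention
`f̂(ξ) = ∫ e^{-i x ξ} f(x) dx` (Mathlib's transform has the phase `e^{-2π i x ξ}`). -/
def IsFourierTransform (f F : ℝ → ℂ) : Prop :=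
  ∃ hf : MemLp f 2 volume,
    F =ᵐ[volume] fun ξ => (𝓕 (hf.toLp f) : Lp ℂ 2 (volume : Measure ℝ)) (ξ / (2 * Real.pi))

/-- `v = J(t) f` with `J(t) = x + 2 i t ∂ₓ`, in the sense of distributions. -/
def IsJ (t : ℝ) (f v : ℝ → ℂ) : Prop :=
  ∀ φ : 𝓢(ℝ, ℂ),
    ∫ x, v x * φ x = ∫ x, f x * ((x : ℂ) * φ x - 2 * Complex.I * (t : ℂ) * deriv φ x)

/-- `J(t)` on the Fourier side: if `F = f̂`, the transform of `J(t) f` is `(i ∂_ξ - 2 t ξ) F`. -/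
def fourierJ (t : ℝ) (F : ℝ → ℂ) (ξ : ℝ) : ℂ :=
  Complex.I * deriv F ξ - 2 * (t : ℂ) * (ξ : ℂ) * F ξ

/-- `α(τ) = √(1 - a² / τ)`. -/
def alpha (a τ : ℝ) : ℝ := Real.sqrt (1 - a ^ 2 / τ)

/-- `Ψ(τ) = τ - (a²/2) log τ - ∫_τ^∞ (α(s) - 1 + a² / (2 s)) ds`. -/
def Psi (a τ : ℝ) : ℝ :=
  τ - a ^ 2 / 2 * Real.log τ - ∫ s in Ioi τ, (alpha a s - 1 + a ^ 2 / (2 * s))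

/-- `Ψ̃(τ) = τ - (a²/2) log τ`. -/
def PsiTilde (a τ : ℝ) : ℝ := τ - a ^ 2 / 2 * Real.log τ

/-- The transform of `Re f` at `ξ`, where `F = f̂`. -/
def reHat (F : ℝ → ℂ) (ξ : ℝ) : ℂ := (F ξ + conj (F (-ξ))) / 2

/-- The transform of `Im f` at `ξ`, where `F = f̂`. -/
def imHat (F : ℝ → ℂ) (ξ : ℝ) : ℂ := (F ξ - conj (F (-ξ))) / (2 * Complex.I)

/-- The amplitude `Y₂(t ξ², ξ)` for `F = ω̂(t)`. It and `Z₂` are the solution of the system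
`reHat = e^{iΨ} Y₂ + e^{-iΨ} Z₂`, `imHat = i α e^{iΨ} Y₂ - i α e^{-iΨ} Z₂` at `τ = t ξ²`. -/
def ampY (a t : ℝ) (F : ℝ → ℂ) (ξ : ℝ) : ℂ :=
  Complex.exp (-(Complex.I * (Psi a (t * ξ ^ 2) : ℂ))) / 2 *
    (reHat F ξ + imHat F ξ / (Complex.I * (alpha a (t * ξ ^ 2) : ℂ)))

/-- The amplitude `Z₂(t ξ², ξ)` for `F = ω̂(t)`. -/
def ampZ (a t : ℝ) (F : ℝ → ℂ) (ξ : ℝ) : ℂ :=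
  Complex.exp (Complex.I * (Psi a (t * ξ ^ 2) : ℂ)) / 2 *
    (reHat F ξ - imHat F ξ / (Complex.I * (alpha a (t * ξ ^ 2) : ℂ)))

/-- `J(t) ω(t)` is in `L²` for all large `t`, with norms bounded uniformly in `t`. -/
def JStaysBounded (ω : ℝ → ℝ → ℂ) : Prop :=
  ∃ (C : NNReal) (T : ℝ), ∀ t, T ≤ t →
    ∃ v : ℝ → ℂ, MemLp v 2 volume ∧ IsJ t (ω t) v ∧ eLpNorm v 2 volume ≤ C

/-- The amplitude system is solved by `ampY` and `ampZ`. -/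
theorem amp_system (a t : ℝ) (F : ℝ → ℂ) (ξ : ℝ) (h : a ^ 2 < t * ξ ^ 2) :
    reHat F ξ = Complex.exp (Complex.I * (Psi a (t * ξ ^ 2) : ℂ)) * ampY a t F ξ +
        Complex.exp (-(Complex.I * (Psi a (t * ξ ^ 2) : ℂ))) * ampZ a t F ξ ∧
      imHat F ξ = Complex.I * (alpha a (t * ξ ^ 2) : ℂ) *
          Complex.exp (Complex.I * (Psi a (t * ξ ^ 2) : ℂ)) * ampY a t F ξ -
        Complex.I * (alpha a (t * ξ ^ 2) : ℂ) *
          Complex.exp (-(Complex.I * (Psi a (t * ξ ^ 2) : ℂ))) * ampZ a t F ξ := by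
  have hpos : 0 < t * ξ ^ 2 := lt_of_le_of_lt (sq_nonneg a) h
  have hα : (alpha a (t * ξ ^ 2) : ℂ) ≠ 0 := by
    have : 0 < alpha a (t * ξ ^ 2) := by
      refine Real.sqrt_pos.2 ?_
      rw [sub_pos, div_lt_one hpos]
      exact h
    exact_mod_cast this.ne'
  unfold ampY ampZ
  rw [Complex.exp_neg]
  have hE := Complex.exp_ne_zero (Complex.I * (Psi a (t * ξ ^ 2) : ℂ))
  generalize Complex.exp (Complex.I * (Psi a (t * ξ ^ 2) : ℂ)) = E at *
  generalize (alpha a (t * ξ ^ 2) : ℂ) = A at *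
  have hI := Complex.I_ne_zero
  constructor
  · field_simp
    ring
  · field_simp
    ring

end

/-! Let S and T be the Fourier transforms of the real and imaginary parts of ω. The equation becomes
S_t = ξ² T, T_t = -(ξ² - a²/t) S, and in the variable τ = tξ² this is the Coulomb equation f'' + (1
- a²/τ) f = 0, the same at every frequency. It has a Jost solution f asymptotic to e^{-iΨ̃}
(`exists_isJost`); f and its conjugate have Wronskian 2i and span the solutions. Hence ω̂(t,ξ) =
c(ξ)(f + if')(tξ²) + conj(c(-ξ))(conj f + i conj f')(tξ²), with c read off from the data at t₀
(`IsLinearSolution.waveHat_ae_eq`). Weak solutions are covered because their Wronskians with f and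
conj f, tested away from ξ = 0, are conserved.

Part (i) follows from the asymptotics of f: Z⁺ = c, Y⁺(ξ) = conj(c(-ξ)), and û_+ = 2e^{ia² log|ξ|}
c. For (ii), apply i∂_ξ - 2tξ to the formula: the terms growing in t cancel exactly, and the
potential a²/τ leaves -(2a²/ξ)S (`IsJost.fourierJ_waveHat`).

For (iii), J(t) is conjugate to i∂_ξ through e^{itξ²}, so an L² bound on Jω makes e^{itξ²}ω̂(t)
Hölder-1/2 uniformly in t (`IsJ.exists_holder`), and û_+ inherits a continuous representative g. At
the scale ξ = y/√t the Hölder bound makes the rescaled profile independent of y in the limit, while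
the explicit formula gives g(0)F(y) + ε conj(g(0))G(y), with F, G built from f and conj f, and ε any
limit phase of e^{-ia² log t} (`zero_mode_relation`). Comparing two values of ε, g(0) ≠ 0 would
force G to be constant. Since G decays at infinity it would vanish, that is f = if', which the
Coulomb equation excludes when a > 0. -/

/-! ### Construction of the Jost solution by a Whittaker-type integral. -/

section Coulomb

/-- The integrand of the integral representation of the decaying Coulomb (Whittaker) function. -/
noncomputable def coulombKernel (κ e : ℂ) (τ s : ℝ) : ℂ :=
  (s : ℂ) ^ (-κ) * ((s : ℂ) + 2 * Complex.I * τ) ^ e * Real.exp (-s)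

/-- `∫₀^∞ s^{-κ} (s + 2 i τ)^e e^{-s} ds`. -/
noncomputable def coulombIntegral (κ e : ℂ) (τ : ℝ) : ℂ :=
  ∫ s in Ioi (0 : ℝ), coulombKernel κ e τ s

theorem coulomb_base_re (s τ : ℝ) : ((s : ℂ) + 2 * Complex.I * τ).re = s := by
  simp

theorem coulomb_base_im (s τ : ℝ) : ((s : ℂ) + 2 * Complex.I * τ).im = 2 * τ := by
  simp

theorem coulomb_base_mem_slitPlane (s : ℝ) {τ : ℝ} (hτ : 0 < τ) :
    (s : ℂ) + 2 * Complex.I * τ ∈ Complex.slitPlane := by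
  rw [Complex.mem_slitPlane_iff, coulomb_base_re, coulomb_base_im]
  right; positivity

theorem ofReal_add_I_im (x : ℝ) : ((x : ℂ) + Complex.I).im = 1 := by
  simp

/-- In the upper half-plane the argument is nonnegative, so an exponent with nonnegative imaginary
part contributes a factor e^{-arg z · Im e} ≤ 1. The exponents κ, κ - 1, κ - 2 with κ = ia²/2 all
qualify. -/
theorem norm_cpow_le_of_im_nonneg {z e : ℂ} {r : ℝ} (hr : 0 < r) (hz : r ≤ z.im)
    (he : e.re ≤ 0) (he' : 0 ≤ e.im) : ‖z ^ e‖ ≤ r ^ e.re := by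
  have hzr : r ≤ ‖z‖ := hz.trans ((le_abs_self _).trans (Complex.abs_im_le_norm z))
  have hz0 : z ≠ 0 := norm_pos_iff.1 (hr.trans_le hzr)
  rw [Complex.norm_cpow_of_ne_zero hz0]
  have h1 : (1 : ℝ) ≤ Real.exp (z.arg * e.im) :=
    Real.one_le_exp (mul_nonneg (Complex.arg_nonneg_iff.2 (hr.le.trans hz)) he')
  calc ‖z‖ ^ e.re / Real.exp (z.arg * e.im) ≤ ‖z‖ ^ e.re / 1 := by gcongr
    _ ≤ r ^ e.re := by
      rw [div_one]; exact Real.rpow_le_rpow_of_nonpos hr hzr he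

theorem norm_coulombKernel_le {κ e : ℂ} (hκ : κ.re = 0) (he : e.re ≤ 0) (he' : 0 ≤ e.im)
    {τ r s : ℝ} (hr : 0 < r) (hτ : r ≤ 2 * τ) (hs : 0 < s) :
    ‖coulombKernel κ e τ s‖ ≤ r ^ e.re * Real.exp (-s) := by
  have h1 : ‖(s : ℂ) ^ (-κ)‖ = 1 := by
    rw [Complex.norm_cpow_eq_rpow_re_of_pos hs]; simp [hκ]
  have h2 := norm_cpow_le_of_im_nonneg (z := (s : ℂ) + 2 * Complex.I * τ) hr
    (by rw [coulomb_base_im]; exact hτ) he he'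
  rw [coulombKernel, norm_mul, norm_mul, h1, one_mul, Complex.norm_real, Real.norm_eq_abs,
    abs_of_pos (Real.exp_pos _)]
  gcongr

theorem continuousOn_coulombKernel (κ e : ℂ) {τ : ℝ} (hτ : 0 < τ) :
    ContinuousOn (coulombKernel κ e τ) (Ioi 0) := by
  intro s hs
  refine ContinuousAt.continuousWithinAt ?_
  unfold coulombKernel
  refine ContinuousAt.mul (ContinuousAt.mul ?_ ?_) (by fun_prop)
  · exact ContinuousAt.cpow (by fun_prop) (by fun_prop)
      (by rw [Complex.mem_slitPlane_iff]; left; simpa using hs)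
  · exact ContinuousAt.cpow (by fun_prop) (by fun_prop)
      (coulomb_base_mem_slitPlane s hτ)

theorem aestronglyMeasurable_coulombKernel (κ e : ℂ) {τ : ℝ} (hτ : 0 < τ) :
    AEStronglyMeasurable (coulombKernel κ e τ) (volume.restrict (Ioi 0)) :=
  (continuousOn_coulombKernel κ e hτ).aestronglyMeasurable measurableSet_Ioi

theorem integrableOn_coulombKernel {κ e : ℂ} (hκ : κ.re = 0) (he : e.re ≤ 0) (he' : 0 ≤ e.im)
    {τ : ℝ} (hτ : 0 < τ) : IntegrableOn (coulombKernel κ e τ) (Ioi 0) := by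
  refine Integrable.mono' ((integrableOn_exp_neg_Ioi 0).const_mul ((2 * τ) ^ e.re))
    (aestronglyMeasurable_coulombKernel κ e hτ) ?_
  filter_upwards [ae_restrict_mem measurableSet_Ioi] with s hs
  exact norm_coulombKernel_le hκ he he' (by positivity) le_rfl hs

theorem norm_coulombIntegral_le {κ e : ℂ} (hκ : κ.re = 0) (he : e.re ≤ 0) (he' : 0 ≤ e.im)
    {τ : ℝ} (hτ : 0 < τ) : ‖coulombIntegral κ e τ‖ ≤ (2 * τ) ^ e.re := by
  have h := norm_integral_le_of_norm_le (μ := volume.restrict (Ioi (0 : ℝ)))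
    (f := coulombKernel κ e τ) ((integrableOn_exp_neg_Ioi 0).const_mul ((2 * τ) ^ e.re)) (by
      filter_upwards [ae_restrict_mem measurableSet_Ioi] with s hs
      exact norm_coulombKernel_le hκ he he' (by positivity) le_rfl hs)
  rw [integral_const_mul, integral_exp_neg_Ioi_zero, mul_one] at h
  exact h

theorem hasDerivAt_coulombIntegral {κ e : ℂ} (hκ : κ.re = 0) (he : e.re ≤ 0) (he' : 0 ≤ e.im)
    {τ : ℝ} (hτ : 0 < τ) :
    HasDerivAt (coulombIntegral κ e) (2 * Complex.I * e * coulombIntegral κ (e - 1) τ) τ := by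
  -- For x > τ/2 the base s + 2ix has imaginary part at least τ, which gives a dominating function
  -- independent of x.
  have hs : Ioi (τ / 2) ∈ 𝓝 τ := Ioi_mem_nhds (by linarith)
  have he1 : (e - 1).re ≤ 0 := by simp; linarith
  have he1' : 0 ≤ (e - 1).im := by simpa using he'
  have key := hasDerivAt_integral_of_dominated_loc_of_deriv_le
    (μ := volume.restrict (Ioi (0 : ℝ)))
    (F := coulombKernel κ e) (F' := fun x s => 2 * Complex.I * e * coulombKernel κ (e - 1) x s)
    (bound := fun s => ‖2 * Complex.I * e‖ * (τ ^ (e - 1).re * Real.exp (-s)))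
    (x₀ := τ) hs
    (by
      filter_upwards [hs] with x hx
      exact aestronglyMeasurable_coulombKernel κ e
        ((half_pos hτ).trans hx))
    (integrableOn_coulombKernel hκ he he' hτ)
    ((aestronglyMeasurable_coulombKernel κ (e - 1) hτ).const_mul _)
    (by
      filter_upwards [ae_restrict_mem measurableSet_Ioi] with s hs x hx
      rw [norm_mul]
      gcongr
      exact norm_coulombKernel_le hκ he1 he1' hτ (by rw [mem_Ioi] at hx; linarith) hs)
    (((integrableOn_exp_neg_Ioi 0).const_mul _).const_mul _)
    (by
      filter_upwards [ae_restrict_mem measurableSet_Ioi] with s hs x hx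
      have hx0 : 0 < x := (half_pos hτ).trans hx
      have h1 : HasDerivAt (fun y : ℂ => (s : ℂ) + 2 * Complex.I * y) (2 * Complex.I) (x : ℂ) := by
        simpa using ((hasDerivAt_id (x : ℂ)).const_mul (2 * Complex.I)).const_add (s : ℂ)
      have h2 := (h1.cpow_const (c := e)
        (coulomb_base_mem_slitPlane s hx0)).comp_ofReal
      have h3 := (h2.const_mul ((s : ℂ) ^ (-κ))).mul_const ((Real.exp (-s) : ℝ) : ℂ)
      unfold coulombKernel
      convert! h3 using 1
      ring)
  have := key.2
  rwa [integral_const_mul] at this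

/-- Differentiate s^{1-κ} z^{κ-1} e^{-s} with z = s + 2iτ and substitute s = z - 2iτ: the result is
a combination of kernels with exponents κ, κ - 1, κ - 2 only. -/
theorem hasDerivAt_coulomb_primitive {κ : ℂ} {τ s : ℝ} (hτ : 0 < τ) (hs : 0 < s) :
    HasDerivAt (fun s : ℝ => -((s : ℂ) * coulombKernel κ (κ - 1) τ s))
      ((κ - 1) * (2 * Complex.I * τ) * coulombKernel κ (κ - 2) τ s -
        2 * Complex.I * τ * coulombKernel κ (κ - 1) τ s + coulombKernel κ κ τ s) s := by
  have hs0 : (s : ℂ) ≠ 0 := by exact_mod_cast hs.ne'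
  have hz := coulomb_base_mem_slitPlane s hτ
  have hz0 := Complex.slitPlane_ne_zero hz
  have h1 : HasDerivAt (fun y : ℝ => (y : ℂ) ^ (-κ)) (-κ * (s : ℂ) ^ (-κ - 1)) s := by
    simpa using ((hasDerivAt_id (s : ℂ)).cpow_const (c := -κ)
      (by rw [Complex.mem_slitPlane_iff]; left; simpa using hs)).comp_ofReal
  have h2 : HasDerivAt (fun y : ℝ => ((y : ℂ) + 2 * Complex.I * τ) ^ (κ - 1))
      ((κ - 1) * ((s : ℂ) + 2 * Complex.I * τ) ^ (κ - 1 - 1)) s := by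
    simpa using (((hasDerivAt_id (s : ℂ)).add_const (2 * Complex.I * (τ : ℂ))).cpow_const
      (c := κ - 1) hz).comp_ofReal
  have h3 : HasDerivAt (fun y : ℝ => ((Real.exp (-y) : ℝ) : ℂ)) (-(Real.exp (-s) : ℝ) : ℂ) s := by
    have := ((hasDerivAt_neg s).exp).ofReal_comp
    simpa using this
  have h4 : HasDerivAt (fun y : ℝ => (y : ℂ)) 1 s := (hasDerivAt_id (s : ℂ)).comp_ofReal
  have h5 := (h4.mul ((h1.mul h2).mul h3)).neg
  unfold coulombKernel
  convert! h5 using 1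
  rw [show κ - 2 = κ - 1 - 1 by ring]
  have e1 : (s : ℂ) ^ (-κ) = s * (s : ℂ) ^ (-κ - 1) := by
    rw [Complex.cpow_sub _ _ hs0, Complex.cpow_one]; field_simp
  have e2 : ∀ e : ℂ, ((s : ℂ) + 2 * Complex.I * τ) ^ e =
      ((s : ℂ) + 2 * Complex.I * τ) * ((s : ℂ) + 2 * Complex.I * τ) ^ (e - 1) := fun e => by
    rw [Complex.cpow_sub _ _ hz0, Complex.cpow_one]; field_simp
  simp only [Pi.mul_apply]
  rw [e2 κ, e2 (κ - 1), e1]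
  ring

/-- A total derivative integrates to zero, since the primitive vanishes at 0 and at infinity. With
a² = -2iκ this contiguity relation is the Coulomb equation for e^{-iτ} `coulombIntegral κ κ τ`. -/
theorem coulombIntegral_relation {κ : ℂ} (hκ : κ.re = 0) (hκ' : 0 ≤ κ.im) {τ : ℝ} (hτ : 0 < τ) :
    (κ - 1) * (2 * Complex.I * τ) * coulombIntegral κ (κ - 2) τ -
      2 * Complex.I * τ * coulombIntegral κ (κ - 1) τ + coulombIntegral κ κ τ = 0 := by
  have i2 := integrableOn_coulombKernel (κ := κ) (e := κ - 2) hκ (by simp [hκ])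
    (by simpa using hκ') hτ
  have i1 := integrableOn_coulombKernel (κ := κ) (e := κ - 1) hκ (by simp [hκ])
    (by simpa using hκ') hτ
  have i0 := integrableOn_coulombKernel (κ := κ) (e := κ) hκ hκ.le hκ' hτ
  have hint : IntegrableOn (fun s => (κ - 1) * (2 * Complex.I * τ) * coulombKernel κ (κ - 2) τ s -
        2 * Complex.I * τ * coulombKernel κ (κ - 1) τ s + coulombKernel κ κ τ s) (Ioi 0) :=
    ((i2.const_mul _).sub (i1.const_mul _)).add i0
  have hb : ∀ s : ℝ, 0 ≤ s → ‖-((s : ℂ) * coulombKernel κ (κ - 1) τ s)‖ ≤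
      (2 * τ) ^ (κ - 1).re * (s * Real.exp (-s)) := by
    intro s hs
    rcases hs.eq_or_lt with rfl | hs
    · simp
    rw [norm_neg, norm_mul, Complex.norm_real, Real.norm_eq_abs, abs_of_pos hs]
    have := norm_coulombKernel_le (κ := κ) (e := κ - 1) (τ := τ) (r := 2 * τ) hκ (by simp [hκ])
      (by simpa using hκ') (by positivity) le_rfl hs
    calc _ ≤ s * ((2 * τ) ^ (κ - 1).re * Real.exp (-s)) := by gcongr
      _ = _ := by ring
  have h0 : ContinuousWithinAt (fun s : ℝ => -((s : ℂ) * coulombKernel κ (κ - 1) τ s))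
      (Ici 0) 0 := by
    unfold ContinuousWithinAt
    simp only [Complex.ofReal_zero, zero_mul, neg_zero]
    refine squeeze_zero_norm' (a := fun s : ℝ => (2 * τ) ^ (κ - 1).re * (s * Real.exp (-s))) ?_ ?_
    · filter_upwards [self_mem_nhdsWithin] with s hs using hb s hs
    · have : Continuous (fun s : ℝ => (2 * τ) ^ (κ - 1).re * (s * Real.exp (-s))) := by fun_prop
      simpa using (this.tendsto 0).mono_left nhdsWithin_le_nhds
  have hinf : Tendsto (fun s : ℝ => -((s : ℂ) * coulombKernel κ (κ - 1) τ s)) atTop (𝓝 0) := by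
    refine squeeze_zero_norm' (a := fun s : ℝ => (2 * τ) ^ (κ - 1).re * (s * Real.exp (-s))) ?_ ?_
    · filter_upwards [eventually_ge_atTop 0] with s hs using hb s hs
    · simpa using (Real.tendsto_pow_mul_exp_neg_atTop_nhds_zero 1).const_mul ((2 * τ) ^ (κ - 1).re)
  have key := integral_Ioi_of_hasDerivAt_of_tendsto h0
    (fun s hs => hasDerivAt_coulomb_primitive (κ := κ) hτ hs) hint hinf
  have e1 := integral_add ((i2.const_mul ((κ - 1) * (2 * Complex.I * τ))).sub
    (i1.const_mul (2 * Complex.I * τ))) i0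
  have e2 := integral_sub (i2.const_mul ((κ - 1) * (2 * Complex.I * τ)))
    (i1.const_mul (2 * Complex.I * τ))
  simp only [Pi.sub_apply] at e1
  rw [e1, e2, integral_const_mul, integral_const_mul] at key
  simpa [coulombIntegral] using key

/-- Factoring 2τ > 0 out of s + 2iτ leaves (s/(2τ) + i)^κ, bounded by 1 and tending to i^κ, so
dominated convergence leaves a Gamma integral. -/
theorem tendsto_coulombIntegral {κ : ℂ} (hκ : κ.re = 0) (hκ' : 0 ≤ κ.im) :
    Tendsto (fun τ : ℝ => ((2 * τ : ℝ) : ℂ) ^ (-κ) * coulombIntegral κ κ τ) atTop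
      (𝓝 (Complex.I ^ κ * Complex.Gamma (1 - κ))) := by
  have hG : Complex.I ^ κ * Complex.Gamma (1 - κ) =
      ∫ s in Ioi (0 : ℝ), (s : ℂ) ^ (-κ) * Complex.I ^ κ * Real.exp (-s) := by
    rw [Complex.Gamma_eq_integral (by simp [hκ]), Complex.GammaIntegral, ← integral_const_mul]
    refine integral_congr_ae (Eventually.of_forall fun s => ?_)
    simp only [show 1 - κ - 1 = -κ by ring]
    ring
  have hlhs : ∀ τ : ℝ, 0 < τ → ((2 * τ : ℝ) : ℂ) ^ (-κ) * coulombIntegral κ κ τ =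
      ∫ s in Ioi (0 : ℝ), (s : ℂ) ^ (-κ) * ((s / (2 * τ) : ℝ) + Complex.I) ^ κ *
        Real.exp (-s) := by
    intro τ hτ
    have h2 : (0 : ℝ) < 2 * τ := by positivity
    rw [coulombIntegral, ← integral_const_mul]
    refine setIntegral_congr_fun measurableSet_Ioi fun s hs => ?_
    have hw : ((s / (2 * τ) : ℝ) : ℂ) + Complex.I ≠ 0 := by
      intro h
      have := congrArg Complex.im h
      rw [ofReal_add_I_im] at this
      simp at this
    have e1 : (s : ℂ) + 2 * Complex.I * τ =
        ((2 * τ : ℝ) : ℂ) * (((s / (2 * τ) : ℝ) : ℂ) + Complex.I) := by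
      have : (τ : ℂ) ≠ 0 := by exact_mod_cast hτ.ne'
      push_cast
      field_simp
    have e2 : ((s : ℂ) + 2 * Complex.I * τ) ^ κ =
        ((2 * τ : ℝ) : ℂ) ^ κ * (((s / (2 * τ) : ℝ) : ℂ) + Complex.I) ^ κ := by
      have h20 : ((2 * τ : ℝ) : ℂ) ≠ 0 := by exact_mod_cast h2.ne'
      rw [e1, Complex.cpow_def_of_ne_zero (mul_ne_zero h20 hw), Complex.log_ofReal_mul h2 hw,
        Complex.cpow_def_of_ne_zero h20, Complex.cpow_def_of_ne_zero hw, ← Complex.exp_add,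
        Complex.ofReal_log h2.le]
      ring_nf
    have h20 : ((2 * τ : ℝ) : ℂ) ≠ 0 := by exact_mod_cast h2.ne'
    have e3 : ((2 * τ : ℝ) : ℂ) ^ (-κ) * ((2 * τ : ℝ) : ℂ) ^ κ = 1 := by
      rw [← Complex.cpow_add _ _ h20]; simp
    simp only [coulombKernel]
    rw [e2]
    linear_combination (s : ℂ) ^ (-κ) * (((s / (2 * τ) : ℝ) : ℂ) + Complex.I) ^ κ *
        Real.exp (-s) * e3
  rw [hG]
  refine Tendsto.congr' (f₁ := fun τ : ℝ => ∫ s in Ioi (0 : ℝ), (s : ℂ) ^ (-κ) *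
    ((s / (2 * τ) : ℝ) + Complex.I) ^ κ * Real.exp (-s)) ?_ ?_
  · filter_upwards [eventually_gt_atTop 0] with τ hτ using (hlhs τ hτ).symm
  refine MeasureTheory.tendsto_integral_filter_of_dominated_convergence
    (fun s => Real.exp (-s)) ?_ ?_ (integrableOn_exp_neg_Ioi 0) ?_
  · filter_upwards [eventually_gt_atTop 0] with τ hτ
    refine ContinuousOn.aestronglyMeasurable (fun s hs => ?_) measurableSet_Ioi
    refine ContinuousAt.continuousWithinAt ?_
    refine ContinuousAt.mul (ContinuousAt.mul ?_ ?_) (by fun_prop)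
    · exact ContinuousAt.cpow (by fun_prop) (by fun_prop)
        (by rw [Complex.mem_slitPlane_iff]; left; simpa using hs)
    · exact ContinuousAt.cpow (by fun_prop) (by fun_prop)
        (by rw [Complex.mem_slitPlane_iff, ofReal_add_I_im]; right; simp)
  · filter_upwards [eventually_gt_atTop 0] with τ hτ
    filter_upwards [ae_restrict_mem measurableSet_Ioi] with s hs
    have h1 : ‖(s : ℂ) ^ (-κ)‖ = 1 := by
      rw [Complex.norm_cpow_eq_rpow_re_of_pos hs]; simp [hκ]
    have h2 := norm_cpow_le_of_im_nonneg (z := ((s / (2 * τ) : ℝ) : ℂ) + Complex.I)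
      (e := κ) one_pos (ofReal_add_I_im _).ge hκ.le hκ'
    rw [Real.one_rpow] at h2
    rw [norm_mul, norm_mul, h1, one_mul, Complex.norm_real, Real.norm_eq_abs,
      abs_of_pos (Real.exp_pos _)]
    exact mul_le_of_le_one_left (Real.exp_pos _).le h2
  · filter_upwards with s
    refine Tendsto.mul (Tendsto.mul tendsto_const_nhds ?_) tendsto_const_nhds
    have hc : ContinuousAt (fun z : ℂ => z ^ κ) Complex.I :=
      ContinuousAt.cpow continuousAt_id continuousAt_const
        (by rw [Complex.mem_slitPlane_iff]; right; simp)
    refine hc.tendsto.comp ?_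
    have : Tendsto (fun τ : ℝ => s / (2 * τ)) atTop (𝓝 0) :=
      Tendsto.div_atTop tendsto_const_nhds (tendsto_id.const_mul_atTop two_pos)
    have h := ((Complex.continuous_ofReal.tendsto 0).comp this).add_const Complex.I
    simpa using h

/-- The Jost solution of the Coulomb equation `f'' + (1 - a² / τ) f = 0`, with `f₁ = f'`. -/
structure IsJost (a : ℝ) (f f₁ : ℝ → ℂ) : Prop where
  deriv_f : ∀ τ, 0 < τ → HasDerivAt f (f₁ τ) τ
  deriv_f₁ : ∀ τ, 0 < τ → HasDerivAt f₁ (-((1 - a ^ 2 / τ : ℝ) : ℂ) * f τ) τ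
  asymp_f : Tendsto (fun τ => f τ - Complex.exp (-(Complex.I * (PsiTilde a τ : ℂ)))) atTop (𝓝 0)
  asymp_f₁ : Tendsto (fun τ => f₁ τ + Complex.I *
    Complex.exp (-(Complex.I * (PsiTilde a τ : ℂ)))) atTop (𝓝 0)

theorem exists_isJost (a : ℝ) : ∃ f f₁ : ℝ → ℂ, IsJost a f f₁ := by
  -- Chosen so that e^{-iτ} τ^κ = e^{-iΨ̃(τ)}.
  set κ : ℂ := ((a ^ 2 / 2 : ℝ) : ℂ) * Complex.I with hκdef
  have hκ : κ.re = 0 := by rw [hκdef, Complex.re_ofReal_mul]; simp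
  have hκ' : 0 ≤ κ.im := by rw [hκdef, Complex.im_ofReal_mul, Complex.I_im]; positivity
  set D : ℂ := Complex.I ^ κ * Complex.Gamma (1 - κ) with hD
  have hD0 : D ≠ 0 := by
    refine mul_ne_zero ?_ (Complex.Gamma_ne_zero_of_re_pos (by simp [hκ]))
    rw [Ne, Complex.cpow_eq_zero_iff]; simp
  -- The integral grows like D (2τ)^κ, so dividing by C leaves exactly τ^κ. That C is nonzero rests
  -- on Γ having no zero at 1 - κ.
  set C : ℂ := (2 : ℂ) ^ κ * D with hC
  have h2κ : (2 : ℂ) ^ κ ≠ 0 := by rw [Ne, Complex.cpow_eq_zero_iff]; simp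
  have hC0 : C ≠ 0 := mul_ne_zero h2κ hD0
  have hE : ∀ τ : ℝ, HasDerivAt (fun τ : ℝ => Complex.exp (-(Complex.I * τ)))
      (Complex.exp (-(Complex.I * τ)) * -Complex.I) τ := by
    intro τ
    have h4 : HasDerivAt (fun y : ℝ => (y : ℂ)) 1 τ := (hasDerivAt_id (τ : ℂ)).comp_ofReal
    simpa using ((h4.const_mul Complex.I).neg).cexp
  have hN0 : ∀ τ, 0 < τ → HasDerivAt (coulombIntegral κ κ)
      (2 * Complex.I * κ * coulombIntegral κ (κ - 1) τ) τ := fun τ hτ =>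
    hasDerivAt_coulombIntegral hκ hκ.le hκ' hτ
  have hN1 : ∀ τ, 0 < τ → HasDerivAt (coulombIntegral κ (κ - 1))
      (2 * Complex.I * (κ - 1) * coulombIntegral κ (κ - 2) τ) τ := fun τ hτ => by
    have := hasDerivAt_coulombIntegral (κ := κ) (e := κ - 1) hκ (by simp [hκ])
      (by simpa using hκ') hτ
    rwa [show κ - 1 - 1 = κ - 2 by ring] at this
  have hΨ : ∀ τ : ℝ, 0 < τ → Complex.exp (-(Complex.I * τ)) =
      Complex.exp (-(Complex.I * (PsiTilde a τ : ℂ))) * ((2 * τ : ℝ) : ℂ) ^ (-κ) * 2 ^ κ := by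
    intro τ hτ
    have h20 : ((2 * τ : ℝ) : ℂ) ≠ 0 := by exact_mod_cast (by positivity : 2 * τ ≠ 0)
    rw [Complex.cpow_def_of_ne_zero two_ne_zero, Complex.cpow_def_of_ne_zero h20,
      ← Complex.exp_add, ← Complex.exp_add, ← Complex.ofReal_log (by positivity),
      Real.log_mul two_ne_zero hτ.ne', show (2 : ℂ) = ((2 : ℝ) : ℂ) by norm_num,
      ← Complex.ofReal_log (by positivity)]
    congr 1
    simp only [PsiTilde, hκdef]
    push_cast
    ring
  have hn : ∀ τ : ℝ, ‖Complex.exp (-(Complex.I * τ))‖ = 1 := fun τ => by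
    simp [Complex.norm_exp]
  have hf : Tendsto (fun τ : ℝ => Complex.exp (-(Complex.I * τ)) * coulombIntegral κ κ τ / C -
      Complex.exp (-(Complex.I * (PsiTilde a τ : ℂ)))) atTop (𝓝 0) := by
    have h1 : Tendsto (fun τ : ℝ => ((2 * τ : ℝ) : ℂ) ^ (-κ) * coulombIntegral κ κ τ / D - 1)
        atTop (𝓝 0) := by
      have := ((tendsto_coulombIntegral hκ hκ').div_const D).sub_const 1
      rwa [div_self hD0, sub_self] at this
    refine squeeze_zero_norm' ?_ (tendsto_norm_zero.comp h1)
    filter_upwards [eventually_gt_atTop 0] with τ hτ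
    rw [hΨ τ hτ, hC]
    have : Complex.exp (-(Complex.I * (PsiTilde a τ : ℂ))) * ((2 * τ : ℝ) : ℂ) ^ (-κ) * 2 ^ κ *
        coulombIntegral κ κ τ / (2 ^ κ * D) - Complex.exp (-(Complex.I * (PsiTilde a τ : ℂ))) =
        Complex.exp (-(Complex.I * (PsiTilde a τ : ℂ))) *
          (((2 * τ : ℝ) : ℂ) ^ (-κ) * coulombIntegral κ κ τ / D - 1) := by
      field_simp
    rw [this, norm_mul, hn, one_mul]
    rfl
  have hN1lim : Tendsto (fun τ : ℝ => Complex.exp (-(Complex.I * τ)) *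
      (2 * Complex.I * κ * coulombIntegral κ (κ - 1) τ) / C) atTop (𝓝 0) := by
    have h0 : Tendsto (coulombIntegral κ (κ - 1)) atTop (𝓝 0) := by
      refine squeeze_zero_norm' (a := fun τ : ℝ => (2 * τ)⁻¹) ?_
        (tendsto_inv_atTop_zero.comp (tendsto_id.const_mul_atTop two_pos))
      filter_upwards [eventually_gt_atTop 0] with τ hτ
      have := norm_coulombIntegral_le (κ := κ) (e := κ - 1) hκ (by simp [hκ])
        (by simpa using hκ') hτ
      simpa [hκ, Real.rpow_neg_one] using this
    have h1 : Tendsto (fun τ : ℝ => (2 * Complex.I * κ * coulombIntegral κ (κ - 1) τ) / C) atTop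
        (𝓝 0) := by
      simpa using (h0.const_mul (2 * Complex.I * κ)).div_const C
    refine squeeze_zero_norm' (Eventually.of_forall fun τ => ?_) (tendsto_norm_zero.comp h1)
    rw [mul_div_assoc, norm_mul, hn, one_mul]
    rfl
  refine ⟨fun τ => Complex.exp (-(Complex.I * τ)) * coulombIntegral κ κ τ / C,
    fun τ => Complex.exp (-(Complex.I * τ)) * (2 * Complex.I * κ * coulombIntegral κ (κ - 1) τ -
      Complex.I * coulombIntegral κ κ τ) / C, ?_, ?_, hf, ?_⟩
  · intro τ hτ
    have := ((hE τ).mul (hN0 τ hτ)).div_const C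
    convert! this using 1
    ring
  · intro τ hτ
    have h := ((hE τ).mul (((hN1 τ hτ).const_mul (2 * Complex.I * κ)).sub
      ((hN0 τ hτ).const_mul Complex.I))).div_const C
    have hr := coulombIntegral_relation hκ hκ' hτ
    have hκ2 : (a : ℂ) ^ 2 = -2 * Complex.I * κ := by
      rw [hκdef]; push_cast
      linear_combination ((a : ℂ) ^ 2) * Complex.I_sq
    have hτ0 : (τ : ℂ) ≠ 0 := by exact_mod_cast hτ.ne'
    convert! h using 1
    rw [← mul_div_assoc]
    congr 1
    push_cast
    rw [hκ2]
    have hN : coulombIntegral κ κ τ = 2 * Complex.I * τ * coulombIntegral κ (κ - 1) τ -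
        (κ - 1) * (2 * Complex.I * τ) * coulombIntegral κ (κ - 2) τ := by
      linear_combination hr
    have e : -2 * Complex.I * κ / τ * coulombIntegral κ κ τ =
        4 * κ * coulombIntegral κ (κ - 1) τ - 4 * κ * (κ - 1) * coulombIntegral κ (κ - 2) τ := by
      have h1 : -2 * Complex.I * κ / τ * (2 * Complex.I * τ * coulombIntegral κ (κ - 1) τ -
          (κ - 1) * (2 * Complex.I * τ) * coulombIntegral κ (κ - 2) τ) = -4 * Complex.I ^ 2 * κ *
          (coulombIntegral κ (κ - 1) τ - (κ - 1) * coulombIntegral κ (κ - 2) τ) := by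
        clear_value κ
        field_simp
        ring
      rw [hN, h1, Complex.I_sq]
      ring
    simp only [Pi.sub_apply]
    clear_value κ
    linear_combination Complex.exp (-(Complex.I * τ)) * e - Complex.exp (-(Complex.I * τ)) *
      (coulombIntegral κ κ τ - 4 * κ * coulombIntegral κ (κ - 1) τ +
        4 * κ * (κ - 1) * coulombIntegral κ (κ - 2) τ) * Complex.I_sq
  · have := hN1lim.sub (hf.const_mul Complex.I)
    rw [mul_zero, sub_zero] at this
    refine this.congr fun τ => ?_
    ring

end Coulomb

/-! ### Asymptotics of the Jost solution and its amplitudes. -/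

section Jost

variable {a : ℝ} {f f₁ : ℝ → ℂ}

/-- The free phase `e^{-i Ψ̃(τ)}`, to which the Jost solution is asymptotic. -/
noncomputable def phase (a τ : ℝ) : ℂ := Complex.exp (-(Complex.I * (PsiTilde a τ : ℂ)))

theorem norm_phase (a τ : ℝ) : ‖phase a τ‖ = 1 := by
  simp [phase, Complex.norm_exp]

theorem conj_phase (a τ : ℝ) : conj (phase a τ) = Complex.exp (Complex.I * (PsiTilde a τ : ℂ)) := by
  rw [phase, ← Complex.exp_conj]
  simp

theorem conj_phase_mul_phase (a τ : ℝ) : conj (phase a τ) * phase a τ = 1 := by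
  rw [mul_comm, Complex.mul_conj, Complex.normSq_eq_norm_sq, norm_phase]; simp

theorem HasDerivAt.conj_ofReal {g : ℝ → ℂ} {g' : ℂ} {x : ℝ} (h : HasDerivAt g g' x) :
    HasDerivAt (fun y => conj (g y)) (conj g') x := h.star

namespace IsJost

theorem tendsto_conj_phase_mul (h : IsJost a f f₁) :
    Tendsto (fun τ => conj (phase a τ) * f τ) atTop (𝓝 1) := by
  have h1 : Tendsto (fun τ => conj (phase a τ) * (f τ - phase a τ)) atTop (𝓝 0) := by
    refine squeeze_zero_norm (fun τ => ?_) (tendsto_norm_zero.comp h.asymp_f)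
    rw [norm_mul, RCLike.norm_conj, norm_phase, one_mul]
    rfl
  have h2 := h1.add_const 1
  rw [zero_add] at h2
  refine h2.congr fun τ => ?_
  linear_combination -(conj_phase_mul_phase a τ)

theorem tendsto_conj_phase_mul_deriv (h : IsJost a f f₁) :
    Tendsto (fun τ => conj (phase a τ) * f₁ τ) atTop (𝓝 (-Complex.I)) := by
  have h1 : Tendsto (fun τ => conj (phase a τ) * (f₁ τ + Complex.I * phase a τ)) atTop (𝓝 0) := by
    refine squeeze_zero_norm (fun τ => ?_) (tendsto_norm_zero.comp h.asymp_f₁)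
    rw [norm_mul, RCLike.norm_conj, norm_phase, one_mul]
    rfl
  have h2 := h1.sub_const Complex.I
  rw [zero_sub] at h2
  refine h2.congr fun τ => ?_
  linear_combination Complex.I * (conj_phase_mul_phase a τ)

/-- The Wronskian of the Jost solution and its conjugate. -/
theorem wronskian (h : IsJost a f f₁) {τ : ℝ} (hτ : 0 < τ) :
    f τ * conj (f₁ τ) - f₁ τ * conj (f τ) = 2 * Complex.I := by
  set w : ℝ → ℂ := fun τ => f τ * conj (f₁ τ) - f₁ τ * conj (f τ) with hw
  have hder : ∀ x, 0 < x → HasDerivAt w 0 x := by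
    intro x hx
    have hf := h.deriv_f x hx
    have hf₁ := h.deriv_f₁ x hx
    have := (hf.mul hf₁.conj_ofReal).sub (hf₁.mul hf.conj_ofReal)
    convert! this using 1
    rw [map_mul, map_neg, Complex.conj_ofReal]
    ring
  have hconst : ∀ x, τ ≤ x → w x = w τ := by
    intro x hx
    refine constant_of_has_deriv_right_zero (a := τ) (b := x)
      (fun y hy => (hder y (hτ.trans_le hy.1)).continuousAt.continuousWithinAt)
      (fun y hy => (hder y (hτ.trans_le hy.1)).hasDerivWithinAt) x ⟨hx, le_rfl⟩
  have hlim : Tendsto w atTop (𝓝 (2 * Complex.I)) := by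
    have h1 := h.tendsto_conj_phase_mul
    have h2 := h.tendsto_conj_phase_mul_deriv
    have c1 := (Complex.continuous_conj.tendsto _).comp h1
    have c2 := (Complex.continuous_conj.tendsto _).comp h2
    have := (h1.mul c2).sub (h2.mul c1)
    simp only [map_one, map_neg, Complex.conj_I] at this
    convert! this using 2 with τ
    · simp only [Function.comp, map_mul, Complex.conj_conj, hw]
      linear_combination (-(f τ * conj (f₁ τ) - f₁ τ * conj (f τ))) * conj_phase_mul_phase a τ
    · ring
  have hlim' : Tendsto w atTop (𝓝 (w τ)) :=
    tendsto_const_nhds.congr' (by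
      filter_upwards [eventually_ge_atTop τ] with x hx using (hconst x hx).symm)
  exact tendsto_nhds_unique hlim' hlim

/-- At infinity conj f ~ e^{iΨ̃} and conj f₁ ~ i e^{iΨ̃}, so the leading terms cancel. This is why
the conjugate mode leaves no trace in the asymptotics of ω̂. -/
theorem tendsto_conj_add (h : IsJost a f f₁) :
    Tendsto (fun τ => conj (f τ) + Complex.I * conj (f₁ τ)) atTop (𝓝 0) := by
  have c1 := (Complex.continuous_conj.tendsto _).comp h.asymp_f
  have c2 := (Complex.continuous_conj.tendsto _).comp h.asymp_f₁
  have := c1.add (c2.const_mul Complex.I)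
  simp only [map_zero, mul_zero, add_zero] at this
  refine this.congr fun τ => ?_
  simp only [Function.comp, map_sub, map_add, map_mul, Complex.conj_I]
  linear_combination (-(conj (Complex.exp (-(Complex.I * (PsiTilde a τ : ℂ)))))) * Complex.I_sq

theorem tendsto_add_sub (h : IsJost a f f₁) :
    Tendsto (fun τ => f τ + Complex.I * f₁ τ - 2 * phase a τ) atTop (𝓝 0) := by
  have := h.asymp_f.add (h.asymp_f₁.const_mul Complex.I)
  simp only [mul_zero, add_zero] at this
  refine this.congr fun τ => ?_
  simp only [phase]
  linear_combination (Complex.exp (-(Complex.I * (PsiTilde a τ : ℂ)))) * Complex.I_sq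

theorem tendsto_conj_sub (h : IsJost a f f₁) :
    Tendsto (fun τ => conj (f τ) - conj (phase a τ)) atTop (𝓝 0) := by
  have c1 := (Complex.continuous_conj.tendsto _).comp h.asymp_f
  rw [map_zero] at c1
  refine c1.congr fun τ => ?_
  simp [phase]

end IsJost

/-- With x = a²/s and r = √(1 - x), the quantity equals -(1 - r)²/2, while the bound is x²/2 = (1 -
r²)²/2. -/
theorem norm_alpha_expansion_le {a s : ℝ} (hs : 0 < s) (h : a ^ 2 ≤ s) :
    ‖alpha a s - 1 + a ^ 2 / (2 * s)‖ ≤ a ^ 4 / 2 * s ^ (-2 : ℝ) := by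
  have hx0 : 0 ≤ a ^ 2 / s := by positivity
  have hx1 : a ^ 2 / s ≤ 1 := (div_le_one hs).2 h
  have e1 : a ^ 2 / (2 * s) = a ^ 2 / s / 2 := by field_simp
  have e2 : a ^ 4 / 2 * s ^ (-2 : ℝ) = (a ^ 2 / s) ^ 2 / 2 := by
    rw [Real.rpow_neg hs.le, show (2 : ℝ) = ((2 : ℕ) : ℝ) by norm_num, Real.rpow_natCast]
    field_simp
  rw [e1, e2, alpha]
  generalize a ^ 2 / s = x at hx0 hx1
  have hr0 : 0 ≤ Real.sqrt (1 - x) := Real.sqrt_nonneg _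
  have hr : Real.sqrt (1 - x) ^ 2 = 1 - x := Real.sq_sqrt (by linarith)
  generalize Real.sqrt (1 - x) = r at hr0 hr
  have hr1 : r ≤ 1 := by nlinarith
  have hx : x = 1 - r ^ 2 := by linarith
  subst hx
  rw [Real.norm_eq_abs, abs_le]
  constructor
  · nlinarith [sq_nonneg (1 - r), mul_nonneg hr0 (sq_nonneg (1 - r)), sq_nonneg (1 - r ^ 2),
      mul_nonneg (sq_nonneg (1 - r)) (sq_nonneg r)]
  · nlinarith [sq_nonneg (1 - r), sq_nonneg (1 - r ^ 2)]

/-- The difference is the tail of an integrand of size s^{-2}, hence O(1/τ). It lets amplitudes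
defined with Ψ be compared with a Jost solution normalised by Ψ̃. -/
theorem tendsto_Psi_sub_PsiTilde (a : ℝ) :
    Tendsto (fun τ => Psi a τ - PsiTilde a τ) atTop (𝓝 0) := by
  refine squeeze_zero_norm' (a := fun τ : ℝ => a ^ 4 / 2 * τ⁻¹) ?_ ?_
  · filter_upwards [eventually_ge_atTop (a ^ 2), eventually_gt_atTop 0] with τ h hτ
    have hint : IntegrableOn (fun s : ℝ => a ^ 4 / 2 * s ^ (-2 : ℝ)) (Ioi τ) :=
      (integrableOn_Ioi_rpow_of_lt (by norm_num) hτ).const_mul _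
    have key := norm_integral_le_of_norm_le (μ := volume.restrict (Ioi τ))
      (f := fun s => alpha a s - 1 + a ^ 2 / (2 * s)) hint (by
        filter_upwards [ae_restrict_mem measurableSet_Ioi] with s hs
        exact norm_alpha_expansion_le (hτ.trans hs) (h.trans (le_of_lt hs)))
    rw [integral_const_mul, integral_Ioi_rpow_of_lt (by norm_num) hτ] at key
    have e : -τ ^ ((-2 : ℝ) + 1) / (-2 + 1) = τ⁻¹ := by
      norm_num [Real.rpow_neg_one]
    rw [e] at key
    rw [Psi, PsiTilde, show ∀ x y : ℝ, x - y - x = -y by intros; ring, norm_neg]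
    exact key
  · have := (tendsto_inv_atTop_zero (𝕜 := ℝ)).const_mul (a ^ 4 / 2)
    rwa [mul_zero] at this

theorem tendsto_alpha (a : ℝ) : Tendsto (alpha a) atTop (𝓝 1) := by
  have h1 : Tendsto (fun τ : ℝ => 1 - a ^ 2 / τ) atTop (𝓝 1) := by
    simpa using (tendsto_const_nhds (x := a ^ 2)).div_atTop tendsto_id |>.const_sub 1
  have h2 := (Real.continuous_sqrt.tendsto 1).comp h1
  rwa [Real.sqrt_one] at h2

theorem tendsto_ofReal_alpha (a : ℝ) : Tendsto (fun τ => (alpha a τ : ℂ)) atTop (𝓝 1) := by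
  have h := (Complex.continuous_ofReal.tendsto 1).comp (tendsto_alpha a)
  rwa [Complex.ofReal_one] at h

/-- The amplitude `Z₂` of the Jost solution. -/
noncomputable def jostAmp (a : ℝ) (f f₁ : ℝ → ℂ) (τ : ℝ) : ℂ :=
  Complex.exp (Complex.I * (Psi a τ : ℂ)) / 2 * (f τ - f₁ τ / (Complex.I * (alpha a τ : ℂ)))

/-- The amplitude `Z₂` of the conjugate Jost solution. -/
noncomputable def jostAmpConj (a : ℝ) (f f₁ : ℝ → ℂ) (τ : ℝ) : ℂ :=
  Complex.exp (Complex.I * (Psi a τ : ℂ)) / 2 *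
    (conj (f τ) - conj (f₁ τ) / (Complex.I * (alpha a τ : ℂ)))

theorem IsJost.tendsto_jostAmp (h : IsJost a f f₁) :
    Tendsto (jostAmp a f f₁) atTop (𝓝 1) := by
  have h1 := h.tendsto_conj_phase_mul
  have h2 := h.tendsto_conj_phase_mul_deriv
  have hα := tendsto_ofReal_alpha a
  have hE : Tendsto (fun τ => Complex.exp (Complex.I * ((Psi a τ - PsiTilde a τ : ℝ) : ℂ))) atTop
      (𝓝 1) := by
    have hc : Continuous fun x : ℝ => Complex.exp (Complex.I * (x : ℂ)) := by fun_prop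
    have := (hc.tendsto 0).comp (tendsto_Psi_sub_PsiTilde a)
    simp only [Complex.ofReal_zero, mul_zero, Complex.exp_zero] at this
    exact this
  have key := (hE.div_const 2).mul (h1.sub (h2.div (hα.const_mul Complex.I) (by simp)))
  have e : (1 : ℂ) / 2 * (1 - -Complex.I / (Complex.I * 1)) = 1 := by
    have := Complex.I_ne_zero
    field_simp
    norm_num
  rw [e] at key
  refine key.congr fun τ => ?_
  have e2 : Complex.exp (Complex.I * (Psi a τ : ℂ)) =
      Complex.exp (Complex.I * ((Psi a τ - PsiTilde a τ : ℝ) : ℂ)) * conj (phase a τ) := by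
    rw [conj_phase, ← Complex.exp_add]
    push_cast
    ring_nf
  rw [jostAmp, e2]
  simp only [Pi.div_apply]
  ring

theorem IsJost.tendsto_jostAmpConj (h : IsJost a f f₁) :
    Tendsto (jostAmpConj a f f₁) atTop (𝓝 0) := by
  have h1 := (Complex.continuous_conj.tendsto _).comp h.tendsto_conj_phase_mul
  have h2 := (Complex.continuous_conj.tendsto _).comp h.tendsto_conj_phase_mul_deriv
  have hα := tendsto_ofReal_alpha a
  have key := (h1.sub (h2.div (hα.const_mul Complex.I) (by simp)))
  have e : conj (1 : ℂ) - conj (-Complex.I) / (Complex.I * 1) = 0 := by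
    have := Complex.I_ne_zero
    simp
  rw [e] at key
  refine squeeze_zero_norm (fun τ => ?_) (tendsto_norm_zero.comp key)
  have hn : ‖Complex.exp (Complex.I * (Psi a τ : ℂ)) / 2 * conj (phase a τ)‖ ≤ 1 := by
    rw [norm_mul, RCLike.norm_conj, norm_phase, norm_div]
    simp [Complex.norm_exp]
    norm_num
  have e2 : jostAmpConj a f f₁ τ = (Complex.exp (Complex.I * (Psi a τ : ℂ)) / 2 *
      conj (phase a τ)) * (conj (conj (phase a τ) * f τ) -
        conj (conj (phase a τ) * f₁ τ) / (Complex.I * (alpha a τ : ℂ))) := by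
    rw [jostAmpConj]
    simp only [map_mul, Complex.conj_conj]
    linear_combination (-(Complex.exp (Complex.I * (Psi a τ : ℂ)) / 2 *
      (conj (f τ) - conj (f₁ τ) / (Complex.I * (alpha a τ : ℂ))))) * conj_phase_mul_phase a τ
  rw [e2, norm_mul]
  exact mul_le_of_le_one_left (norm_nonneg _) hn

/-! ### The explicit solution formula, limits of the amplitudes and the asymptotic state. -/

/-- The Fourier transform at time `t` of the solution whose component along the Jost solution
is `c`. -/
noncomputable def waveHat (f f₁ c : ℝ → ℂ) (t ξ : ℝ) : ℂ :=
  c ξ * (f (t * ξ ^ 2) + Complex.I * f₁ (t * ξ ^ 2)) +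
    conj (c (-ξ)) * (conj (f (t * ξ ^ 2)) + Complex.I * conj (f₁ (t * ξ ^ 2)))

/-- The component along the Jost solution, read off from the data at time `t₀`. -/
noncomputable def waveCoeff (f f₁ : ℝ → ℂ) (t₀ : ℝ) (W₀ : ℝ → ℂ) (ξ : ℝ) : ℂ :=
  (reHat W₀ ξ * conj (f₁ (t₀ * ξ ^ 2)) - imHat W₀ ξ * conj (f (t₀ * ξ ^ 2))) / (2 * Complex.I)

theorem conj_reHat_neg (F : ℝ → ℂ) (ξ : ℝ) : conj (reHat F (-ξ)) = reHat F ξ := by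
  simp [reHat, add_comm, map_ofNat (starRingEnd ℂ) 2]

theorem conj_imHat_neg (F : ℝ → ℂ) (ξ : ℝ) : conj (imHat F (-ξ)) = imHat F ξ := by
  have := Complex.I_ne_zero
  simp only [imHat, neg_neg, map_div₀, map_sub, map_mul, Complex.conj_conj, Complex.conj_I,
    map_ofNat]
  field_simp
  ring

theorem reHat_add_I_mul_imHat (F : ℝ → ℂ) (ξ : ℝ) : reHat F ξ + Complex.I * imHat F ξ = F ξ := by
  have := Complex.I_ne_zero
  simp only [reHat, imHat]
  field_simp
  ring

theorem reHat_waveHat (f f₁ c : ℝ → ℂ) (t ξ : ℝ) :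
    reHat (waveHat f f₁ c t) ξ = c ξ * f (t * ξ ^ 2) + conj (c (-ξ)) * conj (f (t * ξ ^ 2)) := by
  simp only [reHat, waveHat, neg_sq, neg_neg, map_add, map_mul, Complex.conj_conj, Complex.conj_I]
  ring

theorem imHat_waveHat (f f₁ c : ℝ → ℂ) (t ξ : ℝ) :
    imHat (waveHat f f₁ c t) ξ =
      c ξ * f₁ (t * ξ ^ 2) + conj (c (-ξ)) * conj (f₁ (t * ξ ^ 2)) := by
  have := Complex.I_ne_zero
  simp only [imHat, waveHat, neg_sq, neg_neg, map_add, map_mul, Complex.conj_conj, Complex.conj_I]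
  field_simp
  ring

theorem conj_waveCoeff_neg (f f₁ : ℝ → ℂ) (t₀ : ℝ) (W₀ : ℝ → ℂ) (ξ : ℝ) :
    conj (waveCoeff f f₁ t₀ W₀ (-ξ)) =
      -(reHat W₀ ξ * f₁ (t₀ * ξ ^ 2) - imHat W₀ ξ * f (t₀ * ξ ^ 2)) / (2 * Complex.I) := by
  have := Complex.I_ne_zero
  simp only [waveCoeff, map_div₀, map_sub, map_mul, Complex.conj_conj, Complex.conj_I, neg_sq,
    conj_reHat_neg, conj_imHat_neg, map_ofNat]
  field_simp

/-- Cramer's rule in the basis f, conj f, whose determinant is the Wronskian 2i. -/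
theorem IsJost.solve (h : IsJost a f f₁) {τ : ℝ} (hτ : 0 < τ) (u v : ℂ) :
    (u * conj (f₁ τ) - v * conj (f τ)) / (2 * Complex.I) * f τ +
        -(u * f₁ τ - v * f τ) / (2 * Complex.I) * conj (f τ) = u ∧
      (u * conj (f₁ τ) - v * conj (f τ)) / (2 * Complex.I) * f₁ τ +
        -(u * f₁ τ - v * f τ) / (2 * Complex.I) * conj (f₁ τ) = v := by
  have hw := h.wronskian hτ
  have := Complex.I_ne_zero
  constructor
  · field_simp
    linear_combination u * hw
  · field_simp
    linear_combination v * hw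

theorem IsJost.waveHat_waveCoeff (h : IsJost a f f₁) {t₀ ξ : ℝ} (ht₀ : 0 < t₀) (hξ : ξ ≠ 0)
    (W₀ : ℝ → ℂ) : waveHat f f₁ (waveCoeff f f₁ t₀ W₀) t₀ ξ = W₀ ξ := by
  have hτ : 0 < t₀ * ξ ^ 2 := by positivity
  have hs := h.solve hτ (reHat W₀ ξ) (imHat W₀ ξ)
  rw [← reHat_add_I_mul_imHat W₀ ξ, waveHat, conj_waveCoeff_neg, waveCoeff]
  linear_combination hs.1 + Complex.I * hs.2

theorem ampZ_waveHat (a : ℝ) (f f₁ c : ℝ → ℂ) (t ξ : ℝ) : ampZ a t (waveHat f f₁ c t) ξ =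
    c ξ * jostAmp a f f₁ (t * ξ ^ 2) + conj (c (-ξ)) * jostAmpConj a f f₁ (t * ξ ^ 2) := by
  rw [ampZ, reHat_waveHat, imHat_waveHat, jostAmp, jostAmpConj]
  ring

theorem conj_exp_I_mul_ofReal (x : ℝ) :
    conj (Complex.exp (Complex.I * x)) = Complex.exp (-(Complex.I * x)) := by
  rw [← Complex.exp_conj]; simp

theorem ampY_waveHat (a : ℝ) (f f₁ c : ℝ → ℂ) (t ξ : ℝ) : ampY a t (waveHat f f₁ c t) ξ =
    c ξ * conj (jostAmpConj a f f₁ (t * ξ ^ 2)) +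
      conj (c (-ξ)) * conj (jostAmp a f f₁ (t * ξ ^ 2)) := by
  rw [ampY, reHat_waveHat, imHat_waveHat, jostAmp, jostAmpConj]
  simp only [map_mul, map_sub, map_div₀, Complex.conj_conj, Complex.conj_I, Complex.conj_ofReal,
    conj_exp_I_mul_ofReal, map_ofNat]
  ring

theorem tendsto_mul_sq_atTop {ξ : ℝ} (hξ : ξ ≠ 0) :
    Tendsto (fun t : ℝ => t * ξ ^ 2) atTop atTop :=
  tendsto_id.atTop_mul_const (by positivity)

theorem IsJost.tendsto_ampZ (h : IsJost a f f₁) (c : ℝ → ℂ) {ξ : ℝ} (hξ : ξ ≠ 0) :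
    Tendsto (fun t => ampZ a t (waveHat f f₁ c t) ξ) atTop (𝓝 (c ξ)) := by
  have h1 := (h.tendsto_jostAmp.comp (tendsto_mul_sq_atTop hξ)).const_mul (c ξ)
  have h2 := (h.tendsto_jostAmpConj.comp (tendsto_mul_sq_atTop hξ)).const_mul (conj (c (-ξ)))
  have h3 := h1.add h2
  rw [mul_one, mul_zero, add_zero] at h3
  exact h3.congr fun t => (ampZ_waveHat a f f₁ c t ξ).symm

theorem IsJost.tendsto_ampY (h : IsJost a f f₁) (c : ℝ → ℂ) {ξ : ℝ} (hξ : ξ ≠ 0) :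
    Tendsto (fun t => ampY a t (waveHat f f₁ c t) ξ) atTop (𝓝 (conj (c (-ξ)))) := by
  have h1 := (((Complex.continuous_conj.tendsto _).comp h.tendsto_jostAmp).comp
    (tendsto_mul_sq_atTop hξ)).const_mul (conj (c (-ξ)))
  have h2 := (((Complex.continuous_conj.tendsto _).comp h.tendsto_jostAmpConj).comp
    (tendsto_mul_sq_atTop hξ)).const_mul (c ξ)
  have h3 := h2.add h1
  rw [map_one, map_zero, mul_one, mul_zero, zero_add] at h3
  exact h3.congr fun t => (ampY_waveHat a f f₁ c t ξ).symm

/-- The Fourier transform of the asymptotic state. -/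
noncomputable def asympState (a : ℝ) (c : ℝ → ℂ) (ξ : ℝ) : ℂ :=
  2 * Complex.exp (Complex.I * ((a ^ 2 * Real.log |ξ| : ℝ) : ℂ)) * c ξ

theorem coeff_eq_asympState (a : ℝ) (c : ℝ → ℂ) (ξ : ℝ) :
    c ξ = 1 / 2 * Complex.exp (-(Complex.I * ((a ^ 2 * Real.log |ξ| : ℝ) : ℂ))) *
      asympState a c ξ := by
  rw [asympState, Complex.exp_neg]
  have := Complex.exp_ne_zero (Complex.I * ((a ^ 2 * Real.log |ξ| : ℝ) : ℂ))
  field_simp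

theorem conj_coeff_eq_asympState (a : ℝ) (c : ℝ → ℂ) (ξ : ℝ) :
    conj (c (-ξ)) = 1 / 2 * Complex.exp (Complex.I * ((a ^ 2 * Real.log |ξ| : ℝ) : ℂ)) *
      conj (asympState a c (-ξ)) := by
  conv_lhs => rw [coeff_eq_asympState a c (-ξ)]
  rw [map_mul, map_mul, ← conj_exp_I_mul_ofReal, Complex.conj_conj, abs_neg]
  simp [map_ofNat (starRingEnd ℂ) 2]

/-- Since log(tξ²) = log t + 2 log|ξ|, the Coulomb phase splits into a part depending on t and the
factor e^{ia² log|ξ|}; the latter is absorbed into `asympState`. -/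
theorem phase_mul_asympState (a : ℝ) (c : ℝ → ℂ) {t ξ : ℝ} (ht : 0 < t) (hξ : ξ ≠ 0) :
    Complex.exp (-(Complex.I * ((t * ξ ^ 2 : ℝ) : ℂ))) *
      Complex.exp (Complex.I * ((a ^ 2 / 2 * Real.log t : ℝ) : ℂ)) * asympState a c ξ =
    2 * phase a (t * ξ ^ 2) * c ξ := by
  have e : phase a (t * ξ ^ 2) = Complex.exp (-(Complex.I * ((t * ξ ^ 2 : ℝ) : ℂ))) *
      Complex.exp (Complex.I * ((a ^ 2 / 2 * Real.log t : ℝ) : ℂ)) *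
      Complex.exp (Complex.I * ((a ^ 2 * Real.log |ξ| : ℝ) : ℂ)) := by
    rw [phase, PsiTilde, Real.log_mul ht.ne' (by positivity), Real.log_pow, Real.log_abs,
      ← Complex.exp_add, ← Complex.exp_add]
    congr 1
    push_cast
    ring
  rw [e, asympState]
  ring

theorem IsJost.tendsto_waveHat_sub (h : IsJost a f f₁) (c : ℝ → ℂ) {ξ : ℝ} (hξ : ξ ≠ 0) :
    Tendsto (fun t : ℝ => waveHat f f₁ c t ξ -
            Complex.exp (-(Complex.I * ((t * ξ ^ 2 : ℝ) : ℂ))) *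
              Complex.exp (Complex.I * ((a ^ 2 / 2 * Real.log t : ℝ) : ℂ)) * asympState a c ξ)
          atTop (𝓝 0) := by
  have h1 := (h.tendsto_add_sub.comp (tendsto_mul_sq_atTop hξ)).const_mul (c ξ)
  have h2 := (h.tendsto_conj_add.comp (tendsto_mul_sq_atTop hξ)).const_mul (conj (c (-ξ)))
  have h3 := h1.add h2
  rw [mul_zero, mul_zero, add_zero] at h3
  refine h3.congr' ?_
  filter_upwards [eventually_gt_atTop 0] with t ht
  rw [phase_mul_asympState a c ht hξ, waveHat]
  simp only [Function.comp]
  ring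

theorem IsJost.continuousOn_waveHat (h : IsJost a f f₁) (c : ℝ → ℂ) {ξ : ℝ} (hξ : ξ ≠ 0) :
    ContinuousOn (fun t => waveHat f f₁ c t ξ) (Ioi 0) := by
  intro t ht
  have hτ : 0 < t * ξ ^ 2 := mul_pos ht (by positivity)
  have hc : ContinuousAt (fun t : ℝ => t * ξ ^ 2) t := by fun_prop
  have h1 : ContinuousAt (fun t : ℝ => f (t * ξ ^ 2)) t :=
    ContinuousAt.comp (f := fun t : ℝ => t * ξ ^ 2) (h.deriv_f _ hτ).continuousAt hc
  have h2 : ContinuousAt (fun t : ℝ => f₁ (t * ξ ^ 2)) t :=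
    ContinuousAt.comp (f := fun t : ℝ => t * ξ ^ 2) (h.deriv_f₁ _ hτ).continuousAt hc
  refine ContinuousAt.continuousWithinAt ?_
  exact (continuousAt_const.mul (h1.add (continuousAt_const.mul h2))).add
    (continuousAt_const.mul ((Complex.continuous_conj.continuousAt.comp h1).add
      (continuousAt_const.mul (Complex.continuous_conj.continuousAt.comp h2))))

/-! ### Differentiation in the frequency and the action of J(t). -/

section Differentiability

variable {t ξ : ℝ}

theorem IsJost.hasDerivAt_comp_mul_sq (h : IsJost a f f₁) (ht : 0 < t) (hξ : ξ ≠ 0) :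
    HasDerivAt (fun η : ℝ => f (t * η ^ 2)) (2 * t * ξ * f₁ (t * ξ ^ 2)) ξ := by
  have h1 : HasDerivAt (fun η : ℝ => t * η ^ 2) (2 * t * ξ) ξ := by
    have := ((hasDerivAt_id ξ).pow 2).const_mul t
    convert! this using 1
    simp; ring
  have := (h.deriv_f (t * ξ ^ 2) (by positivity)).scomp ξ h1
  convert! this using 1
  simp

theorem IsJost.hasDerivAt_deriv_comp_mul_sq (h : IsJost a f f₁) (ht : 0 < t) (hξ : ξ ≠ 0) :
    HasDerivAt (fun η : ℝ => f₁ (t * η ^ 2))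
      (-2 * (t * ξ - a ^ 2 / ξ) * f (t * ξ ^ 2)) ξ := by
  have h1 : HasDerivAt (fun η : ℝ => t * η ^ 2) (2 * t * ξ) ξ := by
    have := ((hasDerivAt_id ξ).pow 2).const_mul t
    convert! this using 1
    simp; ring
  have := (h.deriv_f₁ (t * ξ ^ 2) (by positivity)).scomp ξ h1
  convert! this using 1
  have hξ' : (ξ : ℂ) ≠ 0 := by exact_mod_cast hξ
  have ht' : (t : ℂ) ≠ 0 := by exact_mod_cast ht.ne'
  simp only [Complex.real_smul]
  push_cast
  field_simp

theorem differentiableAt_conj_comp_neg {c : ℝ → ℂ} (h : DifferentiableAt ℝ c (-ξ)) :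
    DifferentiableAt ℝ (fun η => conj (c (-η))) ξ := by
  have h1 : HasDerivAt (fun η => c (-η)) _ ξ := h.hasDerivAt.scomp ξ (hasDerivAt_neg ξ)
  exact h1.conj_ofReal.differentiableAt

theorem IsJost.hasDerivAt_waveHat (h : IsJost a f f₁) {c : ℝ → ℂ} (ht : 0 < t) (hξ : ξ ≠ 0)
    (hc : DifferentiableAt ℝ c ξ) (hc' : DifferentiableAt ℝ c (-ξ)) :
    HasDerivAt (waveHat f f₁ c t)
      (deriv c ξ * (f (t * ξ ^ 2) + Complex.I * f₁ (t * ξ ^ 2)) +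
        c ξ * (2 * t * ξ * f₁ (t * ξ ^ 2) +
          Complex.I * (-2 * (t * ξ - a ^ 2 / ξ) * f (t * ξ ^ 2))) +
        (deriv (fun η => conj (c (-η))) ξ *
            (conj (f (t * ξ ^ 2)) + Complex.I * conj (f₁ (t * ξ ^ 2))) +
          conj (c (-ξ)) * (2 * t * ξ * conj (f₁ (t * ξ ^ 2)) +
            Complex.I * (-2 * (t * ξ - a ^ 2 / ξ) * conj (f (t * ξ ^ 2)))))) ξ := by
  have hf := h.hasDerivAt_comp_mul_sq ht hξ
  have hf₁ := h.hasDerivAt_deriv_comp_mul_sq ht hξ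
  have h1 := hc.hasDerivAt.mul (hf.add (hf₁.const_mul Complex.I))
  have h2 := (differentiableAt_conj_comp_neg hc').hasDerivAt.mul
    (hf.conj_ofReal.add (hf₁.conj_ofReal.const_mul Complex.I))
  convert! h1.add h2 using 1
  simp [map_ofNat (starRingEnd ℂ) 2]

/-- The terms with the factor tξ produced by i∂_ξ cancel against -2tξ times the transform, and only
the Coulomb potential survives. The identity is exact at each time, so the asymptotics follow
termwise. -/
theorem IsJost.fourierJ_waveHat (h : IsJost a f f₁) {c : ℝ → ℂ} (ht : 0 < t) (hξ : ξ ≠ 0)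
    (hc : DifferentiableAt ℝ c ξ) (hc' : DifferentiableAt ℝ c (-ξ)) :
    fourierJ t (waveHat f f₁ c t) ξ =
      Complex.I * deriv c ξ * (f (t * ξ ^ 2) + Complex.I * f₁ (t * ξ ^ 2)) +
      Complex.I * deriv (fun η => conj (c (-η))) ξ *
        (conj (f (t * ξ ^ 2)) + Complex.I * conj (f₁ (t * ξ ^ 2))) -
      2 * (a : ℂ) ^ 2 / ξ * (c ξ * f (t * ξ ^ 2) + conj (c (-ξ)) * conj (f (t * ξ ^ 2))) := by
  rw [fourierJ, (h.hasDerivAt_waveHat ht hξ hc hc').deriv, waveHat]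
  have hξ' : (ξ : ℂ) ≠ 0 := by exact_mod_cast hξ
  field_simp
  ring_nf
  simp only [Complex.I_sq]
  ring

theorem IsJost.tendsto_fourierJ (h : IsJost a f f₁) {c : ℝ → ℂ} (hξ : ξ ≠ 0)
    (hc : DifferentiableAt ℝ c ξ) (hc' : DifferentiableAt ℝ c (-ξ)) :
    Tendsto (fun t : ℝ => fourierJ t (waveHat f f₁ c t) ξ -
            2 * Complex.I * Complex.exp (-(Complex.I * (PsiTilde a (t * ξ ^ 2) : ℂ))) *
              deriv c ξ +
            2 * (a : ℂ) ^ 2 / (ξ : ℂ) *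
              (Complex.exp (Complex.I * (PsiTilde a (t * ξ ^ 2) : ℂ)) * conj (c (-ξ)) +
                Complex.exp (-(Complex.I * (PsiTilde a (t * ξ ^ 2) : ℂ))) * c ξ))
          atTop (𝓝 0) := by
  have hτ := tendsto_mul_sq_atTop hξ
  have h1 := (h.tendsto_add_sub.comp hτ).const_mul (Complex.I * deriv c ξ)
  have h2 := (h.tendsto_conj_add.comp hτ).const_mul
    (Complex.I * deriv (fun η => conj (c (-η))) ξ)
  have h3 := (h.asymp_f.comp hτ).const_mul (2 * (a : ℂ) ^ 2 / ξ * c ξ)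
  have h4 := (h.tendsto_conj_sub.comp hτ).const_mul (2 * (a : ℂ) ^ 2 / ξ * conj (c (-ξ)))
  have h5 := ((h1.add h2).sub h3).sub h4
  simp only [mul_zero, add_zero, sub_zero] at h5
  refine h5.congr' ?_
  filter_upwards [eventually_gt_atTop 0] with t ht
  rw [h.fourierJ_waveHat ht hξ hc hc', ← conj_phase]
  simp only [Function.comp, phase]
  ring

theorem differentiableAt_reHat {F : ℝ → ℂ} (h : DifferentiableAt ℝ F ξ)
    (h' : DifferentiableAt ℝ F (-ξ)) : DifferentiableAt ℝ (reHat F) ξ :=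
  (h.add (differentiableAt_conj_comp_neg h')).div_const 2

theorem differentiableAt_imHat {F : ℝ → ℂ} (h : DifferentiableAt ℝ F ξ)
    (h' : DifferentiableAt ℝ F (-ξ)) : DifferentiableAt ℝ (imHat F) ξ :=
  (h.sub (differentiableAt_conj_comp_neg h')).div_const _

theorem IsJost.differentiableAt_waveCoeff (h : IsJost a f f₁) {W₀ : ℝ → ℂ} (ht : 0 < t)
    (hξ : ξ ≠ 0) (h1 : DifferentiableAt ℝ W₀ ξ) (h2 : DifferentiableAt ℝ W₀ (-ξ)) :
    DifferentiableAt ℝ (waveCoeff f f₁ t W₀) ξ :=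
  (((differentiableAt_reHat h1 h2).mul
    (h.hasDerivAt_deriv_comp_mul_sq ht hξ).conj_ofReal.differentiableAt).sub
    ((differentiableAt_imHat h1 h2).mul
    (h.hasDerivAt_comp_mul_sq ht hξ).conj_ofReal.differentiableAt)).div_const _

/-- The two functions differ by the phase e^{ia² log|ξ|}, which is smooth away from the origin. -/
theorem differentiableAt_coeff_of_asympState {c : ℝ → ℂ} (hξ : ξ ≠ 0)
    (h : DifferentiableAt ℝ (asympState a c) ξ) : DifferentiableAt ℝ c ξ := by
  have hl : DifferentiableAt ℝ (fun ξ : ℝ => 1 / 2 *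
      Complex.exp (-(Complex.I * ((a ^ 2 * Real.log |ξ| : ℝ) : ℂ)))) ξ := by
    simp only [Real.log_abs]
    have h1 : DifferentiableAt ℝ (fun ξ : ℝ => ((a ^ 2 * Real.log ξ : ℝ) : ℂ)) ξ :=
      (((Real.hasDerivAt_log hξ).const_mul (a ^ 2)).ofReal_comp).differentiableAt
    exact (((h1.const_mul Complex.I).neg).cexp).const_mul _
  rw [show c = fun ξ => _ from funext (coeff_eq_asympState a c)]
  exact hl.mul h

end Differentiability

end Jost

/-! ### Time derivatives of pairings with moving test functions. -/

section Pairing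

/-- Cauchy–Schwarz against the indicator of K. It controls the remainder in the product rule below
and later yields the Hölder-1/2 bound. -/
theorem setIntegral_norm_le_eLpNorm {E : Type*} [NormedAddCommGroup E] {g : ℝ → E}
    (hg : MemLp g 2 volume) {K : Set ℝ} (hK : volume K ≠ ⊤) :
    ∫ x in K, ‖g x‖ ≤ (eLpNorm g 2 volume).toReal * (volume K).toReal ^ (1 / 2 : ℝ) := by
  have hgK : MemLp g 2 (volume.restrict K) := hg.restrict K
  have h1 := eLpNorm_le_eLpNorm_mul_rpow_measure_univ (μ := volume.restrict K) (f := g)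
    (p := 1) (q := 2) (by norm_num) hgK.1
  rw [Measure.restrict_apply_univ] at h1
  norm_num at h1
  have h2 : eLpNorm g 2 (volume.restrict K) ≤ eLpNorm g 2 volume := eLpNorm_restrict_le _ _ _ _
  have h3 : eLpNorm g 1 (volume.restrict K) ≤
      eLpNorm g 2 volume * volume K ^ (1 / 2 : ℝ) := by
    refine h1.trans ?_
    gcongr
  have hfin : eLpNorm g 2 volume * volume K ^ (1 / 2 : ℝ) ≠ ⊤ :=
    ENNReal.mul_ne_top hg.2.ne (ENNReal.rpow_ne_top_of_nonneg (by norm_num) hK)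
  have h4 := ENNReal.toReal_mono hfin h3
  rw [ENNReal.toReal_mul, ← ENNReal.toReal_rpow] at h4
  rw [integral_norm_eq_lintegral_enorm hgK.1, ← eLpNorm_one_eq_lintegral_enorm]
  exact h4

theorem memLp_two_of_continuous_of_eq_zero {ψ : ℝ → ℂ} (hψ : Continuous ψ) {K : Set ℝ}
    (hK : IsCompact K) (h0 : ∀ x, x ∉ K → ψ x = 0) : MemLp ψ 2 volume :=
  hψ.memLp_of_hasCompactSupport (HasCompactSupport.intro hK h0)

theorem integrable_mul_of_memLp_two {f g : ℝ → ℂ} (hf : MemLp f 2 volume)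
    (hg : MemLp g 2 volume) : Integrable (fun x => f x * g x) :=
  hf.integrable_mul hg

/-- The product rule for the pairing of an `L²`-continuous curve with a moving test function. -/
theorem hasDerivWithinAt_pairing {S : ℝ → ℝ → ℂ} {t₀ t : ℝ} (ht : t₀ ≤ t)
    (hS : ∀ s, t₀ ≤ s → MemLp (S s) 2 volume)
    (hcont : Tendsto (fun s => eLpNorm (S s - S t) 2 volume) (𝓝[Ici t₀] t) (𝓝 0))
    {ψ : ℝ → ℝ → ℂ} {ψ' : ℝ → ℂ} {K : Set ℝ} (hK : IsCompact K) {L : ℝ} (hL : 0 ≤ L)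
    (hψ : ∀ s, t₀ ≤ s → Continuous (ψ s)) (hψ0 : ∀ s η, η ∉ K → ψ s η = 0)
    (hlip : ∀ s ∈ Icc t₀ (t + 1), ∀ η, ‖ψ s η - ψ t η‖ ≤ L * |s - t|)
    (hder : ∀ η, HasDerivWithinAt (fun s => ψ s η) (ψ' η) (Ici t₀) t) {D : ℂ}
    (hD : HasDerivWithinAt (fun s => ∫ η, S s η * ψ t η) D (Ici t₀) t) :
    HasDerivWithinAt (fun s => ∫ η, S s η * ψ s η) (D + ∫ η, S t η * ψ' η) (Ici t₀) t := by
  have hmem : ∀ s, t₀ ≤ s → MemLp (ψ s) 2 volume := fun s hs =>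
    memLp_two_of_continuous_of_eq_zero (hψ s hs) hK (hψ0 s)
  have hI : ∀ s r, t₀ ≤ s → t₀ ≤ r → Integrable (fun η => S s η * ψ r η) := fun s r hs hr =>
    integrable_mul_of_memLp_two (hS s hs) (hmem r hr)
  have hnear : ∀ᶠ s in 𝓝[Ici t₀ \ {t}] t, s ∈ Icc t₀ (t + 1) ∧ s ≠ t := by
    filter_upwards [self_mem_nhdsWithin,
      mem_nhdsWithin_of_mem_nhds (Iic_mem_nhds (lt_add_one t))] with s hs hs'
    exact ⟨⟨hs.1, hs'⟩, fun h => hs.2 h⟩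
  have hlipK : ∀ s ∈ Icc t₀ (t + 1), s ≠ t → ∀ η,
      ‖(s - t)⁻¹ • (ψ s η - ψ t η)‖ ≤ K.indicator (fun _ => L) η := by
    intro s hs hne η
    by_cases hη : η ∈ K
    · rw [indicator_of_mem hη, norm_smul, norm_inv, Real.norm_eq_abs]
      have : 0 < |s - t| := abs_pos.2 (sub_ne_zero.2 hne)
      rw [inv_mul_le_iff₀ this, mul_comm]
      exact hlip s hs η
    · simp [hψ0 s η hη, hψ0 t η hη, hη]
  -- The proof rests on S_s ψ_s = S_s ψ_t + S_t (ψ_s - ψ_t) + (S_s - S_t)(ψ_s - ψ_t). The first term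
  -- is `hD`; here the second is handled by dominated convergence.
  have h2 : HasDerivWithinAt (fun s => ∫ η, S t η * (ψ s η - ψ t η)) (∫ η, S t η * ψ' η)
      (Ici t₀) t := by
    rw [hasDerivWithinAt_iff_tendsto_slope]
    have hdom : Tendsto (fun s => ∫ η, S t η * ((s - t)⁻¹ • (ψ s η - ψ t η)))
        (𝓝[Ici t₀ \ {t}] t) (𝓝 (∫ η, S t η * ψ' η)) := by
      refine MeasureTheory.tendsto_integral_filter_of_dominated_convergence
        (fun η => ‖S t η‖ * K.indicator (fun _ => L) η) ?_ ?_ ?_ ?_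
      · filter_upwards [hnear] with s hs
        have c1 := hψ s hs.1.1
        have c2 := hψ t ht
        have hc : Continuous fun η => (s - t)⁻¹ • (ψ s η - ψ t η) := by fun_prop
        exact (hS t ht).1.mul hc.aestronglyMeasurable
      · filter_upwards [hnear] with s hs
        filter_upwards with η
        rw [norm_mul]
        exact mul_le_mul_of_nonneg_left (hlipK s hs.1 hs.2 η) (norm_nonneg _)
      · have : MemLp (K.indicator (fun _ => L)) 2 volume :=
          memLp_indicator_const 2 hK.measurableSet L (Or.inr hK.measure_lt_top.ne)
        exact (hS t ht).norm.integrable_mul this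
      · filter_upwards with η
        have := hasDerivWithinAt_iff_tendsto_slope.1 (hder η)
        refine (this.const_mul (S t η)).congr fun s => ?_
        simp [slope_def_module]
    refine hdom.congr fun s => ?_
    rw [slope_def_module]
    simp only [sub_self, mul_zero, integral_zero, sub_zero]
    rw [← integral_smul]
    refine integral_congr_ae (Eventually.of_forall fun η => ?_)
    simp only [mul_smul_comm]
  -- The Lipschitz bound absorbs the division by s - t, and L² continuity of S makes what is left
  -- tend to zero.
  have h3 : HasDerivWithinAt (fun s => ∫ η, (S s η - S t η) * (ψ s η - ψ t η)) 0 (Ici t₀) t := by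
    rw [hasDerivWithinAt_iff_tendsto_slope]
    have hlim : Tendsto (fun s => L * ((eLpNorm (S s - S t) 2 volume).toReal *
        (volume K).toReal ^ (1 / 2 : ℝ))) (𝓝[Ici t₀ \ {t}] t) (𝓝 0) := by
      have h := (ENNReal.tendsto_toReal ENNReal.zero_ne_top).comp hcont
      have := ((h.mono_left (nhdsWithin_mono t fun x (hx : x ∈ Ici t₀ \ {t}) => hx.1)).mul_const
        ((volume K).toReal ^ (1 / 2 : ℝ))).const_mul L
      simpa using this
    refine squeeze_zero_norm' ?_ hlim
    filter_upwards [hnear] with s hs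
    have hSs : MemLp (S s - S t) 2 volume := (hS s hs.1.1).sub (hS t ht)
    have hle := setIntegral_norm_le_eLpNorm hSs hK.measure_lt_top.ne
    rw [slope_def_module]
    simp only [sub_self, mul_zero, integral_zero, sub_zero]
    rw [← integral_smul]
    calc ‖∫ η, (s - t)⁻¹ • ((S s η - S t η) * (ψ s η - ψ t η))‖
        ≤ ∫ η, L * K.indicator (fun η => ‖(S s - S t) η‖) η := by
          refine norm_integral_le_of_norm_le ?_ (Eventually.of_forall fun η => ?_)
          · refine Integrable.const_mul ?_ L
            rw [integrable_indicator_iff hK.measurableSet]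
            have : IsFiniteMeasure (volume.restrict K) := ⟨by simpa using hK.measure_lt_top⟩
            exact ((hSs.restrict K).integrable (by norm_num)).norm
          · rw [← mul_smul_comm, norm_mul]
            have := hlipK s hs.1 hs.2 η
            by_cases hη : η ∈ K
            · rw [indicator_of_mem hη] at this ⊢
              rw [mul_comm]
              exact mul_le_mul_of_nonneg_right this (norm_nonneg _)
            · rw [indicator_of_notMem hη] at this ⊢
              rw [mul_zero]
              have h0 := le_antisymm this (norm_nonneg _)
              rw [h0, mul_zero]
      _ = L * ∫ η in K, ‖(S s - S t) η‖ := by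
          rw [integral_const_mul, integral_indicator hK.measurableSet]
      _ ≤ _ := mul_le_mul_of_nonneg_left hle hL
  have hsum := (hD.add h2).add h3
  rw [add_zero] at hsum
  refine hsum.congr_of_mem (fun s hs => ?_) ht
  have hs' : t₀ ≤ s := hs
  have e1 : ∫ η, S t η * (ψ s η - ψ t η) = (∫ η, S t η * ψ s η) - ∫ η, S t η * ψ t η := by
    rw [← integral_sub (hI t s ht hs') (hI t t ht ht)]
    simp only [mul_sub]
  have e2 : ∫ η, (S s η - S t η) * (ψ s η - ψ t η) = ((∫ η, S s η * ψ s η) -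
      ∫ η, S s η * ψ t η) - ((∫ η, S t η * ψ s η) - ∫ η, S t η * ψ t η) := by
    rw [← integral_sub (hI s s hs' hs') (hI s t hs' ht),
      ← integral_sub (hI t s ht hs') (hI t t ht ht), ← integral_sub]
    · refine integral_congr_ae (Eventually.of_forall fun η => ?_)
      simp only
      ring
    · exact (hI s s hs' hs').sub (hI s t hs' ht)
    · exact (hI t s ht hs').sub (hI t t ht ht)
  simp only [Pi.add_apply]
  rw [e1, e2]
  ring

/-- The symbol of `-∂ₓ²` in the frequency variable of Mathlib's Fourier transform. -/
noncomputable def freqSq (η : ℝ) : ℝ := (2 * Real.pi * η) ^ 2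

theorem freqSq_pos {η : ℝ} (h : η ≠ 0) : 0 < freqSq η := by
  have := Real.pi_ne_zero
  unfold freqSq
  positivity

theorem continuous_freqSq : Continuous freqSq := by
  unfold freqSq; fun_prop

theorem contDiff_freqSq : ContDiff ℝ (⊤ : ℕ∞) freqSq := by
  unfold freqSq; fun_prop

/-- Coulomb solutions are controlled only for τ > 0; a cutoff supported away from zero frequency
turns them into genuine test functions. -/
theorem contDiff_comp_freqSq_mul {h : ℝ → ℂ} (hh : ContDiffOn ℝ (⊤ : ℕ∞) h (Ioi 0)) {s : ℝ}
    (hs : 0 < s) {χ : ℝ → ℂ} (hχ : ContDiff ℝ (⊤ : ℕ∞) χ) (h0 : (0 : ℝ) ∉ tsupport χ) :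
    ContDiff ℝ (⊤ : ℕ∞) fun η => h (s * freqSq η) * χ η := by
  rw [contDiff_iff_contDiffAt]
  intro η
  by_cases hη : η ∈ tsupport χ
  · have hη0 : η ≠ 0 := fun h => h0 (h ▸ hη)
    have hpos : 0 < s * freqSq η := mul_pos hs (freqSq_pos hη0)
    have h1 : ContDiffAt ℝ (⊤ : ℕ∞) h (s * freqSq η) := hh.contDiffAt (Ioi_mem_nhds hpos)
    have h2 : ContDiffAt ℝ (⊤ : ℕ∞) (fun η => s * freqSq η) η :=
      (contDiff_const.mul contDiff_freqSq).contDiffAt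
    exact (ContDiffAt.comp (f := fun η => s * freqSq η) η h1 h2).mul hχ.contDiffAt
  · have : (fun η => h (s * freqSq η) * χ η) =ᶠ[𝓝 η] fun _ => 0 := by
      filter_upwards [(isClosed_tsupport χ).isOpen_compl.mem_nhds hη] with y hy
      rw [image_eq_zero_of_notMem_tsupport hy, mul_zero]
    exact contDiffAt_const.congr_of_eventuallyEq this

theorem hasDerivWithinAt_pairing_comp {S : ℝ → ℝ → ℂ} {t₀ t : ℝ} (ht₀ : 0 < t₀) (ht : t₀ ≤ t)
    (hS : ∀ s, t₀ ≤ s → MemLp (S s) 2 volume)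
    (hcont : Tendsto (fun s => eLpNorm (S s - S t) 2 volume) (𝓝[Ici t₀] t) (𝓝 0))
    {h h' : ℝ → ℂ} (hh : ContDiffOn ℝ (⊤ : ℕ∞) h (Ioi 0))
    (hh' : ContinuousOn h' (Ioi 0)) (hder : ∀ τ, 0 < τ → HasDerivAt h (h' τ) τ)
    {χ : ℝ → ℂ} (hχ : ContDiff ℝ (⊤ : ℕ∞) χ) (hχc : HasCompactSupport χ)
    (h0 : (0 : ℝ) ∉ tsupport χ) {D : ℂ}
    (hD : HasDerivWithinAt (fun s => ∫ η, S s η * (h (t * freqSq η) * χ η)) D (Ici t₀) t) :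
    HasDerivWithinAt (fun s => ∫ η, S s η * (h (s * freqSq η) * χ η))
      (D + ∫ η, S t η * (freqSq η * h' (t * freqSq η) * χ η)) (Ici t₀) t := by
  have hpos : ∀ s, t₀ ≤ s → ∀ η ∈ tsupport χ, 0 < s * freqSq η := fun s hs η hη =>
    mul_pos (ht₀.trans_le hs) (freqSq_pos fun e => h0 (e ▸ hη))
  have hd : ∀ s, t₀ ≤ s → ∀ η, HasDerivAt (fun s => h (s * freqSq η) * χ η)
      (freqSq η * h' (s * freqSq η) * χ η) s := by
    intro s hs η
    by_cases hη : η ∈ tsupport χ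
    · have h1 : HasDerivAt (fun s : ℝ => s * freqSq η) (freqSq η) s := by
        simpa using (hasDerivAt_id s).mul_const (freqSq η)
      have := ((hder _ (hpos s hs η hη)).scomp s h1).mul_const (χ η)
      simpa using this
    · rw [image_eq_zero_of_notMem_tsupport hη]
      simpa using hasDerivAt_const s (0 : ℂ)
  -- A uniform bound on the time derivative over a compact set provides the Lipschitz constant, by
  -- the mean value inequality.
  obtain ⟨L, hL⟩ : ∃ L, ∀ p ∈ Icc t₀ (t + 1) ×ˢ tsupport χ,
      ‖(freqSq p.2 : ℂ) * h' (p.1 * freqSq p.2) * χ p.2‖ ≤ L := by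
    refine IsCompact.exists_bound_of_continuousOn (isCompact_Icc.prod hχc) ?_
    have c1 : Continuous fun p : ℝ × ℝ => p.1 * freqSq p.2 :=
      continuous_fst.mul (continuous_freqSq.comp continuous_snd)
    have c2 : Continuous fun p : ℝ × ℝ => ((freqSq p.2 : ℝ) : ℂ) :=
      Complex.continuous_ofReal.comp (continuous_freqSq.comp continuous_snd)
    refine (c2.continuousOn.mul (hh'.comp c1.continuousOn ?_)).mul
      (hχ.continuous.comp continuous_snd).continuousOn
    intro p hp
    exact hpos p.1 hp.1.1 p.2 hp.2
  refine hasDerivWithinAt_pairing (K := tsupport χ) (L := max L 0) ht hS hcont hχc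
    (le_max_right _ _) ?_ ?_ ?_ ?_ hD
  · intro s hs
    exact (contDiff_comp_freqSq_mul hh (ht₀.trans_le hs) hχ h0).continuous
  · intro s η hη
    rw [image_eq_zero_of_notMem_tsupport hη, mul_zero]
  · intro s hs η
    have := (convex_Icc t₀ (t + 1)).norm_image_sub_le_of_norm_hasDerivWithin_le
      (f := fun s => h (s * freqSq η) * χ η)
      (f' := fun s => freqSq η * h' (s * freqSq η) * χ η) (C := max L 0) (x := t) (y := s)
      (fun x hx => (hd x hx.1 η).hasDerivWithinAt) (fun x hx => ?_) ⟨ht, by linarith⟩ hs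
    · simpa using this
    · by_cases hη : η ∈ tsupport χ
      · exact (hL (x, η) ⟨hx, hη⟩).trans (le_max_left _ _)
      · rw [image_eq_zero_of_notMem_tsupport hη]
        simp
  · intro η
    exact (hd t ht η).hasDerivWithinAt

end Pairing

/-! ### Conservation of Wronskians for weak solutions of the first-order system. -/

section WeakSystem

variable {a : ℝ}

/-- `g'' + (1 - a² / τ) g = 0` on `(0, ∞)`, with `g₁ = g'`. -/
structure IsCoulombPair (a : ℝ) (g g₁ : ℝ → ℂ) : Prop where
  deriv_g : ∀ τ, 0 < τ → HasDerivAt g (g₁ τ) τ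
  deriv_g₁ : ∀ τ, 0 < τ → HasDerivAt g₁ (-((1 - a ^ 2 / τ : ℝ) : ℂ) * g τ) τ

theorem IsJost.isCoulombPair {f f₁ : ℝ → ℂ} (h : IsJost a f f₁) : IsCoulombPair a f f₁ :=
  ⟨h.deriv_f, h.deriv_f₁⟩

theorem IsCoulombPair.conj {g g₁ : ℝ → ℂ} (h : IsCoulombPair a g g₁) :
    IsCoulombPair a (fun τ => conj (g τ)) (fun τ => conj (g₁ τ)) :=
  ⟨fun τ hτ => (h.deriv_g τ hτ).conj_ofReal, fun τ hτ => by
    have := (h.deriv_g₁ τ hτ).conj_ofReal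
    rwa [map_mul, map_neg, Complex.conj_ofReal] at this⟩

theorem contDiffOn_potential (n : ℕ) :
    ContDiffOn ℝ n (fun τ : ℝ => -((1 - a ^ 2 / τ : ℝ) : ℂ)) (Ioi 0) := by
  refine ContDiffOn.neg (Complex.ofRealCLM.contDiff.comp_contDiffOn ?_)
  exact contDiffOn_const.sub (contDiffOn_const.div contDiffOn_id fun x hx => ne_of_gt hx)

/-- Bootstrap: n derivatives of the pair make g' = g₁ and g₁' = -(1 - a²/τ)g of class C^n, which
gains one derivative for both. -/
theorem IsCoulombPair.contDiffOn {g g₁ : ℝ → ℂ} (h : IsCoulombPair a g g₁) :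
    ContDiffOn ℝ (⊤ : ℕ∞) g (Ioi 0) ∧ ContDiffOn ℝ (⊤ : ℕ∞) g₁ (Ioi 0) := by
  have key : ∀ n : ℕ, ContDiffOn ℝ n g (Ioi 0) ∧ ContDiffOn ℝ n g₁ (Ioi 0) := by
    intro n
    induction n with
    | zero =>
      simp only [Nat.cast_zero, contDiffOn_zero]
      exact ⟨fun τ hτ => (h.deriv_g τ hτ).continuousAt.continuousWithinAt,
        fun τ hτ => (h.deriv_g₁ τ hτ).continuousAt.continuousWithinAt⟩
    | succ n ih =>
      push_cast
      constructor
      · rw [contDiffOn_succ_iff_deriv_of_isOpen isOpen_Ioi]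
        refine ⟨fun τ hτ => (h.deriv_g τ hτ).differentiableAt.differentiableWithinAt, by simp, ?_⟩
        exact ih.2.congr fun τ hτ => (h.deriv_g τ hτ).deriv
      · rw [contDiffOn_succ_iff_deriv_of_isOpen isOpen_Ioi]
        refine ⟨fun τ hτ => (h.deriv_g₁ τ hτ).differentiableAt.differentiableWithinAt, by simp, ?_⟩
        exact ((contDiffOn_potential n).mul ih.1).congr fun τ hτ => (h.deriv_g₁ τ hτ).deriv
  exact ⟨contDiffOn_infty.2 fun n => (key n).1, contDiffOn_infty.2 fun n => (key n).2⟩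

/-- The system `S_t = ξ² T`, `T_t = -(ξ² - a² / t) S` with `ξ² = freqSq η`, tested against smooth
compactly supported functions of the frequency. -/
structure IsWeakSystem (a t₀ : ℝ) (S T : ℝ → ℝ → ℂ) : Prop where
  memLp_S : ∀ s, t₀ ≤ s → MemLp (S s) 2 volume
  memLp_T : ∀ s, t₀ ≤ s → MemLp (T s) 2 volume
  cont_S : ∀ t, t₀ ≤ t → Tendsto (fun s => eLpNorm (S s - S t) 2 volume) (𝓝[Ici t₀] t) (𝓝 0)
  cont_T : ∀ t, t₀ ≤ t → Tendsto (fun s => eLpNorm (T s - T t) 2 volume) (𝓝[Ici t₀] t) (𝓝 0)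
  deriv_S : ∀ ψ : ℝ → ℂ, ContDiff ℝ (⊤ : ℕ∞) ψ → HasCompactSupport ψ → ∀ t, t₀ ≤ t →
    HasDerivWithinAt (fun s => ∫ η, S s η * ψ η) (∫ η, T t η * (freqSq η * ψ η)) (Ici t₀) t
  deriv_T : ∀ ψ : ℝ → ℂ, ContDiff ℝ (⊤ : ℕ∞) ψ → HasCompactSupport ψ → ∀ t, t₀ ≤ t →
    HasDerivWithinAt (fun s => ∫ η, T s η * ψ η)
      (-∫ η, S t η * (((freqSq η - a ^ 2 / t : ℝ) : ℂ) * ψ η)) (Ici t₀) t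

namespace IsWeakSystem

variable {t₀ : ℝ} {S T : ℝ → ℝ → ℂ}

/-- This is the localised Wronskian of (S, T) with a classical solution evaluated at tξ². Its time
derivative vanishes because both solve the same linear system; testing against g(tξ²)χ replaces
solving that system frequency by frequency. -/
theorem pairing_const (hw : IsWeakSystem a t₀ S T) (ht₀ : 0 < t₀) {g g₁ : ℝ → ℂ}
    (hg : IsCoulombPair a g g₁) {χ : ℝ → ℂ} (hχ : ContDiff ℝ (⊤ : ℕ∞) χ)
    (hχc : HasCompactSupport χ) (h0 : (0 : ℝ) ∉ tsupport χ) {t : ℝ} (ht : t₀ ≤ t) :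
    (∫ η, S t η * (g₁ (t * freqSq η) * χ η)) - (∫ η, T t η * (g (t * freqSq η) * χ η)) =
      (∫ η, S t₀ η * (g₁ (t₀ * freqSq η) * χ η)) -
        ∫ η, T t₀ η * (g (t₀ * freqSq η) * χ η) := by
  obtain ⟨sg, sg₁⟩ := hg.contDiffOn
  have hsupp : ∀ (h : ℝ → ℂ) (s : ℝ), HasCompactSupport fun η => h (s * freqSq η) * χ η :=
    fun h s => hχc.mul_left
  have hder : ∀ r, t₀ ≤ r → HasDerivWithinAt (fun t =>
      (∫ η, S t η * (g₁ (t * freqSq η) * χ η)) - (∫ η, T t η * (g (t * freqSq η) * χ η))) 0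
      (Ici t₀) r := by
    intro r hr
    have hr0 : 0 < r := ht₀.trans_le hr
    have smg₁ := contDiff_comp_freqSq_mul sg₁ hr0 hχ h0
    have smg := contDiff_comp_freqSq_mul sg hr0 hχ h0
    have cpot : ContinuousOn (fun τ : ℝ => -((1 - a ^ 2 / τ : ℝ) : ℂ) * g τ) (Ioi 0) :=
      (contDiffOn_potential 0).continuousOn.mul sg.continuousOn
    have d1 := hasDerivWithinAt_pairing_comp ht₀ hr hw.memLp_S (hw.cont_S r hr) sg₁ cpot
      hg.deriv_g₁ hχ hχc h0 (hw.deriv_S _ smg₁ (hsupp g₁ r) r hr)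
    have d2 := hasDerivWithinAt_pairing_comp ht₀ hr hw.memLp_T (hw.cont_T r hr) sg
      sg₁.continuousOn hg.deriv_g hχ hχc h0 (hw.deriv_T _ smg (hsupp g r) r hr)
    have e1 : ∫ η, S r η * (freqSq η * (-((1 - a ^ 2 / (r * freqSq η) : ℝ) : ℂ) *
        g (r * freqSq η)) * χ η) =
        -∫ η, S r η * (((freqSq η - a ^ 2 / r : ℝ) : ℂ) * (g (r * freqSq η) * χ η)) := by
      rw [← integral_neg]
      refine integral_congr_ae (Eventually.of_forall fun η => ?_)
      by_cases hη : η ∈ tsupport χ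
      · have hη0 : η ≠ 0 := fun e => h0 (e ▸ hη)
        have hq : (freqSq η : ℂ) ≠ 0 := by exact_mod_cast (freqSq_pos hη0).ne'
        have hr' : (r : ℂ) ≠ 0 := by exact_mod_cast hr0.ne'
        push_cast
        field_simp
      · simp [image_eq_zero_of_notMem_tsupport hη]
    have e2 : ∫ η, T r η * (freqSq η * g₁ (r * freqSq η) * χ η) =
        ∫ η, T r η * (freqSq η * (g₁ (r * freqSq η) * χ η)) := by
      simp only [mul_assoc]
    rw [e1] at d1
    rw [e2] at d2
    have d := d1.sub d2
    convert! d using 1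
    ring
  exact constant_of_has_deriv_right_zero (a := t₀) (b := t)
    (fun r hr => ((hder r hr.1).continuousWithinAt).mono Icc_subset_Ici_self)
    (fun r hr => (hder r hr.1).mono (Ici_subset_Ici.2 hr.1)) t ⟨ht, le_rfl⟩

theorem locallyIntegrableOn (hS : ∀ s, t₀ ≤ s → MemLp (S s) 2 volume) {s : ℝ} (ht₀ : 0 < t₀)
    (hs : t₀ ≤ s) {h : ℝ → ℂ} (hh : ContinuousOn h (Ioi 0)) :
    LocallyIntegrableOn (fun η => S s η * h (s * freqSq η)) {0}ᶜ := by
  have hl : LocallyIntegrableOn (S s) ({0}ᶜ : Set ℝ) :=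
    ((hS s hs).locallyIntegrable (by norm_num)).locallyIntegrableOn _
  refine hl.mul_continuousOn ?_ isOpen_compl_singleton.isLocallyClosed
  refine hh.comp (continuous_const.mul continuous_freqSq).continuousOn fun η hη => ?_
  exact mul_pos (ht₀.trans_le hs) (freqSq_pos hη)

/-- Conservation against every cutoff away from the origin determines a locally integrable function
there almost everywhere. -/
theorem ae_const (hw : IsWeakSystem a t₀ S T) (ht₀ : 0 < t₀) {g g₁ : ℝ → ℂ}
    (hg : IsCoulombPair a g g₁) {t : ℝ} (ht : t₀ ≤ t) :
    ∀ᵐ η : ℝ, η ∈ ({0}ᶜ : Set ℝ) →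
      (S t η * g₁ (t * freqSq η) - T t η * g (t * freqSq η)) -
      (S t₀ η * g₁ (t₀ * freqSq η) - T t₀ η * g (t₀ * freqSq η)) = 0 := by
  obtain ⟨sg, sg₁⟩ := hg.contDiffOn
  have l1 := locallyIntegrableOn hw.memLp_S ht₀ ht sg₁.continuousOn
  have l2 := locallyIntegrableOn hw.memLp_T ht₀ ht sg.continuousOn
  have l3 := locallyIntegrableOn hw.memLp_S ht₀ le_rfl sg₁.continuousOn
  have l4 := locallyIntegrableOn hw.memLp_T ht₀ le_rfl sg.continuousOn
  refine isOpen_compl_singleton.ae_eq_zero_of_integral_contDiff_smul_eq_zero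
    ((l1.sub l2).sub (l3.sub l4)) ?_
  intro χ hχ hχc hχ0
  have h0 : (0 : ℝ) ∉ tsupport fun η => (χ η : ℂ) := fun h =>
    hχ0 (tsupport_comp_subset (g := Complex.ofReal) Complex.ofReal_zero χ h) rfl
  have hχ' : ContDiff ℝ (⊤ : ℕ∞) fun η => (χ η : ℂ) := Complex.ofRealCLM.contDiff.comp hχ
  have hχc' : HasCompactSupport fun η => (χ η : ℂ) := hχc.comp_left Complex.ofReal_zero
  have key := hw.pairing_const ht₀ hg hχ' hχc' h0 ht
  have hI : ∀ (R : ℝ → ℝ → ℂ) (hR : ∀ s, t₀ ≤ s → MemLp (R s) 2 volume) (h : ℝ → ℂ)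
      (hh : ContDiffOn ℝ (⊤ : ℕ∞) h (Ioi 0)) (s : ℝ) (hs : t₀ ≤ s),
      Integrable fun η => R s η * (h (s * freqSq η) * χ η) := fun R hR h hh s hs =>
    integrable_mul_of_memLp_two (hR s hs)
      ((contDiff_comp_freqSq_mul hh (ht₀.trans_le hs) hχ' h0).continuous.memLp_of_hasCompactSupport
        hχc'.mul_left)
  have i1 := hI S hw.memLp_S g₁ sg₁ t ht
  have i2 := hI T hw.memLp_T g sg t ht
  have i3 := hI S hw.memLp_S g₁ sg₁ t₀ le_rfl
  have i4 := hI T hw.memLp_T g sg t₀ le_rfl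
  have e := integral_sub (i1.sub i2) (i3.sub i4)
  simp only [Pi.sub_apply] at e
  rw [integral_sub i1 i2, integral_sub i3 i4, key, sub_self] at e
  rw [← e]
  refine integral_congr_ae (Eventually.of_forall fun η => ?_)
  simp only [Complex.real_smul]
  ring

end IsWeakSystem

end WeakSystem

/-! ### The L² Fourier transform under transposition, conjugation and reflection. -/

section FourierPairing

theorem ae_comp_mul_right {p : ℝ → Prop} (h : ∀ᵐ x : ℝ, p x) {b : ℝ} (hb : b ≠ 0) :
    ∀ᵐ x : ℝ, p (x * b) := by
  have hq : Measure.QuasiMeasurePreserving (fun x : ℝ => x * b) volume volume := by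
    refine ⟨measurable_id.mul_const b, ?_⟩
    rw [Real.map_volume_mul_right hb]
    exact Measure.smul_absolutelyContinuous
  exact hq.ae h

theorem ae_comp_neg {p : ℝ → Prop} (h : ∀ᵐ x : ℝ, p x) : ∀ᵐ x : ℝ, p (-x) := by
  simpa using ae_comp_mul_right h (b := -1) (by norm_num)

/-- The Fourier transform on `L²` is its own transpose. -/
theorem integral_mul_fourier_eq {f : ℝ → ℂ} (hf : MemLp f 2 volume) (ψ : 𝓢(ℝ, ℂ)) :
    ∫ x, f x * 𝓕 (ψ : ℝ → ℂ) x =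
      ∫ η, (𝓕 (hf.toLp f) : Lp ℂ 2 (volume : Measure ℝ)) η * ψ η := by
  have h := congrArg (fun T : 𝓢'(ℝ, ℂ) => T ψ)
    (Lp.fourier_toTemperedDistribution_eq (hf.toLp f))
  simp only [TemperedDistribution.fourier_apply, Lp.toTemperedDistribution_apply,
    smul_eq_mul] at h
  rw [← SchwartzMap.fourier_coe]
  calc ∫ x, f x * (𝓕 ψ) x = ∫ x, (𝓕 ψ) x * (hf.toLp f) x := by
        refine integral_congr_ae ?_
        filter_upwards [hf.coeFn_toLp] with x hx
        rw [hx, mul_comm]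
    _ = _ := by
        rw [h]
        simp only [mul_comm]

theorem deriv_fourier_of_schwartz (ψ : 𝓢(ℝ, ℂ)) :
    deriv (𝓕 (ψ : ℝ → ℂ)) = 𝓕 fun η : ℝ => (-2 * Real.pi * Complex.I * η) * ψ η := by
  have h1 : Integrable (fun x : ℝ => x • ψ x) := by
    have := ψ.integrable_pow_mul volume 1
    refine (integrable_norm_iff ?_).1 (this.congr (Eventually.of_forall fun x => ?_))
    · exact (continuous_id.smul ψ.continuous).aestronglyMeasurable
    · simp
  exact Real.deriv_fourier ψ.integrable h1

theorem conj_fourier (ψ : ℝ → ℂ) (x : ℝ) : conj (𝓕 ψ x) = 𝓕 (fun η => conj (ψ (-η))) x := by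
  rw [Real.fourier_eq', Real.fourier_eq', ← integral_conj, ← integral_neg_eq_self]
  refine integral_congr_ae (Eventually.of_forall fun η => ?_)
  simp only [smul_eq_mul, map_mul, ← Complex.exp_conj]
  simp [map_ofNat (starRingEnd ℂ) 2]

theorem memLp_conj_comp_neg {F : ℝ → ℂ} (hF : MemLp F 2 volume) :
    MemLp (fun η => conj (F (-η))) 2 volume :=
  (hF.comp_measurePreserving (Measure.measurePreserving_neg volume)).star

theorem eLpNorm_conj_comp_neg {F : ℝ → ℂ} (hF : MemLp F 2 volume) :
    eLpNorm (fun η => conj (F (-η))) 2 volume = eLpNorm F 2 volume := by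
  rw [← eLpNorm_comp_measurePreserving hF.1 (Measure.measurePreserving_neg volume)]
  refine eLpNorm_congr_norm_ae (Eventually.of_forall fun η => ?_)
  simp

theorem memLp_reHat {F : ℝ → ℂ} (hF : MemLp F 2 volume) : MemLp (reHat F) 2 volume := by
  have h := (hF.add (memLp_conj_comp_neg hF)).const_mul (2⁻¹ : ℂ)
  refine h.ae_eq (Eventually.of_forall fun η => ?_)
  simp only [Pi.add_apply, reHat]
  ring

theorem memLp_imHat {F : ℝ → ℂ} (hF : MemLp F 2 volume) : MemLp (imHat F) 2 volume := by
  have h := (hF.sub (memLp_conj_comp_neg hF)).const_mul ((2 * Complex.I)⁻¹ : ℂ)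
  refine h.ae_eq (Eventually.of_forall fun η => ?_)
  simp only [Pi.sub_apply, imHat]
  rw [div_eq_inv_mul]

theorem eLpNorm_reHat_sub_le {F G : ℝ → ℂ} (hF : MemLp F 2 volume) (hG : MemLp G 2 volume) :
    eLpNorm (reHat F - reHat G) 2 volume ≤ 2 * eLpNorm (F - G) 2 volume := by
  have hD := hF.sub hG
  have h1 := eLpNorm_add_le hD.1 (memLp_conj_comp_neg hD).1 (p := 2) (by norm_num)
  rw [eLpNorm_conj_comp_neg hD, ← two_mul] at h1
  refine le_trans (eLpNorm_mono_ae (Eventually.of_forall fun η => ?_)) h1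
  have : (reHat F - reHat G) η = 2⁻¹ * ((F - G) + fun η => conj ((F - G) (-η))) η := by
    simp only [reHat, Pi.sub_apply, Pi.add_apply, map_sub]; ring
  rw [this, norm_mul]
  refine mul_le_of_le_one_left (norm_nonneg _) ?_
  norm_num

theorem eLpNorm_imHat_sub_le {F G : ℝ → ℂ} (hF : MemLp F 2 volume) (hG : MemLp G 2 volume) :
    eLpNorm (imHat F - imHat G) 2 volume ≤ 2 * eLpNorm (F - G) 2 volume := by
  have hD := hF.sub hG
  have h1 := eLpNorm_sub_le hD.1 (memLp_conj_comp_neg hD).1 (p := 2) (by norm_num)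
  rw [eLpNorm_conj_comp_neg hD, ← two_mul] at h1
  refine le_trans (eLpNorm_mono_ae (Eventually.of_forall fun η => ?_)) h1
  have : (imHat F - imHat G) η =
      (2 * Complex.I)⁻¹ * ((F - G) - fun η => conj ((F - G) (-η))) η := by
    simp only [imHat, Pi.sub_apply, map_sub]; ring
  rw [this, norm_mul]
  refine mul_le_of_le_one_left (norm_nonneg _) ?_
  simp
  norm_num

end FourierPairing

/-! ### From the distributional equation to the explicit formula. -/

section LinearSolution

variable {a t₀ : ℝ} {ω : ℝ → ℝ → ℂ}

open Classical in
/-- The Fourier transform, in Mathlib's convention, of the solution at time `t`. -/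
noncomputable def freqSide (ω : ℝ → ℝ → ℂ) (t : ℝ) : ℝ → ℂ :=
  -- The default 0 keeps the function in L² at every time, including times before t₀.
  if h : MemLp (ω t) 2 volume then (𝓕 (h.toLp (ω t)) : Lp ℂ 2 (volume : Measure ℝ)) else 0

theorem freqSide_eq {t : ℝ} (h : MemLp (ω t) 2 volume) :
    freqSide ω t = (𝓕 (h.toLp (ω t)) : Lp ℂ 2 (volume : Measure ℝ)) := by
  rw [freqSide, dif_pos h]

theorem memLp_freqSide (t : ℝ) : MemLp (freqSide ω t) 2 volume := by
  unfold freqSide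
  split_ifs with h
  · exact Lp.memLp _
  · exact MemLp.zero

theorem eLpNorm_freqSide_sub {s t : ℝ} (hs : MemLp (ω s) 2 volume) (ht : MemLp (ω t) 2 volume) :
    eLpNorm (freqSide ω s - freqSide ω t) 2 volume = eLpNorm (ω s - ω t) 2 volume := by
  rw [freqSide_eq hs, freqSide_eq ht]
  have h1 : eLpNorm ((𝓕 (hs.toLp (ω s)) : Lp ℂ 2 (volume : Measure ℝ)) -
      (𝓕 (ht.toLp (ω t)) : Lp ℂ 2 (volume : Measure ℝ)) : ℝ → ℂ) 2 volume =
      ‖𝓕 (hs.toLp (ω s)) - 𝓕 (ht.toLp (ω t))‖ₑ := by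
    rw [Lp.enorm_def]
    exact eLpNorm_congr_ae (Lp.coeFn_sub _ _).symm
  have h2 : 𝓕 (hs.toLp (ω s)) - 𝓕 (ht.toLp (ω t)) = 𝓕 ((hs.sub ht).toLp (ω s - ω t)) := by
    rw [MemLp.toLp_sub]
    exact ((Lp.fourierTransformₗᵢ ℝ ℂ).map_sub _ _).symm
  rw [h1, h2, ← ofReal_norm, Lp.norm_fourier_eq, ofReal_norm, Lp.enorm_def]
  exact eLpNorm_congr_ae (MemLp.coeFn_toLp _)

namespace IsLinearSolution

theorem pairing (hω : IsLinearSolution a t₀ ω) {t : ℝ} (ht : t₀ ≤ t) (ψ : 𝓢(ℝ, ℂ)) :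
    ∫ x, ω t x * 𝓕 (ψ : ℝ → ℂ) x = ∫ η, freqSide ω t η * ψ η := by
  rw [freqSide_eq (hω.memLp t ht)]
  exact integral_mul_fourier_eq (hω.memLp t ht) ψ

/-- Test the equation against the Fourier transform of ψ and transpose: two x-derivatives become
multiplication by -ξ², and conj ω becomes the reflected conjugate of the transform. -/
theorem hasDerivWithinAt_pairing_freqSide (hω : IsLinearSolution a t₀ ω) {ψ : ℝ → ℂ}
    (hψ : ContDiff ℝ (⊤ : ℕ∞) ψ) (hψc : HasCompactSupport ψ) {t : ℝ} (ht : t₀ ≤ t) :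
    HasDerivWithinAt (fun s => ∫ η, freqSide ω s η * ψ η)
      (Complex.I * (-(∫ η, freqSide ω t η * (freqSq η * ψ η)) + ((a ^ 2 / (2 * t) : ℝ) : ℂ) *
        ∫ η, (freqSide ω t η + conj (freqSide ω t (-η))) * ψ η)) (Ici t₀) t := by
  set ψs : 𝓢(ℝ, ℂ) := hψc.toSchwartzMap hψ with hψs
  have hcoe : (ψs : ℝ → ℂ) = ψ := rfl
  have s1 : ContDiff ℝ (⊤ : ℕ∞) fun η : ℝ => (-2 * Real.pi * Complex.I * η) * ψ η :=
    (contDiff_const.mul Complex.ofRealCLM.contDiff).mul hψ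
  have c1 : HasCompactSupport fun η : ℝ => (-2 * Real.pi * Complex.I * η) * ψ η := hψc.mul_left
  set ψ1 : 𝓢(ℝ, ℂ) := c1.toSchwartzMap s1 with hψ1
  have s2 : ContDiff ℝ (⊤ : ℕ∞) fun η : ℝ => (-2 * Real.pi * Complex.I * η) * ψ1 η :=
    (contDiff_const.mul Complex.ofRealCLM.contDiff).mul s1
  have c2 : HasCompactSupport fun η : ℝ => (-2 * Real.pi * Complex.I * η) * ψ1 η := c1.mul_left
  set ψ2 : 𝓢(ℝ, ℂ) := c2.toSchwartzMap s2 with hψ2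
  have sr : ContDiff ℝ (⊤ : ℕ∞) fun η : ℝ => conj (ψ (-η)) :=
    Complex.conjCLE.contDiff.comp (hψ.comp contDiff_neg)
  have cr : HasCompactSupport fun η : ℝ => conj (ψ (-η)) := by
    refine HasCompactSupport.comp_left (g := conj) ?_ (map_zero _)
    exact hψc.comp_homeomorph (Homeomorph.neg ℝ)
  set ψr : 𝓢(ℝ, ℂ) := cr.toSchwartzMap sr with hψr
  have hF := memLp_freqSide (ω := ω) t
  have hψ2L : MemLp ψ 2 volume := hψ.continuous.memLp_of_hasCompactSupport hψc
  have key := hω.equation (𝓕 ψs) t ht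
  have hd : deriv (deriv (𝓕 ψs : 𝓢(ℝ, ℂ))) = 𝓕 (ψ2 : ℝ → ℂ) := by
    rw [SchwartzMap.fourier_coe, deriv_fourier_of_schwartz]
    exact deriv_fourier_of_schwartz ψ1
  have e1 : ∫ x, ω t x * deriv (deriv (𝓕 ψs : 𝓢(ℝ, ℂ))) x =
      -∫ η, freqSide ω t η * (freqSq η * ψ η) := by
    rw [hd, hω.pairing ht, ← integral_neg]
    refine integral_congr_ae (Eventually.of_forall fun η => ?_)
    change freqSide ω t η * ((-2 * Real.pi * Complex.I * η) *
      ((-2 * Real.pi * Complex.I * η) * ψ η)) = _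
    simp only [freqSq]
    push_cast
    linear_combination (4 * freqSide ω t η * Real.pi ^ 2 * η ^ 2 * ψ η) * Complex.I_sq
  have e2 : ∫ x, (ω t x + conj (ω t x)) * (𝓕 ψs : 𝓢(ℝ, ℂ)) x =
      ∫ η, (freqSide ω t η + conj (freqSide ω t (-η))) * ψ η := by
    have hφ : MemLp (𝓕 ψs : 𝓢(ℝ, ℂ)) 2 volume := (𝓕 ψs : 𝓢(ℝ, ℂ)).memLp 2 volume
    have i1 := integrable_mul_of_memLp_two (hω.memLp t ht) hφ
    have i2 := integrable_mul_of_memLp_two (hω.memLp t ht).star hφ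
    have i3 := integrable_mul_of_memLp_two hF hψ2L
    have i4 := integrable_mul_of_memLp_two (memLp_conj_comp_neg hF) hψ2L
    have e3 : ∫ x, conj (ω t x) * (𝓕 ψs : 𝓢(ℝ, ℂ)) x =
        ∫ η, conj (freqSide ω t (-η)) * ψ η := by
      have h := congrArg conj (hω.pairing ht ψr)
      rw [← integral_conj, ← integral_conj] at h
      calc _ = ∫ x, conj (ω t x * 𝓕 (ψr : ℝ → ℂ) x) := by
            refine integral_congr_ae (Eventually.of_forall fun x => ?_)
            have : conj (𝓕 (ψr : ℝ → ℂ) x) = 𝓕 (ψs : ℝ → ℂ) x := by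
              have hr : (fun η => conj (ψr (-η))) = ψs := by
                funext η
                change conj (conj (ψ (- -η))) = ψ η
                simp
              rw [conj_fourier, hr]
            simp only [map_mul, this, SchwartzMap.fourier_coe]
        _ = _ := h
        _ = _ := by
            rw [← integral_neg_eq_self]
            refine integral_congr_ae (Eventually.of_forall fun η => ?_)
            change conj (freqSide ω t (-η) * conj (ψ (- -η))) = _
            simp
    have l := integral_add i1 i2
    have r := integral_add i3 i4
    have p1 : ∫ x, ω t x * (𝓕 ψs : 𝓢(ℝ, ℂ)) x = ∫ η, freqSide ω t η * ψ η := hω.pairing ht ψs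
    calc _ = ∫ x, (ω t x * (𝓕 ψs : 𝓢(ℝ, ℂ)) x + conj (ω t x) * (𝓕 ψs : 𝓢(ℝ, ℂ)) x) := by
          simp only [add_mul]
      _ = _ := l
      _ = (∫ η, freqSide ω t η * ψ η) + ∫ η, conj (freqSide ω t (-η)) * ψ η := by
          rw [p1, ← e3]; rfl
      _ = _ := r.symm
      _ = _ := by simp only [add_mul]
  rw [e1, e2] at key
  exact key.congr_of_mem (fun s hs => (hω.pairing hs ψs).symm) ht

/-- Add to, or subtract from, the equation its conjugate tested against the reflected conjugate of
ψ. -/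
theorem isWeakSystem (hω : IsLinearSolution a t₀ ω) (ht₀ : 0 < t₀) :
    IsWeakSystem a t₀ (fun t => reHat (freqSide ω t)) (fun t => imHat (freqSide ω t)) := by
  have hlim : ∀ t, t₀ ≤ t → Tendsto (fun s => 2 * eLpNorm (freqSide ω s - freqSide ω t) 2 volume)
      (𝓝[Ici t₀] t) (𝓝 0) := by
    intro t ht
    have h := ENNReal.Tendsto.const_mul (a := 2) (hω.continuous_L2 t ht) (Or.inr (by norm_num))
    rw [mul_zero] at h
    refine h.congr' ?_
    filter_upwards [self_mem_nhdsWithin] with s hs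
    rw [eLpNorm_freqSide_sub (hω.memLp s hs) (hω.memLp t ht)]
  have hrefl : ∀ (F ψ : ℝ → ℂ), conj (∫ η, F η * conj (ψ (-η))) = ∫ η, conj (F (-η)) * ψ η := by
    intro F ψ
    rw [← integral_conj, ← integral_neg_eq_self]
    simp
  have hre : ∀ (F ψ : ℝ → ℂ), MemLp F 2 volume → MemLp ψ 2 volume → ∫ η, reHat F η * ψ η =
      2⁻¹ * ((∫ η, F η * ψ η) + conj (∫ η, F η * conj (ψ (-η)))) := by
    intro F ψ hF hψ
    rw [hrefl, ← integral_add (integrable_mul_of_memLp_two hF hψ)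
      (integrable_mul_of_memLp_two (memLp_conj_comp_neg hF) hψ), ← integral_const_mul]
    refine integral_congr_ae (Eventually.of_forall fun η => ?_)
    simp only [reHat]
    ring
  have him : ∀ (F ψ : ℝ → ℂ), MemLp F 2 volume → MemLp ψ 2 volume → ∫ η, imHat F η * ψ η =
      (2 * Complex.I)⁻¹ * ((∫ η, F η * ψ η) - conj (∫ η, F η * conj (ψ (-η)))) := by
    intro F ψ hF hψ
    rw [hrefl, ← integral_sub (integrable_mul_of_memLp_two hF hψ)
      (integrable_mul_of_memLp_two (memLp_conj_comp_neg hF) hψ), ← integral_const_mul]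
    refine integral_congr_ae (Eventually.of_forall fun η => ?_)
    simp only [imHat]
    ring
  have hF := fun t => memLp_freqSide (ω := ω) t
  have hsmooth : ∀ ψ : ℝ → ℂ, ContDiff ℝ (⊤ : ℕ∞) ψ →
      ContDiff ℝ (⊤ : ℕ∞) fun η : ℝ => conj (ψ (-η)) := fun ψ hψ =>
    Complex.conjCLE.contDiff.comp (hψ.comp contDiff_neg)
  have hcomp : ∀ ψ : ℝ → ℂ, HasCompactSupport ψ → HasCompactSupport fun η : ℝ => conj (ψ (-η)) :=
    fun ψ hψc => HasCompactSupport.comp_left (g := conj)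
      (hψc.comp_homeomorph (Homeomorph.neg ℝ)) (map_zero _)
  have hL2 : ∀ ψ : ℝ → ℂ, ContDiff ℝ (⊤ : ℕ∞) ψ → HasCompactSupport ψ → MemLp ψ 2 volume :=
    fun ψ h hc => h.continuous.memLp_of_hasCompactSupport hc
  have hsq : ∀ ψ : ℝ → ℂ, ContDiff ℝ (⊤ : ℕ∞) ψ → HasCompactSupport ψ →
      MemLp (fun η => freqSq η * ψ η) 2 volume := fun ψ h hc =>
    ((Complex.continuous_ofReal.comp continuous_freqSq).mul h.continuous).memLp_of_hasCompactSupport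
      hc.mul_left
  -- The potential term is invariant under reflection and conjugation. As it carries a factor i in
  -- the equation, it drops out for S and doubles for T.
  have hsymm : ∀ (t : ℝ) (ψ : ℝ → ℂ),
      conj (∫ η, (freqSide ω t η + conj (freqSide ω t (-η))) * conj (ψ (-η))) =
      ∫ η, (freqSide ω t η + conj (freqSide ω t (-η))) * ψ η := by
    intro t ψ
    rw [hrefl (fun η => freqSide ω t η + conj (freqSide ω t (-η)))]
    refine integral_congr_ae (Eventually.of_forall fun η => ?_)
    simp only [map_add, Complex.conj_conj, neg_neg]
    ring
  have hsqr : ∀ (t : ℝ) (ψ : ℝ → ℂ),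
      ∫ η, freqSide ω t η * (freqSq η * conj (ψ (-η))) =
      ∫ η, freqSide ω t η * conj ((fun η => freqSq η * ψ η) (-η)) := by
    intro t ψ
    refine integral_congr_ae (Eventually.of_forall fun η => ?_)
    simp [freqSq, map_ofNat (starRingEnd ℂ) 2]
  have hsum : ∀ (t : ℝ) (ψ : ℝ → ℂ),
      ∫ η, (freqSide ω t η + conj (freqSide ω t (-η))) * ψ η =
      2 * ∫ η, reHat (freqSide ω t) η * ψ η := by
    intro t ψ
    rw [← integral_const_mul]
    refine integral_congr_ae (Eventually.of_forall fun η => ?_)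
    simp only [reHat]
    ring
  have hI := Complex.I_ne_zero
  refine ⟨fun s _ => memLp_reHat (hF s), fun s _ => memLp_imHat (hF s), ?_, ?_, ?_, ?_⟩
  · intro t ht
    exact tendsto_of_tendsto_of_tendsto_of_le_of_le tendsto_const_nhds (hlim t ht)
      (fun _ => zero_le) (fun s => eLpNorm_reHat_sub_le (hF s) (hF t))
  · intro t ht
    exact tendsto_of_tendsto_of_tendsto_of_le_of_le tendsto_const_nhds (hlim t ht)
      (fun _ => zero_le) (fun s => eLpNorm_imHat_sub_le (hF s) (hF t))
  · intro ψ hψ hψc t ht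
    have d1 := hω.hasDerivWithinAt_pairing_freqSide hψ hψc ht
    have d2 := (hω.hasDerivWithinAt_pairing_freqSide (hsmooth ψ hψ) (hcomp ψ hψc) ht).star
    have d := (d1.add d2).const_mul (2⁻¹ : ℂ)
    refine HasDerivWithinAt.congr_of_mem (f := _) ?_ (fun s _ => hre (freqSide ω s) ψ (hF s) (hL2 ψ hψ hψc)) ht
    convert! d using 1
    rw [him _ _ (hF t) (hsq ψ hψ hψc), ← hsqr]
    have := hsymm t ψ
    simp only [← starRingEnd_apply, map_mul, map_add, map_neg, Complex.conj_I, Complex.conj_ofReal]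
    rw [this]
    generalize (∫ η, freqSide ω t η * (freqSq η * ψ η)) = p
    generalize conj (∫ η, freqSide ω t η * (freqSq η * conj (ψ (-η)))) = q
    field_simp
    linear_combination (p - q) * Complex.I_sq
  · intro ψ hψ hψc t ht
    have d1 := hω.hasDerivWithinAt_pairing_freqSide hψ hψc ht
    have d2 := (hω.hasDerivWithinAt_pairing_freqSide (hsmooth ψ hψ) (hcomp ψ hψc) ht).star
    have d := (d1.sub d2).const_mul ((2 * Complex.I)⁻¹ : ℂ)
    refine HasDerivWithinAt.congr_of_mem (f := _) ?_ (fun s _ => him (freqSide ω s) ψ (hF s) (hL2 ψ hψ hψc)) ht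
    convert! d using 1
    have ht' : (t : ℂ) ≠ 0 := by exact_mod_cast (ht₀.trans_le ht).ne'
    have e : ∫ η, reHat (freqSide ω t) η * (((freqSq η - a ^ 2 / t : ℝ) : ℂ) * ψ η) =
        (∫ η, reHat (freqSide ω t) η * (freqSq η * ψ η)) -
          (a ^ 2 / t : ℝ) * ∫ η, reHat (freqSide ω t) η * ψ η := by
      rw [← integral_const_mul, ← integral_sub
        (integrable_mul_of_memLp_two (memLp_reHat (hF t)) (hsq ψ hψ hψc))
        ((integrable_mul_of_memLp_two (memLp_reHat (hF t)) (hL2 ψ hψ hψc)).const_mul _)]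
      refine integral_congr_ae (Eventually.of_forall fun η => ?_)
      push_cast
      ring
    rw [e, hre _ _ (hF t) (hsq ψ hψ hψc), ← hsqr]
    have h1 := hsymm t ψ
    simp only [← starRingEnd_apply, map_mul, map_add, map_neg, Complex.conj_I, Complex.conj_ofReal]
    rw [h1, hsum]
    push_cast
    field_simp
    ring

/-- The Fourier transform of a solution is `waveHat`, with the coefficient read off from the
data. -/
theorem waveHat_ae_eq (hω : IsLinearSolution a t₀ ω) (ht₀ : 0 < t₀) {f f₁ : ℝ → ℂ}
    (hf : IsJost a f f₁) {W₀ : ℝ → ℂ} (hW₀ : IsFourierTransform (ω t₀) W₀) {t : ℝ}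
    (ht : t₀ ≤ t) :
    ∀ᵐ η : ℝ, waveHat f f₁ (waveCoeff f f₁ t₀ W₀) t (2 * Real.pi * η) = freqSide ω t η := by
  have hw := hω.isWeakSystem ht₀
  have hπ : 2 * Real.pi ≠ 0 := by positivity
  have h0 : ∀ᵐ η : ℝ, W₀ (2 * Real.pi * η) = freqSide ω t₀ η := by
    obtain ⟨hm, hW⟩ := hW₀
    filter_upwards [ae_comp_mul_right hW hπ] with η hη
    rw [mul_comm, hη, mul_div_cancel_right₀ _ hπ, freqSide_eq hm]
  have hne : ∀ᵐ η : ℝ, η ∈ ({0}ᶜ : Set ℝ) := compl_mem_ae_iff.2 (by simp)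
  -- The conserved Wronskians with conj f and with f are 2i c(ξ) and -2i conj(c(-ξ)). Knowing both
  -- at time t determines S and T there.
  filter_upwards [hw.ae_const ht₀ hf.isCoulombPair ht, hw.ae_const ht₀ hf.isCoulombPair.conj ht,
    h0, ae_comp_neg h0, hne] with η h1 h2 h3 h4 h5
  have hτ : 0 < t * freqSq η := mul_pos (ht₀.trans_le ht) (freqSq_pos h5)
  have hs := hf.solve hτ (reHat (freqSide ω t) η) (imHat (freqSide ω t) η)
  have h1 := h1 h5
  have h2 := h2 h5
  have er : reHat W₀ (2 * Real.pi * η) = reHat (freqSide ω t₀) η := by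
    rw [mul_neg] at h4
    rw [reHat, h3, h4, reHat]
  have ei : imHat W₀ (2 * Real.pi * η) = imHat (freqSide ω t₀) η := by
    rw [mul_neg] at h4
    rw [imHat, h3, h4, imHat]
  have hq : (2 * Real.pi * η) ^ 2 = freqSq η := rfl
  rw [waveHat, conj_waveCoeff_neg, waveCoeff, er, ei, hq,
    ← reHat_add_I_mul_imHat (freqSide ω t) η]
  rw [sub_eq_zero] at h1 h2
  rw [← h1, ← h2]
  linear_combination hs.1 + Complex.I * hs.2

end IsLinearSolution

end LinearSolution

/-! ### Functions with a locally integrable weak derivative. -/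

section WeakDerivative

/-- The primitive starting left of the support is zero again to its right because the total integral
vanishes. -/
theorem exists_smooth_primitive {θ : ℝ → ℝ} (hθ : ContDiff ℝ (⊤ : ℕ∞) θ) (hθc : HasCompactSupport θ)
    (h0 : ∫ x, θ x = 0) :
    ∃ Θ : ℝ → ℝ, ContDiff ℝ (⊤ : ℕ∞) Θ ∧ HasCompactSupport Θ ∧ deriv Θ = θ := by
  obtain ⟨R₀, hR₀⟩ := hθc.isCompact.isBounded.subset_closedBall 0
  set R : ℝ := R₀ + 1 with hRdef
  have hz : ∀ x, x ∉ Ioo (-R) R → θ x = 0 := fun x hx =>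
    image_eq_zero_of_notMem_tsupport fun h => hx (by
      have := hR₀ h
      rw [Real.closedBall_eq_Icc] at this
      constructor <;> linarith [this.1, this.2])
  have hcont := hθ.continuous
  refine ⟨fun x => ∫ y in (-R)..x, θ y, ?_, ?_, ?_⟩
  · rw [contDiff_infty_iff_deriv]
    have hd : ∀ x, HasDerivAt (fun x => ∫ y in (-R)..x, θ y) (θ x) x := fun x =>
      hcont.integral_hasStrictDerivAt _ _ |>.hasDerivAt
    refine ⟨fun x => (hd x).differentiableAt, ?_⟩
    rwa [show deriv (fun x => ∫ y in (-R)..x, θ y) = θ from funext fun x => (hd x).deriv]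
  · refine HasCompactSupport.intro (isCompact_Icc (a := -R) (b := R)) fun x hx => ?_
    rcases lt_or_ge x (-R) with h | h
    · rw [intervalIntegral.integral_symm, neg_eq_zero]
      refine intervalIntegral.integral_zero_ae (Eventually.of_forall fun y hy => ?_)
      rw [uIoc_of_le h.le] at hy
      exact hz y fun h' => (not_lt.2 hy.2) h'.1
    · have hxR : R < x := by
        by_contra hcon
        exact hx ⟨h, not_lt.1 hcon⟩
      rw [← h0]
      refine intervalIntegral.integral_eq_integral_of_support_subset fun y hy => ?_
      have hy' : y ∈ Ioo (-R) R := by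
        by_contra hcon
        exact hy (hz y hcon)
      exact ⟨hy'.1, (hy'.2.trans hxR).le⟩
  · funext x
    exact (hcont.integral_hasStrictDerivAt _ _).hasDerivAt.deriv

theorem integrable_smul_of_locallyIntegrable {D : ℝ → ℂ} (hD : LocallyIntegrable D) {χ : ℝ → ℝ}
    (hχ : Continuous χ) (hχc : HasCompactSupport χ) : Integrable fun x => χ x • D x :=
  hD.integrable_smul_left_of_hasCompactSupport hχ hχc

/-- The lemma of du Bois-Reymond. -/
theorem exists_ae_eq_const_of_integral_deriv_smul {D : ℝ → ℂ} (hD : LocallyIntegrable D)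
    (h : ∀ χ : ℝ → ℝ, ContDiff ℝ (⊤ : ℕ∞) χ → HasCompactSupport χ →
      ∫ x, deriv χ x • D x = 0) : ∃ c : ℂ, ∀ᵐ x : ℝ, D x = c := by
  let b : ContDiffBump (0 : ℝ) := ⟨1, 2, one_pos, one_lt_two⟩
  set ρ : ℝ → ℝ := b.normed volume with hρ
  have sρ : ContDiff ℝ (⊤ : ℕ∞) ρ := b.contDiff_normed
  have cρ : HasCompactSupport ρ := b.hasCompactSupport_normed
  have iρ : ∫ x, ρ x = 1 := b.integral_normed
  set c : ℂ := ∫ x, ρ x • D x with hc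
  refine ⟨c, ?_⟩
  have hDc : LocallyIntegrable (fun x => D x - c) := hD.sub (locallyIntegrable_const c)
  have key := ae_eq_zero_of_integral_contDiff_smul_eq_zero hDc fun χ hχ hχc => by
    set m : ℝ := ∫ x, χ x with hm
    have iχ : Integrable χ := hχ.continuous.integrable_of_hasCompactSupport hχc
    have iρ' : Integrable ρ := sρ.continuous.integrable_of_hasCompactSupport cρ
    have c1 : HasCompactSupport fun x => m * ρ x := cρ.mul_left
    -- Removing m times a bump of integral one leaves mean zero, hence the derivative of a test
    -- function, which D annihilates. So D pairs with χ as the constant c does.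
    obtain ⟨Θ, sΘ, cΘ, dΘ⟩ := exists_smooth_primitive (θ := fun x => χ x - m * ρ x)
      (hχ.sub (contDiff_const.mul sρ)) (hχc.sub c1) (by
        rw [integral_sub iχ (iρ'.const_mul m), integral_const_mul, iρ, hm]; ring)
    have h1 := h Θ sΘ cΘ
    rw [dΘ] at h1
    have j1 := integrable_smul_of_locallyIntegrable hD hχ.continuous hχc
    have j2 := integrable_smul_of_locallyIntegrable hD sρ.continuous cρ
    have e1 : ∫ x, (χ x - m * ρ x) • D x = (∫ x, χ x • D x) - m • ∫ x, ρ x • D x := by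
      have := integral_sub j1 (j2.smul m)
      simp only [Pi.smul_apply] at this
      rw [← integral_smul, ← this]
      simp only [sub_smul, mul_smul]
    have e2 : ∫ x, χ x • (D x - c) = (∫ x, χ x • D x) - m • c := by
      simp only [smul_sub]
      rw [integral_sub j1 (iχ.smul_const c), integral_smul_const]
    rw [e2, hc, ← e1, h1]
  filter_upwards [key] with x hx using sub_eq_zero.1 hx

theorem intervalIntegrable_of_locallyIntegrable {E : Type*} [NormedAddCommGroup E] {m : ℝ → E}
    (hm : LocallyIntegrable m) (x y : ℝ) : IntervalIntegrable m volume x y :=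
  (hm.integrableOn_isCompact isCompact_uIcc).intervalIntegrable

/-- Integration by parts for absolutely continuous functions, on an interval whose endpoints lie
outside the support of χ. -/
theorem integral_deriv_mul_primitive {m : ℝ → ℝ} (hm : LocallyIntegrable m) {χ : ℝ → ℝ}
    (hχ : ContDiff ℝ (⊤ : ℕ∞) χ) (hχc : HasCompactSupport χ) :
    ∫ x, deriv χ x * ∫ y in (0 : ℝ)..x, m y = -∫ x, χ x * m x := by
  obtain ⟨R₀, hR₀⟩ := hχc.isCompact.isBounded.subset_closedBall 0
  set R : ℝ := max R₀ 0 + 1 with hRdef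
  have hR : tsupport χ ⊆ Ioo (-R) R := by
    refine hR₀.trans ?_
    rw [Real.closedBall_eq_Icc]
    intro x hx
    have := le_max_left R₀ 0
    constructor <;> linarith [hx.1, hx.2]
  have hR0 : 0 < R := by have := le_max_right R₀ 0; linarith
  have hRR : -R ≤ R := by linarith
  have z1 : χ R = 0 := image_eq_zero_of_notMem_tsupport fun h => lt_irrefl _ (hR h).2
  have z2 : χ (-R) = 0 := image_eq_zero_of_notMem_tsupport fun h => lt_irrefl _ (hR h).1
  have hmI : IntervalIntegrable m volume (-R) R :=
    intervalIntegrable_of_locallyIntegrable hm _ _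
  have acM := hmI.absolutelyContinuousOnInterval_intervalIntegral (c := 0)
    (by rw [uIcc_of_le hRR]; exact ⟨by linarith, hR0.le⟩)
  have acχ : AbsolutelyContinuousOnInterval χ (-R) R :=
    ((hχ.of_le (by simp)).contDiffOn (s := uIcc (-R) R)).absolutelyContinuousOnInterval
  have key := acM.integral_mul_deriv_eq_deriv_mul acχ
  rw [z1, z2, mul_zero, mul_zero, sub_zero, zero_sub] at key
  have e1 : ∫ x in (-R)..R, (∫ y in (0 : ℝ)..x, m y) * deriv χ x =
      ∫ x, deriv χ x * ∫ y in (0 : ℝ)..x, m y := by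
    simp only [mul_comm]
    refine intervalIntegral.integral_eq_integral_of_support_subset fun x hx => ?_
    have hx' : deriv χ x ≠ 0 := fun h => hx (by simp [h])
    have := hR (support_deriv_subset hx')
    exact ⟨this.1, this.2.le⟩
  have e2 : ∫ x in (-R)..R, deriv (fun x => ∫ y in (0 : ℝ)..x, m y) x * χ x =
      ∫ x, χ x * m x := by
    rw [← intervalIntegral.integral_eq_integral_of_support_subset (a := -R) (b := R)
      (f := fun x => χ x * m x)]
    · refine intervalIntegral.integral_congr_ae ?_
      filter_upwards [LocallyIntegrable.ae_hasDerivAt_integral hm] with x hx _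
      rw [(hx 0).deriv, mul_comm]
    · intro x hx
      have hx' : χ x ≠ 0 := fun h => hx (by simp [h])
      have := hR (subset_tsupport _ hx')
      exact ⟨this.1, this.2.le⟩
  rw [← e1, key, e2]

theorem integral_deriv_smul_primitive {m : ℝ → ℂ} (hm : LocallyIntegrable m) {χ : ℝ → ℝ}
    (hχ : ContDiff ℝ (⊤ : ℕ∞) χ) (hχc : HasCompactSupport χ) :
    ∫ x, deriv χ x • ∫ y in (0 : ℝ)..x, m y = -∫ x, χ x • m x := by
  have hII : ∀ x, IntervalIntegrable m volume 0 x := fun x =>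
    intervalIntegrable_of_locallyIntegrable hm _ _
  have hMc : Continuous fun x => ∫ y in (0 : ℝ)..x, m y :=
    intervalIntegral.continuous_primitive (intervalIntegrable_of_locallyIntegrable hm) 0
  have cd : Continuous (deriv χ) := hχ.continuous_deriv (by simp)
  have i1 : Integrable fun x => deriv χ x • ∫ y in (0 : ℝ)..x, m y :=
    (cd.smul hMc).integrable_of_hasCompactSupport hχc.deriv.smul_right
  have i2 := integrable_smul_of_locallyIntegrable hm hχ.continuous hχc
  have main : ∀ L : ℂ →L[ℝ] ℝ, L (∫ x, deriv χ x • ∫ y in (0 : ℝ)..x, m y) =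
      L (-∫ x, χ x • m x) := by
    intro L
    have hLm : LocallyIntegrable fun x => L (m x) := by
      intro x
      obtain ⟨s, hs, hi⟩ := hm x
      exact ⟨s, hs, L.integrable_comp hi⟩
    have := integral_deriv_mul_primitive hLm hχ hχc
    rw [map_neg, ← L.integral_comp_comm i1, ← L.integral_comp_comm i2]
    simp only [map_smul, smul_eq_mul]
    rw [← this]
    refine integral_congr_ae (Eventually.of_forall fun x => ?_)
    simp only
    rw [L.intervalIntegral_comp_comm (hII x)]
  exact Complex.ext (main Complex.reCLM) (main Complex.imCLM)

/-- The difference of h and the primitive of m has zero weak derivative, so du Bois-Reymond applies.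
-/
theorem exists_ae_eq_primitive {h m : ℝ → ℂ} (hh : LocallyIntegrable h) (hm : LocallyIntegrable m)
    (hw : ∀ χ : ℝ → ℝ, ContDiff ℝ (⊤ : ℕ∞) χ → HasCompactSupport χ →
      ∫ x, deriv χ x • h x = -∫ x, χ x • m x) :
    ∃ c : ℂ, ∀ᵐ x : ℝ, h x = c + ∫ y in (0 : ℝ)..x, m y := by
  have hMc : Continuous fun x => ∫ y in (0 : ℝ)..x, m y :=
    intervalIntegral.continuous_primitive (intervalIntegrable_of_locallyIntegrable hm) 0
  obtain ⟨c, hc⟩ := exists_ae_eq_const_of_integral_deriv_smul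
    (D := fun x => h x - ∫ y in (0 : ℝ)..x, m y) (hh.sub hMc.locallyIntegrable)
    (fun χ hχ hχc => by
      have cd : Continuous (deriv χ) := hχ.continuous_deriv (by simp)
      simp only [smul_sub]
      rw [integral_sub (integrable_smul_of_locallyIntegrable hh cd hχc.deriv)
        (integrable_smul_of_locallyIntegrable hMc.locallyIntegrable cd hχc.deriv),
        hw χ hχ hχc, integral_deriv_smul_primitive hm hχ hχc, sub_self])
  exact ⟨c, by filter_upwards [hc] with x hx; rw [← hx]; ring⟩

end WeakDerivative

/-! ### Conjugation of J(t) to a frequency derivative. -/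

section Galilei

/-- The factor `e^{i t ξ²}` that conjugates `J(t)` to `i ∂_ξ`, in the frequency `η = ξ / 2π`. -/
noncomputable def galilei (t η : ℝ) : ℂ := Complex.exp (Complex.I * ((t * freqSq η : ℝ) : ℂ))

theorem norm_galilei (t η : ℝ) : ‖galilei t η‖ = 1 := by
  rw [galilei, mul_comm, Complex.norm_exp_ofReal_mul_I]

theorem contDiff_galilei (t : ℝ) : ContDiff ℝ (⊤ : ℕ∞) (galilei t) := by
  unfold galilei
  exact ((contDiff_const.mul (Complex.ofRealCLM.contDiff.comp
    (contDiff_const.mul contDiff_freqSq)))).cexp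

theorem hasDerivAt_galilei (t η : ℝ) :
    HasDerivAt (galilei t) (8 * Real.pi ^ 2 * Complex.I * t * η * galilei t η) η := by
  have h1 : HasDerivAt (fun η => t * freqSq η) (t * (8 * Real.pi ^ 2 * η)) η := by
    unfold freqSq
    have := (((hasDerivAt_id η).const_mul (2 * Real.pi)).pow 2).const_mul t
    convert! this using 1
    simp only [id]
    ring
  have := (h1.ofReal_comp.const_mul Complex.I).cexp
  unfold galilei
  convert! this using 1
  push_cast
  ring

theorem memLp_galilei_mul (t : ℝ) {F : ℝ → ℂ} (hF : MemLp F 2 volume) :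
    MemLp (fun η => galilei t η * F η) 2 volume := by
  refine hF.of_le ((contDiff_galilei t).continuous.aestronglyMeasurable.mul hF.1)
    (Eventually.of_forall fun η => ?_)
  rw [norm_mul, norm_galilei, one_mul]

/-- Multiplication by x is a frequency derivative. Where it falls on e^{itξ²} it is cancelled by
-2it∂ₓ, so only the derivative of χ remains. -/
theorem fourier_galilei (t : ℝ) {χ : ℝ → ℂ} (hχ : ContDiff ℝ (⊤ : ℕ∞) χ)
    (hχc : HasCompactSupport χ) :
    ∃ ψ E : 𝓢(ℝ, ℂ), (∀ η, ψ η = galilei t η * χ η) ∧ (∀ η, E η = galilei t η * deriv χ η) ∧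
      ∀ x : ℝ, (x : ℂ) * (𝓕 ψ : 𝓢(ℝ, ℂ)) x -
        2 * Complex.I * (t : ℂ) * deriv (𝓕 ψ : 𝓢(ℝ, ℂ)) x =
          (2 * Real.pi * Complex.I)⁻¹ * 𝓕 (E : ℝ → ℂ) x := by
  have sd : ContDiff ℝ (⊤ : ℕ∞) (deriv χ) := (contDiff_infty_iff_deriv.1 hχ).2
  have s1 := (contDiff_galilei t).mul hχ
  have c1 : HasCompactSupport fun η => galilei t η * χ η := hχc.mul_left
  have s2 := (contDiff_galilei t).mul sd
  have c2 : HasCompactSupport fun η => galilei t η * deriv χ η := hχc.deriv.mul_left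
  have s3 : ContDiff ℝ (⊤ : ℕ∞) fun η : ℝ =>
      (-2 * Real.pi * Complex.I * η) * (galilei t η * χ η) :=
    (contDiff_const.mul Complex.ofRealCLM.contDiff).mul s1
  have c3 : HasCompactSupport fun η : ℝ =>
      (-2 * Real.pi * Complex.I * η) * (galilei t η * χ η) := c1.mul_left
  set ψ : 𝓢(ℝ, ℂ) := c1.toSchwartzMap s1 with hψ
  set E : 𝓢(ℝ, ℂ) := c2.toSchwartzMap s2 with hE
  set ψ1 : 𝓢(ℝ, ℂ) := c3.toSchwartzMap s3 with hψ1
  refine ⟨ψ, E, fun η => rfl, fun η => rfl, fun x => ?_⟩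
  have hd : deriv (𝓕 ψ : 𝓢(ℝ, ℂ)) x = (𝓕 ψ1 : 𝓢(ℝ, ℂ)) x := by
    rw [SchwartzMap.fourier_coe, deriv_fourier_of_schwartz]
    rfl
  have hder : deriv (ψ : ℝ → ℂ) = ((-4 * Real.pi * t : ℂ) • ψ1 + E : 𝓢(ℝ, ℂ)) := by
    funext η
    have h1 : HasDerivAt (ψ : ℝ → ℂ) _ η := (hasDerivAt_galilei t η).mul
      ((hχ.differentiable (by simp)).differentiableAt (x := η)).hasDerivAt
    rw [h1.deriv]
    change _ = (-4 * Real.pi * t : ℂ) * ((-2 * Real.pi * Complex.I * η) * (galilei t η * χ η)) +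
      galilei t η * deriv χ η
    ring
  have h2 := congrFun (Real.fourier_deriv ψ.integrable ψ.differentiable (by
    rw [hder]; exact SchwartzMap.integrable _)) x
  rw [hder, ← SchwartzMap.fourier_coe, ← SchwartzMap.fourier_coe, FourierTransform.fourier_add,
    FourierTransform.fourier_smul] at h2
  have hπ : (Real.pi : ℂ) ≠ 0 := by exact_mod_cast Real.pi_ne_zero
  have hI := Complex.I_ne_zero
  rw [hd, ← SchwartzMap.fourier_coe]
  simp only [_root_.add_apply, _root_.smul_apply, smul_eq_mul] at h2
  field_simp
  linear_combination -h2 - 4 * Real.pi * t * (𝓕 ψ1 : 𝓢(ℝ, ℂ)) x * Complex.I_sq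

/-- If `v = J(t) f`, then `e^{i t ξ²} f̂` is absolutely continuous with derivative
`-i e^{i t ξ²} v̂`. -/
theorem IsJ.exists_ae_eq_primitive {t : ℝ} {f v : ℝ → ℂ} (hf : MemLp f 2 volume)
    (hv : MemLp v 2 volume) (hJ : IsJ t f v) :
    ∃ c : ℂ, ∀ᵐ η : ℝ, galilei t η * (𝓕 (hf.toLp f) : Lp ℂ 2 (volume : Measure ℝ)) η =
      c + ∫ y in (0 : ℝ)..η, -(2 * Real.pi * Complex.I) *
        (galilei t y * (𝓕 (hv.toLp v) : Lp ℂ 2 (volume : Measure ℝ)) y) := by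
  have hF := memLp_galilei_mul t (Lp.memLp (𝓕 (hf.toLp f)))
  have hV := memLp_galilei_mul t (Lp.memLp (𝓕 (hv.toLp v)))
  refine _root_.exists_ae_eq_primitive (hF.locallyIntegrable (by norm_num))
    ((hV.const_mul (-(2 * Real.pi * Complex.I))).locallyIntegrable (by norm_num)) ?_
  intro χ hχ hχc
  have hχ' : ContDiff ℝ (⊤ : ℕ∞) fun η => (χ η : ℂ) := Complex.ofRealCLM.contDiff.comp hχ
  have hχc' : HasCompactSupport fun η => (χ η : ℂ) := hχc.comp_left Complex.ofReal_zero
  obtain ⟨ψ, E, hψ, hE, hG⟩ := fourier_galilei t hχ' hχc'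
  have key := hJ (𝓕 ψ)
  simp only [hG] at key
  have e1 : ∫ x, v x * (𝓕 ψ : 𝓢(ℝ, ℂ)) x = _ := integral_mul_fourier_eq hv ψ
  have e2 : ∫ x, f x * ((2 * Real.pi * Complex.I)⁻¹ * 𝓕 (E : ℝ → ℂ) x) =
      (2 * Real.pi * Complex.I)⁻¹ *
        ∫ η, (𝓕 (hf.toLp f) : Lp ℂ 2 (volume : Measure ℝ)) η * E η := by
    rw [← integral_mul_fourier_eq hf E, ← integral_const_mul]
    refine integral_congr_ae (Eventually.of_forall fun x => ?_)
    simp only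
    ring
  rw [e1, e2] at key
  have e3 : ∫ η, χ η • (-(2 * Real.pi * Complex.I) *
      (galilei t η * (𝓕 (hv.toLp v) : Lp ℂ 2 (volume : Measure ℝ)) η)) =
      -(2 * Real.pi * Complex.I) *
        ∫ η, (𝓕 (hv.toLp v) : Lp ℂ 2 (volume : Measure ℝ)) η * ψ η := by
    rw [← integral_const_mul]
    refine integral_congr_ae (Eventually.of_forall fun η => ?_)
    simp only [hψ, Complex.real_smul]
    ring
  have e4 : ∫ η, deriv χ η • (galilei t η * (𝓕 (hf.toLp f) : Lp ℂ 2 (volume : Measure ℝ)) η) =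
      ∫ η, (𝓕 (hf.toLp f) : Lp ℂ 2 (volume : Measure ℝ)) η * E η := by
    refine integral_congr_ae (Eventually.of_forall fun η => ?_)
    have hd : deriv (fun η => (χ η : ℂ)) η = ((deriv χ η : ℝ) : ℂ) :=
      ((hχ.differentiable (by simp)).differentiableAt (x := η)).hasDerivAt.ofReal_comp.deriv
    simp only [hE, hd, Complex.real_smul]
    ring
  have hπ : (Real.pi : ℂ) ≠ 0 := by exact_mod_cast Real.pi_ne_zero
  have hI := Complex.I_ne_zero
  rw [e3, e4, key]
  field_simp

end Galilei

/-! ### Pointwise meaning of the transform of J(t)ω(t), and the Hölder bound. -/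

section FourierJ

variable {a : ℝ} {f f₁ : ℝ → ℂ}

theorem ae_ne_zero : ∀ᵐ η : ℝ, η ≠ 0 :=
  compl_mem_ae_iff.2 (measure_singleton (0 : ℝ))

theorem IsJost.continuousOn_waveHat_freq (h : IsJost a f f₁) {c : ℝ → ℂ} {t : ℝ} (ht : 0 < t)
    (hc : ContinuousOn c {0}ᶜ) : ContinuousOn (waveHat f f₁ c t) {0}ᶜ := by
  intro ξ hξ
  have hξ' : ξ ≠ 0 := hξ
  have h1 := (h.hasDerivAt_comp_mul_sq ht hξ').continuousAt
  have h2 := (h.hasDerivAt_deriv_comp_mul_sq ht hξ').continuousAt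
  have c1 : ContinuousAt c ξ := hc.continuousAt (isOpen_compl_singleton.mem_nhds hξ)
  have c2 : ContinuousAt c (-ξ) :=
    hc.continuousAt (isOpen_compl_singleton.mem_nhds (by simpa using hξ'))
  have c3 : ContinuousAt (fun ξ => c (-ξ)) ξ :=
    ContinuousAt.comp (f := fun ξ : ℝ => -ξ) c2 continuousAt_neg
  refine ContinuousAt.continuousWithinAt ?_
  exact (c1.mul (h1.add (continuousAt_const.mul h2))).add
    ((Complex.continuous_conj.continuousAt.comp c3).mul
      ((Complex.continuous_conj.continuousAt.comp h1).add
        (continuousAt_const.mul (Complex.continuous_conj.continuousAt.comp h2))))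

theorem IsJost.continuousOn_waveCoeff (h : IsJost a f f₁) {W₀ : ℝ → ℂ} {t : ℝ} (ht : 0 < t)
    (hW : ContinuousOn W₀ {0}ᶜ) : ContinuousOn (waveCoeff f f₁ t W₀) {0}ᶜ := by
  intro ξ hξ
  have hξ' : ξ ≠ 0 := hξ
  have h1 := (h.hasDerivAt_comp_mul_sq ht hξ').continuousAt
  have h2 := (h.hasDerivAt_deriv_comp_mul_sq ht hξ').continuousAt
  have c1 : ContinuousAt W₀ ξ := hW.continuousAt (isOpen_compl_singleton.mem_nhds hξ)
  have c2 : ContinuousAt W₀ (-ξ) :=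
    hW.continuousAt (isOpen_compl_singleton.mem_nhds (by simpa using hξ'))
  have c3 : ContinuousAt (fun ξ => conj (W₀ (-ξ))) ξ :=
    Complex.continuous_conj.continuousAt.comp
      (ContinuousAt.comp (f := fun ξ : ℝ => -ξ) c2 continuousAt_neg)
  refine ContinuousAt.continuousWithinAt ?_
  have k1 : ContinuousAt (reHat W₀) ξ := (c1.add c3).div_const _
  have k2 : ContinuousAt (imHat W₀) ξ := (c1.sub c3).div_const _
  exact ((k1.mul (Complex.continuous_conj.continuousAt.comp h2)).sub
    (k2.mul (Complex.continuous_conj.continuousAt.comp h1))).div_const _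

theorem isFourierTransform_of_ae {v G : ℝ → ℂ} (hv : MemLp v 2 volume)
    (h : ∀ᵐ η : ℝ, G (2 * Real.pi * η) = (𝓕 (hv.toLp v) : Lp ℂ 2 (volume : Measure ℝ)) η) :
    IsFourierTransform v G := by
  refine ⟨hv, ?_⟩
  have hπ : (2 * Real.pi) ≠ 0 := by positivity
  filter_upwards [ae_comp_mul_right h (inv_ne_zero hπ)] with ξ hξ
  rw [div_eq_mul_inv, ← hξ]
  congr 1
  field_simp

/-- `fourierJ` is the Fourier transform of `J(t) f` as soon as the representative of `f̂` is
continuous away from the origin. -/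
theorem isFourierTransform_fourierJ {t : ℝ} {f v G : ℝ → ℂ} (hG : ContinuousOn G {0}ᶜ)
    (hf : MemLp f 2 volume)
    (hGf : ∀ᵐ η : ℝ, G (2 * Real.pi * η) = (𝓕 (hf.toLp f) : Lp ℂ 2 (volume : Measure ℝ)) η)
    (hv : MemLp v 2 volume) (hJ : IsJ t f v) : IsFourierTransform v (fourierJ t G) := by
  refine isFourierTransform_of_ae hv ?_
  obtain ⟨c, hc⟩ := hJ.exists_ae_eq_primitive hf hv
  have hV := (memLp_galilei_mul t (Lp.memLp (𝓕 (hv.toLp v)))).const_mul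
    (-(2 * Real.pi * Complex.I))
  have hVl := hV.locallyIntegrable (by norm_num)
  set V : ℝ → ℂ := ⇑(𝓕 (hv.toLp v) : Lp ℂ 2 (volume : Measure ℝ)) with hVdef
  set H : ℝ → ℂ := fun η => c + ∫ y in (0 : ℝ)..η,
    -(2 * Real.pi * Complex.I) * (galilei t y * V y) with hH
  have hHc : Continuous H := continuous_const.add
    (intervalIntegral.continuous_primitive (intervalIntegrable_of_locallyIntegrable hVl) 0)
  have hπ : (2 * Real.pi) ≠ 0 := by positivity
  have hGc : ContinuousOn (fun η => galilei t η * G (2 * Real.pi * η)) {0}ᶜ := by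
    refine (contDiff_galilei t).continuous.continuousOn.mul
      (hG.comp (by fun_prop) fun η hη => ?_)
    exact mul_ne_zero hπ hη
  -- Continuity of G is used here: almost everywhere equality with the primitive becomes equality
  -- off the origin, so G is classically differentiable almost everywhere by Lebesgue's theorem.
  have heq : EqOn (fun η => galilei t η * G (2 * Real.pi * η)) H {0}ᶜ := by
    refine Measure.eqOn_open_of_ae_eq (μ := volume) (ae_restrict_of_ae ?_)
      isOpen_compl_singleton hGc hHc.continuousOn
    filter_upwards [hc, hGf] with η h1 h2
    rw [h2, h1]
  filter_upwards [LocallyIntegrable.ae_hasDerivAt_integral hVl, ae_ne_zero] with η h1 h2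
  have hd : HasDerivAt (fun η => galilei t η * G (2 * Real.pi * η))
      (-(2 * Real.pi * Complex.I) * (galilei t η * V η)) η := by
    refine ((h1 0).const_add c).congr_of_eventuallyEq ?_
    exact heq.eventuallyEq_of_mem (isOpen_compl_singleton.mem_nhds h2)
  have hinv : ∀ η, galilei (-t) η * galilei t η = 1 := fun η => by
    rw [galilei, galilei, ← Complex.exp_add, ← Complex.exp_zero]
    congr 1
    push_cast
    ring
  have hd2 := (hasDerivAt_galilei (-t) η).mul hd
  have e : (galilei (-t) * fun η => galilei t η * G (2 * Real.pi * η)) =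
      fun η => G (2 * Real.pi * η) := by
    funext y
    simp only [Pi.mul_apply]
    rw [← mul_assoc, hinv, one_mul]
  rw [e] at hd2
  have hsc : HasDerivAt (fun ξ : ℝ => (2 * Real.pi)⁻¹ * ξ) (2 * Real.pi)⁻¹ (2 * Real.pi * η) := by
    simpa using (hasDerivAt_id (2 * Real.pi * η)).const_mul (2 * Real.pi)⁻¹
  have hy : (2 * Real.pi)⁻¹ * (2 * Real.pi * η) = η := by field_simp
  have hd3 := (HasDerivAt.scomp (h := fun ξ : ℝ => (2 * Real.pi)⁻¹ * ξ) (2 * Real.pi * η)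
    (by rw [hy]; exact hd2) hsc).congr_of_eventuallyEq (f₁ := G) (Eventually.of_forall fun ξ => by
      simp only [Function.comp]
      congr 1
      field_simp)
  rw [fourierJ, hd3.deriv]
  have hπ' : (Real.pi : ℂ) ≠ 0 := by exact_mod_cast Real.pi_ne_zero
  simp only [Complex.real_smul]
  push_cast
  field_simp
  linear_combination (-2 * (V η) * Complex.I ^ 2 - 8 * Real.pi * t * η * G (2 * Real.pi * η) *
    Complex.I ^ 2) * hinv η -
      (2 * V η + 8 * Real.pi * t * η * G (2 * Real.pi * η)) * Complex.I_sq

/-- A bound on `J(t) f` in `L²` is a Hölder bound on `e^{i t ξ²} f̂`. -/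
theorem IsJ.exists_holder {t : ℝ} {f v : ℝ → ℂ} (hf : MemLp f 2 volume) (hv : MemLp v 2 volume)
    (hJ : IsJ t f v) {C : NNReal} (hC : eLpNorm v 2 volume ≤ C) :
    ∃ H : ℝ → ℂ, (∀ x y, ‖H x - H y‖ ≤ 2 * Real.pi * C * Real.sqrt |x - y|) ∧
      ∀ᵐ η : ℝ, galilei t η * (𝓕 (hf.toLp f) : Lp ℂ 2 (volume : Measure ℝ)) η = H η := by
  obtain ⟨c, hc⟩ := hJ.exists_ae_eq_primitive hf hv
  set V : ℝ → ℂ := ⇑(𝓕 (hv.toLp v) : Lp ℂ 2 (volume : Measure ℝ)) with hVdef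
  have hVm : MemLp V 2 volume := Lp.memLp (𝓕 (hv.toLp v))
  have hV := (memLp_galilei_mul t hVm).const_mul (-(2 * Real.pi * Complex.I))
  have hVl := hV.locallyIntegrable (by norm_num)
  have hVC : (eLpNorm V 2 volume).toReal ≤ C := by
    have e : eLpNorm V 2 volume = eLpNorm v 2 volume := by
      rw [hVdef, ← Lp.enorm_def, ← ofReal_norm, Lp.norm_fourier_eq, ofReal_norm, Lp.enorm_def]
      exact eLpNorm_congr_ae (MemLp.coeFn_toLp _)
    rw [e]
    exact ENNReal.toReal_le_of_le_ofReal C.2 (by simpa using hC)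
  refine ⟨_, fun x y => ?_, hc⟩
  have hI := intervalIntegrable_of_locallyIntegrable hVl
  rw [add_sub_add_left_eq_sub, intervalIntegral.integral_interval_sub_left (hI _ _) (hI _ _),
    intervalIntegral.norm_integral_eq_norm_integral_uIoc]
  -- Cauchy–Schwarz on the interval between the two points gives the square root of its length;
  -- Plancherel bounds the other factor by C.
  have h1 := setIntegral_norm_le_eLpNorm hVm (K := uIoc y x) (by simp [uIoc])
  have h2 : (volume (uIoc y x)).toReal = |x - y| := by
    rw [Real.volume_uIoc, ENNReal.toReal_ofReal (abs_nonneg _)]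
  rw [h2, ← Real.sqrt_eq_rpow] at h1
  calc _ ≤ ∫ z in uIoc y x, ‖-(2 * Real.pi * Complex.I) * (galilei t z * V z)‖ :=
        norm_integral_le_integral_norm _
    _ = 2 * Real.pi * ∫ z in uIoc y x, ‖V z‖ := by
        rw [← integral_const_mul]
        refine integral_congr_ae (Eventually.of_forall fun z => ?_)
        simp only [norm_mul, norm_galilei, norm_neg, Complex.norm_I, Complex.norm_real, one_mul,
          mul_one, Real.norm_eq_abs, abs_of_pos Real.pi_pos, Complex.norm_ofNat]
    _ ≤ 2 * Real.pi * (C * Real.sqrt |x - y|) := by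
        gcongr
        exact h1.trans (by gcongr)
    _ = _ := by ring

end FourierJ

/-! ### Vanishing of the zero mode. -/

section ZeroMode

variable {a : ℝ} {f f₁ : ℝ → ℂ}

/-- The coefficient `c` with prescribed asymptotic state. -/
noncomputable def stateCoeff (a : ℝ) (g : ℝ → ℂ) (ξ : ℝ) : ℂ :=
  1 / 2 * Complex.exp (-(Complex.I * ((a ^ 2 * Real.log |ξ| : ℝ) : ℂ))) * g ξ

theorem continuousOn_stateCoeff (a : ℝ) {g : ℝ → ℂ} (hg : Continuous g) :
    ContinuousOn (stateCoeff a g) {0}ᶜ := by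
  unfold stateCoeff
  refine ContinuousOn.mul (continuousOn_const.mul ?_) hg.continuousOn
  refine Complex.continuous_exp.comp_continuousOn ?_
  refine (continuousOn_const.mul (Complex.continuous_ofReal.comp_continuousOn ?_)).neg
  simp only [Real.log_abs]
  exact continuousOn_const.mul Real.continuousOn_log

/-- The Hölder bound for the asymptotic state is obtained only on a set of full measure; uniform
continuity there suffices to extend it. -/
theorem exists_continuous_extension_of_holder {u : ℝ → ℂ} {A : Set ℝ} (hA : Dense A) {B : ℝ}
    (hu : ∀ x ∈ A, ∀ y ∈ A, ‖u x - u y‖ ≤ B * Real.sqrt |x - y|) :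
    ∃ g : ℝ → ℂ, Continuous g ∧ ∀ x ∈ A, g x = u x := by
  have huc : UniformContinuous fun x : A => u x := by
    have hlim : Tendsto (fun p : A × A => B * Real.sqrt |(p.1 : ℝ) - p.2|) (uniformity A)
        (𝓝 0) := by
      have h1 : Tendsto (fun p : A × A => dist p.1 p.2) (uniformity A) (𝓝 0) :=
        tendsto_uniformity_iff_dist_tendsto_zero.1 tendsto_id
      have h2 := ((Real.continuous_sqrt.tendsto 0).comp h1).const_mul B
      rw [Real.sqrt_zero, mul_zero] at h2
      exact h2
    refine tendsto_uniformity_iff_dist_tendsto_zero.2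
      (squeeze_zero (fun _ => dist_nonneg) (fun p => ?_) hlim)
    rw [dist_eq_norm]
    exact hu p.1 p.1.2 p.2 p.2.2
  have hi := isUniformInducing_val A
  have hd : DenseRange ((↑) : A → ℝ) := hA.denseRange_val
  refine ⟨(hi.isDenseInducing hd).extend fun x : A => u x,
    (uniformContinuous_uniformly_extend hi hd huc).continuous, fun x hx => ?_⟩
  exact uniformly_extend_of_ind hi hd huc ⟨x, hx⟩

/-- Otherwise f = i f₁ throughout; differentiating and using the Coulomb equation at τ = 1 gives a²
f₁(1) = 0, so f and f₁ both vanish there, against the Wronskian 2i. -/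
theorem IsJost.exists_ne_zero (h : IsJost a f f₁) (ha : 0 < a) :
    ∃ τ, 0 < τ ∧ conj (f τ) + Complex.I * conj (f₁ τ) ≠ 0 := by
  by_contra! hcon
  have h1 : ∀ τ, 0 < τ → f τ = Complex.I * f₁ τ := by
    intro τ hτ
    have := congrArg conj (hcon τ hτ)
    simp only [map_add, map_mul, Complex.conj_conj, Complex.conj_I, map_zero] at this
    linear_combination this
  have hd1 := h.deriv_f 1 one_pos
  have hd2 : HasDerivAt f (Complex.I * (-((1 - a ^ 2 / 1 : ℝ) : ℂ) * f 1)) 1 := by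
    refine ((h.deriv_f₁ 1 one_pos).const_mul Complex.I).congr_of_eventuallyEq ?_
    filter_upwards [Ioi_mem_nhds one_pos] with τ hτ using h1 τ hτ
  have he := hd1.unique hd2
  have hf := h1 1 one_pos
  have ha' : (a : ℂ) ≠ 0 := by exact_mod_cast ha.ne'
  have hz : (a : ℂ) ^ 2 * f₁ 1 = 0 := by
    rw [hf] at he
    push_cast at he
    linear_combination he - (1 - (a : ℂ) ^ 2) * f₁ 1 * Complex.I_sq
  have hz' : f₁ 1 = 0 := by
    rcases mul_eq_zero.1 hz with h2 | h2
    · exact absurd h2 (pow_ne_zero 2 ha')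
    · exact h2
  have hw := h.wronskian one_pos
  rw [hf, hz'] at hw
  simp at hw

/-- The rescaled limit at frequency `y / √t`: along a sequence of times with
`e^{-i a² log t} = ε`. -/
theorem zero_mode_relation {g : ℝ → ℂ} (hg : Continuous g)
    {B : ℝ} {H : ℝ → ℝ → ℂ} {t : ℕ → ℝ} (ht : Tendsto t atTop atTop)
    (hH : ∀ᶠ n in atTop, ∀ x y, ‖H (t n) x - H (t n) y‖ ≤ B * Real.sqrt |x - y|)
    (hHw : ∀ᶠ n in atTop, ∀ ξ, ξ ≠ 0 → Complex.exp (Complex.I * ((t n * ξ ^ 2 : ℝ) : ℂ)) *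
      waveHat f f₁ (stateCoeff a g) (t n) ξ = H (t n) ξ)
    {ε : ℂ} (hε : ∀ n, Complex.exp (-(Complex.I * ((a ^ 2 * Real.log (t n) : ℝ) : ℂ))) = ε)
    {F G : ℝ → ℂ}
    (hF : ∀ y, F y = Complex.exp (-(Complex.I * ((a ^ 2 * Real.log y : ℝ) : ℂ))) *
      Complex.exp (Complex.I * ((y ^ 2 : ℝ) : ℂ)) * (f (y ^ 2) + Complex.I * f₁ (y ^ 2)))
    (hG : ∀ y, G y = Complex.exp (Complex.I * ((a ^ 2 * Real.log y : ℝ) : ℂ)) *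
      Complex.exp (Complex.I * ((y ^ 2 : ℝ) : ℂ)) *
        (conj (f (y ^ 2)) + Complex.I * conj (f₁ (y ^ 2))))
    {y y' : ℝ} (hy : 0 < y) (hy' : 0 < y') :
    g 0 * (F y - F y') + ε * conj (g 0) * (G y - G y') = 0 := by
  -- At ξ = y/√t one has tξ² = y² and log|ξ| = log y - (log t)/2. The prefactor removes the t-phase
  -- from the first term and turns that of the conjugate term into e^{-ia² log t} = ε.
  have hform : ∀ y : ℝ, 0 < y → ∀ᶠ n in atTop,
      2 * Complex.exp (-(Complex.I * ((a ^ 2 / 2 * Real.log (t n) : ℝ) : ℂ))) *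
        H (t n) (y / Real.sqrt (t n)) =
      g (y / Real.sqrt (t n)) * F y + ε * conj (g (-(y / Real.sqrt (t n)))) * G y := by
    intro y hy
    filter_upwards [hHw, ht.eventually_gt_atTop 0] with n hn htn
    have hs : 0 < Real.sqrt (t n) := Real.sqrt_pos.2 htn
    have hξ : y / Real.sqrt (t n) ≠ 0 := by positivity
    have hsq : t n * (y / Real.sqrt (t n)) ^ 2 = y ^ 2 := by
      rw [div_pow, Real.sq_sqrt htn.le]; field_simp
    have hlog : Real.log |y / Real.sqrt (t n)| = Real.log y - Real.log (t n) / 2 := by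
      rw [Real.log_abs, Real.log_div hy.ne' hs.ne', Real.log_sqrt htn.le]
    rw [← hn _ hξ, waveHat, stateCoeff, stateCoeff, abs_neg, hsq, hlog, hF, hG, ← hε n,
      map_mul, map_mul, ← Complex.exp_conj]
    have e0 : conj (-(Complex.I * ((a ^ 2 * (Real.log y - Real.log (t n) / 2) : ℝ) : ℂ))) =
        Complex.I * ((a ^ 2 * Real.log y : ℝ) : ℂ) +
          -(Complex.I * ((a ^ 2 / 2 * Real.log (t n) : ℝ) : ℂ)) := by
      rw [map_neg, map_mul, Complex.conj_I, Complex.conj_ofReal]; push_cast; ring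
    have e1 : -(Complex.I * ((a ^ 2 * (Real.log y - Real.log (t n) / 2) : ℝ) : ℂ)) =
        -(Complex.I * ((a ^ 2 * Real.log y : ℝ) : ℂ)) +
          Complex.I * ((a ^ 2 / 2 * Real.log (t n) : ℝ) : ℂ) := by
      push_cast; ring
    have e2 : -(Complex.I * ((a ^ 2 * Real.log (t n) : ℝ) : ℂ)) =
        -(Complex.I * ((a ^ 2 / 2 * Real.log (t n) : ℝ) : ℂ)) +
        -(Complex.I * ((a ^ 2 / 2 * Real.log (t n) : ℝ) : ℂ)) := by
      push_cast; ring
    have e3 : Complex.exp (-(Complex.I * ((a ^ 2 / 2 * Real.log (t n) : ℝ) : ℂ))) *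
        Complex.exp (Complex.I * ((a ^ 2 / 2 * Real.log (t n) : ℝ) : ℂ)) = 1 := by
      rw [← Complex.exp_add, neg_add_cancel, Complex.exp_zero]
    rw [e0, e1, e2]
    simp only [Complex.exp_add, map_div₀, map_one, map_ofNat (starRingEnd ℂ) 2]
    linear_combination (Complex.exp (-(Complex.I * ((a ^ 2 * Real.log y : ℝ) : ℂ))) *
      g (y / Real.sqrt (t n)) * Complex.exp (Complex.I * ((y ^ 2 : ℝ) : ℂ)) *
      (f (y ^ 2) + Complex.I * f₁ (y ^ 2))) * e3
  have hsmall : ∀ y : ℝ, Tendsto (fun n => y / Real.sqrt (t n)) atTop (𝓝 0) := fun y =>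
    tendsto_const_nhds.div_atTop (Real.tendsto_sqrt_atTop.comp ht)
  have hlim : ∀ y : ℝ, Tendsto (fun n => g (y / Real.sqrt (t n)) * F y +
      ε * conj (g (-(y / Real.sqrt (t n)))) * G y) atTop
      (𝓝 (g 0 * F y + ε * conj (g 0) * G y)) := by
    intro y
    have h1 := (hg.tendsto 0).comp (hsmall y)
    have h2 : Tendsto (fun n => conj (g (-(y / Real.sqrt (t n))))) atTop (𝓝 (conj (g 0))) := by
      have hc : Continuous fun x : ℝ => conj (g (-x)) :=
        Complex.continuous_conj.comp (hg.comp continuous_neg)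
      have := (hc.tendsto 0).comp (hsmall y)
      rwa [neg_zero] at this
    exact (h1.mul_const _).add ((h2.const_mul ε).mul_const _)
  -- The points y/√t and y'/√t merge as t grows, so the uniform Hölder bound kills the difference.
  have hdiff : Tendsto (fun n =>
      2 * Complex.exp (-(Complex.I * ((a ^ 2 / 2 * Real.log (t n) : ℝ) : ℂ))) *
        H (t n) (y / Real.sqrt (t n)) -
      2 * Complex.exp (-(Complex.I * ((a ^ 2 / 2 * Real.log (t n) : ℝ) : ℂ))) *
        H (t n) (y' / Real.sqrt (t n))) atTop (𝓝 0) := by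
    have hz : Tendsto (fun n => 2 * (B * Real.sqrt |y / Real.sqrt (t n) - y' / Real.sqrt (t n)|))
        atTop (𝓝 0) := by
      have := (Real.continuous_sqrt.tendsto 0).comp
        (((hsmall y).sub (hsmall y')).abs.trans (by simp))
      have := (this.const_mul B).const_mul 2
      simpa using this
    refine squeeze_zero_norm' ?_ hz
    filter_upwards [hH] with n hn
    rw [← mul_sub, norm_mul, norm_mul, ← conj_exp_I_mul_ofReal, RCLike.norm_conj, mul_comm
      Complex.I, Complex.norm_exp_ofReal_mul_I, mul_one, Complex.norm_ofNat]
    exact mul_le_mul_of_nonneg_left (hn _ _) two_pos.le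
  have hdiff' := (hlim y).sub (hlim y')
  have := tendsto_nhds_unique (hdiff'.congr' ?_) hdiff
  · linear_combination this
  · filter_upwards [hform y hy, hform y' hy'] with n h1 h2
    rw [h1, h2]

/-- Solve a² log t = 2πn + θ: the logarithmic phase passes through every point of the circle at
arbitrarily late times. -/
theorem exists_times (ha : 0 < a) (θ : ℝ) : ∃ t : ℕ → ℝ, Tendsto t atTop atTop ∧
    ∀ n, Complex.exp (-(Complex.I * ((a ^ 2 * Real.log (t n) : ℝ) : ℂ))) =
      Complex.exp (-(Complex.I * θ)) := by
  refine ⟨fun n => Real.exp ((n * (2 * Real.pi) + θ) / a ^ 2), ?_, fun n => ?_⟩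
  · refine Real.tendsto_exp_atTop.comp (Tendsto.atTop_div_const (by positivity) ?_)
    exact tendsto_atTop_add_const_right _ _
      (tendsto_natCast_atTop_atTop.atTop_mul_const (by positivity))
  · rw [Real.log_exp, mul_div_cancel₀ _ (by positivity), Complex.exp_eq_exp_iff_exists_int]
    refine ⟨-n, ?_⟩
    push_cast
    ring

theorem continuous_of_holder {H : ℝ → ℂ} {B : ℝ}
    (hH : ∀ x y, ‖H x - H y‖ ≤ B * Real.sqrt |x - y|) : Continuous H := by
  rw [continuous_iff_continuousAt]
  intro x
  have hc : Continuous fun y : ℝ => B * Real.sqrt |y - x| := by fun_prop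
  refine tendsto_iff_norm_sub_tendsto_zero.2 (squeeze_zero (fun _ => norm_nonneg _)
    (fun y => hH y x) ?_)
  simpa using hc.tendsto x

/-- If `e^{i t ξ²} ω̂(t)` is Hölder continuous uniformly in time, the asymptotic state is continuous
and vanishes at the origin. -/
theorem IsJost.exists_continuous_asympState (h : IsJost a f f₁) (ha : 0 < a) {c : ℝ → ℂ}
    {B T : ℝ} {H : ℝ → ℝ → ℂ}
    (hH : ∀ t, T ≤ t → ∀ x y, ‖H t x - H t y‖ ≤ B * Real.sqrt |x - y|)
    (hHw : ∀ t, T ≤ t → ∀ᵐ ξ : ℝ, Complex.exp (Complex.I * ((t * ξ ^ 2 : ℝ) : ℂ)) *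
      waveHat f f₁ c t ξ = H t ξ) :
    ∃ g : ℝ → ℂ, Continuous g ∧ g =ᵐ[volume] asympState a c ∧ g 0 = 0 := by
  -- Integer times suffice to reach the limit, and being countable they keep the exceptional set
  -- null.
  set A : Set ℝ := {ξ | ξ ≠ 0 ∧ ∀ n : ℕ, T ≤ n →
    Complex.exp (Complex.I * (((n : ℝ) * ξ ^ 2 : ℝ) : ℂ)) * waveHat f f₁ c n ξ = H n ξ} with hA
  have hAae : ∀ᵐ ξ : ℝ, ξ ∈ A := by
    have h2 : ∀ᵐ ξ : ℝ, ∀ n : ℕ, T ≤ n →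
        Complex.exp (Complex.I * (((n : ℝ) * ξ ^ 2 : ℝ) : ℂ)) * waveHat f f₁ c n ξ = H n ξ := by
      rw [ae_all_iff]
      intro n
      by_cases hn : T ≤ n
      · filter_upwards [hHw n hn] with ξ hξ _ using hξ
      · exact Eventually.of_forall fun ξ h => absurd h hn
    filter_upwards [ae_ne_zero, h2] with ξ h3 h4 using ⟨h3, h4⟩
  have hlim : ∀ ξ ∈ A, Tendsto (fun n : ℕ =>
      Complex.exp (-(Complex.I * ((a ^ 2 / 2 * Real.log n : ℝ) : ℂ))) * H n ξ) atTop
      (𝓝 (asympState a c ξ)) := by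
    intro ξ hξ
    have h1 := (h.tendsto_waveHat_sub c hξ.1).comp tendsto_natCast_atTop_atTop
    have h2 : Tendsto (fun n : ℕ =>
        Complex.exp (-(Complex.I * ((a ^ 2 / 2 * Real.log n : ℝ) : ℂ))) * H n ξ -
          asympState a c ξ) atTop (𝓝 0) := by
      refine squeeze_zero_norm' ?_ (tendsto_norm_zero.comp h1)
      filter_upwards [eventually_ge_atTop ⌈T⌉₊] with n hn
      rw [← hξ.2 n (Nat.ceil_le.1 hn)]
      refine le_of_eq ?_
      have e1 : ‖Complex.exp (-(Complex.I * ((a ^ 2 / 2 * Real.log n : ℝ) : ℂ))) *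
          Complex.exp (Complex.I * (((n : ℝ) * ξ ^ 2 : ℝ) : ℂ))‖ = 1 := by
        rw [norm_mul, ← conj_exp_I_mul_ofReal, RCLike.norm_conj, mul_comm Complex.I,
          Complex.norm_exp_ofReal_mul_I, mul_comm Complex.I, Complex.norm_exp_ofReal_mul_I,
          one_mul]
      have e2 : Complex.exp (-(Complex.I * ((a ^ 2 / 2 * Real.log n : ℝ) : ℂ))) *
          Complex.exp (Complex.I * (((n : ℝ) * ξ ^ 2 : ℝ) : ℂ)) *
          (Complex.exp (-(Complex.I * (((n : ℝ) * ξ ^ 2 : ℝ) : ℂ))) *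
          Complex.exp (Complex.I * ((a ^ 2 / 2 * Real.log n : ℝ) : ℂ))) = 1 := by
        rw [← Complex.exp_add, ← Complex.exp_add, ← Complex.exp_add, ← Complex.exp_zero]
        congr 1
        ring
      have e3 : Complex.exp (-(Complex.I * ((a ^ 2 / 2 * Real.log n : ℝ) : ℂ))) *
          (Complex.exp (Complex.I * (((n : ℝ) * ξ ^ 2 : ℝ) : ℂ)) * waveHat f f₁ c n ξ) -
            asympState a c ξ =
          Complex.exp (-(Complex.I * ((a ^ 2 / 2 * Real.log n : ℝ) : ℂ))) *
          Complex.exp (Complex.I * (((n : ℝ) * ξ ^ 2 : ℝ) : ℂ)) *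
          (waveHat f f₁ c n ξ - Complex.exp (-(Complex.I * (((n : ℝ) * ξ ^ 2 : ℝ) : ℂ))) *
            Complex.exp (Complex.I * ((a ^ 2 / 2 * Real.log n : ℝ) : ℂ)) * asympState a c ξ) := by
        linear_combination asympState a c ξ * e2
      rw [e3, norm_mul, e1, one_mul]
      rfl
    simpa using h2.add_const (asympState a c ξ)
  -- The unimodular factor in `hlim` does not depend on ξ, so the Hölder bound on `H` passes to the
  -- limit.
  have hu : ∀ x ∈ A, ∀ y ∈ A, ‖asympState a c x - asympState a c y‖ ≤ B * Real.sqrt |x - y| := by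
    intro x hx y hy
    refine le_of_tendsto ((hlim x hx).sub (hlim y hy)).norm ?_
    filter_upwards [eventually_ge_atTop ⌈T⌉₊] with n hn
    rw [← mul_sub, norm_mul, ← conj_exp_I_mul_ofReal, RCLike.norm_conj, mul_comm Complex.I,
      Complex.norm_exp_ofReal_mul_I, one_mul]
    exact hH n (Nat.ceil_le.1 hn) x y
  have hAd : Dense A := Measure.dense_of_ae hAae
  obtain ⟨g, hg, hgA⟩ := exists_continuous_extension_of_holder hAd hu
  have hgae : ∀ᵐ ξ : ℝ, g ξ = asympState a c ξ := by
    filter_upwards [hAae] with ξ hξ using hgA ξ hξ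
  refine ⟨g, hg, hgae, ?_⟩
  have hcoeff : ∀ ξ, g ξ = asympState a c ξ → stateCoeff a g ξ = c ξ := fun ξ hξ => by
    rw [stateCoeff, hξ, ← coeff_eq_asympState]
  -- With c replaced by the coefficient of the continuous g, both sides are continuous off the
  -- origin and agree everywhere there. This permits evaluation at the single points y/√t.
  have hEq : ∀ t, max T 1 ≤ t → ∀ ξ, ξ ≠ 0 →
      Complex.exp (Complex.I * ((t * ξ ^ 2 : ℝ) : ℂ)) *
        waveHat f f₁ (stateCoeff a g) t ξ = H t ξ := by
    intro t ht
    have htT : T ≤ t := (le_max_left _ _).trans ht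
    have ht0 : 0 < t := one_pos.trans_le ((le_max_right _ _).trans ht)
    have key : EqOn (fun ξ => Complex.exp (Complex.I * ((t * ξ ^ 2 : ℝ) : ℂ)) *
        waveHat f f₁ (stateCoeff a g) t ξ) (H t) {0}ᶜ := by
      refine Measure.eqOn_open_of_ae_eq (μ := volume) (ae_restrict_of_ae ?_)
        isOpen_compl_singleton ?_ (continuous_of_holder (hH t htT)).continuousOn
      · filter_upwards [hHw t htT, hgae, ae_comp_neg hgae] with ξ h1 h2 h3
        rw [← h1, waveHat, waveHat, hcoeff ξ h2, hcoeff (-ξ) h3]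
      · refine ContinuousOn.mul (Continuous.continuousOn (by fun_prop)) ?_
        exact h.continuousOn_waveHat_freq ht0 (continuousOn_stateCoeff a hg)
    exact fun ξ hξ => key hξ
  by_contra hg0
  set F : ℝ → ℂ := fun y => Complex.exp (-(Complex.I * ((a ^ 2 * Real.log y : ℝ) : ℂ))) *
      Complex.exp (Complex.I * ((y ^ 2 : ℝ) : ℂ)) * (f (y ^ 2) + Complex.I * f₁ (y ^ 2)) with hF
  set G : ℝ → ℂ := fun y => Complex.exp (Complex.I * ((a ^ 2 * Real.log y : ℝ) : ℂ)) *
      Complex.exp (Complex.I * ((y ^ 2 : ℝ) : ℂ)) *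
        (conj (f (y ^ 2)) + Complex.I * conj (f₁ (y ^ 2))) with hG
  have hrel : ∀ θ : ℝ, ∀ y y', 0 < y → 0 < y' →
      g 0 * (F y - F y') + Complex.exp (-(Complex.I * θ)) * conj (g 0) * (G y - G y') = 0 := by
    intro θ y y' hy hy'
    obtain ⟨t, ht, hθ⟩ := exists_times ha θ
    refine zero_mode_relation hg (H := H) (B := B) ht ?_ ?_ hθ (fun _ => rfl) (fun _ => rfl)
      hy hy'
    · filter_upwards [ht.eventually_ge_atTop T] with n hn using hH _ hn
    · filter_upwards [ht.eventually_ge_atTop (max T 1)] with n hn using hEq _ hn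
  -- The angles 0 and π give ε = 1 and ε = -1; subtracting the two relations eliminates F.
  have hconst : ∀ y y', 0 < y → 0 < y' → G y = G y' := by
    intro y y' hy hy'
    have h1 := hrel 0 y y' hy hy'
    have h2 := hrel Real.pi y y' hy hy'
    have e1 : Complex.exp (-(Complex.I * (Real.pi : ℂ))) = -1 := by
      rw [Complex.exp_neg, mul_comm, Complex.exp_pi_mul_I]; norm_num
    rw [Complex.ofReal_zero, mul_zero, neg_zero, Complex.exp_zero] at h1
    rw [e1] at h2
    have h3 : conj (g 0) * (G y - G y') = 0 := by linear_combination (h1 - h2) / 2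
    have h4 : conj (g 0) ≠ 0 := by simpa using hg0
    exact sub_eq_zero.1 ((mul_eq_zero.1 h3).resolve_left h4)
  have hnorm : ∀ y, ‖G y‖ = ‖conj (f (y ^ 2)) + Complex.I * conj (f₁ (y ^ 2))‖ := by
    intro y
    rw [hG, norm_mul, norm_mul, mul_comm Complex.I, Complex.norm_exp_ofReal_mul_I,
      mul_comm Complex.I, Complex.norm_exp_ofReal_mul_I, one_mul, one_mul]
  -- Constant on the positive axis and decaying at infinity, G vanishes there, which contradicts
  -- `exists_ne_zero`.
  have hGlim : Tendsto G atTop (𝓝 0) := by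
    rw [tendsto_zero_iff_norm_tendsto_zero]
    have := (tendsto_norm_zero.comp h.tendsto_conj_add).comp
      (tendsto_pow_atTop (α := ℝ) two_ne_zero)
    exact this.congr fun y => (hnorm y).symm
  obtain ⟨τ, hτ, hne⟩ := h.exists_ne_zero ha
  have hs : 0 < Real.sqrt τ := Real.sqrt_pos.2 hτ
  have hG0 : G (Real.sqrt τ) = 0 := by
    refine tendsto_nhds_unique (tendsto_const_nhds.congr' ?_) hGlim
    filter_upwards [eventually_gt_atTop 0] with y hy using hconst _ _ hs hy
  have := hnorm (Real.sqrt τ)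
  rw [hG0, norm_zero, Real.sq_sqrt hτ.le] at this
  exact hne (norm_eq_zero.1 this.symm)

end ZeroMode

/-! ### The representative continuous in time, and the theorem. -/

section Representative

variable {a t₀ : ℝ} {f f₁ : ℝ → ℂ}

open Classical in
/-- The representative of the Fourier transform of the solution with data `W₀` at time `t₀`. -/
noncomputable def waveRep (f f₁ : ℝ → ℂ) (t₀ : ℝ) (W₀ : ℝ → ℂ) (t ξ : ℝ) : ℂ :=
  if ξ = 0 then W₀ 0 else waveHat f f₁ (waveCoeff f f₁ t₀ W₀) t ξ

theorem waveRep_of_ne (f f₁ : ℝ → ℂ) (t₀ : ℝ) (W₀ : ℝ → ℂ) (t : ℝ) {ξ : ℝ} (hξ : ξ ≠ 0) :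
    waveRep f f₁ t₀ W₀ t ξ = waveHat f f₁ (waveCoeff f f₁ t₀ W₀) t ξ := if_neg hξ

theorem waveRep_eventuallyEq (f f₁ : ℝ → ℂ) (t₀ : ℝ) (W₀ : ℝ → ℂ) (t : ℝ) {ξ : ℝ} (hξ : ξ ≠ 0) :
    waveRep f f₁ t₀ W₀ t =ᶠ[𝓝 ξ] waveHat f f₁ (waveCoeff f f₁ t₀ W₀) t := by
  filter_upwards [isOpen_compl_singleton.mem_nhds (show ξ ∈ ({0}ᶜ : Set ℝ) from hξ)] with η hη
  exact waveRep_of_ne f f₁ t₀ W₀ t hη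

theorem ampY_congr {a t ξ : ℝ} {F G : ℝ → ℂ} (h : F ξ = G ξ) (h' : F (-ξ) = G (-ξ)) :
    ampY a t F ξ = ampY a t G ξ := by
  simp only [ampY, reHat, imHat, h, h']

theorem ampZ_congr {a t ξ : ℝ} {F G : ℝ → ℂ} (h : F ξ = G ξ) (h' : F (-ξ) = G (-ξ)) :
    ampZ a t F ξ = ampZ a t G ξ := by
  simp only [ampZ, reHat, imHat, h, h']

theorem fourierJ_congr {t ξ : ℝ} {F G : ℝ → ℂ} (h : F =ᶠ[𝓝 ξ] G) :
    fourierJ t F ξ = fourierJ t G ξ := by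
  rw [fourierJ, fourierJ, h.deriv_eq, h.eq_of_nhds]

theorem IsLinearSolution.waveRep_ae_eq {ω : ℝ → ℝ → ℂ} (hω : IsLinearSolution a t₀ ω)
    (ht₀ : 0 < t₀) (h : IsJost a f f₁) {W₀ : ℝ → ℂ} (hW₀ : IsFourierTransform (ω t₀) W₀) {t : ℝ}
    (ht : t₀ ≤ t) : ∀ᵐ η : ℝ, waveRep f f₁ t₀ W₀ t (2 * Real.pi * η) =
      (𝓕 ((hω.memLp t ht).toLp (ω t)) : Lp ℂ 2 (volume : Measure ℝ)) η := by
  filter_upwards [hω.waveHat_ae_eq ht₀ h hW₀ ht, ae_ne_zero] with η h1 h2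
  rw [waveRep_of_ne _ _ _ _ _ (mul_ne_zero (by positivity) h2), h1, freqSide_eq]

theorem IsLinearSolution.exists_continuous_asympState {ω : ℝ → ℝ → ℂ}
    (hω : IsLinearSolution a t₀ ω) (ha : 0 < a) (ht₀ : 0 < t₀) (h : IsJost a f f₁) {W₀ : ℝ → ℂ}
    (hW₀ : IsFourierTransform (ω t₀) W₀) (hJ : JStaysBounded ω) :
    ∃ g : ℝ → ℂ, Continuous g ∧ g =ᵐ[volume] asympState a (waveCoeff f f₁ t₀ W₀) ∧ g 0 = 0 := by
  obtain ⟨C, T, hT⟩ := hJ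
  have key : ∀ t, max T t₀ ≤ t → ∃ H : ℝ → ℂ,
      (∀ x y, ‖H x - H y‖ ≤ 2 * Real.pi * C * Real.sqrt |x - y|) ∧
      ∀ᵐ ξ : ℝ, Complex.exp (Complex.I * ((t * ξ ^ 2 : ℝ) : ℂ)) *
        waveHat f f₁ (waveCoeff f f₁ t₀ W₀) t ξ = H ξ := by
    intro t ht
    obtain ⟨v, hv, hJv, hC⟩ := hT t ((le_max_left _ _).trans ht)
    have ht' := (le_max_right _ _).trans ht
    obtain ⟨H, hH, hHe⟩ := hJv.exists_holder (hω.memLp t ht') hv hC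
    have hπ : (2 * Real.pi) ≠ 0 := by positivity
    -- Passing from η = ξ/2π to ξ contracts distances in the argument of H, so the same Hölder
    -- constant serves.
    refine ⟨fun ξ => H (ξ * (2 * Real.pi)⁻¹), fun x y => (hH _ _).trans ?_, ?_⟩
    · refine mul_le_mul_of_nonneg_left (Real.sqrt_le_sqrt ?_) (by positivity)
      rw [← sub_mul, abs_mul, abs_of_pos (by positivity : 0 < (2 * Real.pi)⁻¹)]
      refine mul_le_of_le_one_right (abs_nonneg _) (inv_le_one_of_one_le₀ ?_)
      linarith [Real.pi_gt_three]
    · have h1 : ∀ᵐ η : ℝ, galilei t η * waveHat f f₁ (waveCoeff f f₁ t₀ W₀) t (2 * Real.pi * η) =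
          H η := by
        filter_upwards [hHe, hω.waveHat_ae_eq ht₀ h hW₀ ht'] with η h1 h2
        rw [h2, freqSide_eq (hω.memLp t ht'), h1]
      filter_upwards [ae_comp_mul_right h1 (inv_ne_zero hπ)] with ξ hξ
      rw [← hξ, galilei, freqSq, mul_left_comm, mul_inv_cancel₀ hπ, mul_one]
  choose! H hH using key
  exact h.exists_continuous_asympState ha (fun t ht => (hH t ht).1) fun t ht => (hH t ht).2

end Representative

theorem mainTheorem7 (a t₀ : ℝ) (ha : 0 < a) (ht₀ : 0 < t₀)
    (ω : ℝ → ℝ → ℂ) (hω : IsLinearSolution a t₀ ω)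
    (W₀ : ℝ → ℂ) (hW₀ : IsFourierTransform (ω t₀) W₀) :
    ∃ (W : ℝ → ℝ → ℂ) (Yp Zp up : ℝ → ℂ),
      -- `W t` represents the Fourier transform of `ω t` and is continuous in time at each `ξ ≠ 0`
      W t₀ = W₀ ∧
      (∀ t, t₀ ≤ t → IsFourierTransform (ω t) (W t)) ∧
      (∀ ξ : ℝ, ξ ≠ 0 → ContinuousOn (fun t => W t ξ) (Ici t₀)) ∧
      -- the limits `Y⁺`, `Z⁺` of the amplitudes exist
      (∀ ξ : ℝ, ξ ≠ 0 →
        Tendsto (fun t => ampY a t (W t) ξ) atTop (𝓝 (Yp ξ)) ∧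
        Tendsto (fun t => ampZ a t (W t) ξ) atTop (𝓝 (Zp ξ))) ∧
      -- `up` is the Fourier transform of the asymptotic state, and determines `Y⁺`, `Z⁺`
      (∀ ξ : ℝ, ξ ≠ 0 →
        Tendsto (fun t : ℝ => W t ξ -
            Complex.exp (-(Complex.I * ((t * ξ ^ 2 : ℝ) : ℂ))) *
              Complex.exp (Complex.I * ((a ^ 2 / 2 * Real.log t : ℝ) : ℂ)) * up ξ)
          atTop (𝓝 0) ∧
        Zp ξ = 1 / 2 * Complex.exp (-(Complex.I * ((a ^ 2 * Real.log |ξ| : ℝ) : ℂ))) * up ξ ∧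
        Yp ξ = 1 / 2 * Complex.exp (Complex.I * ((a ^ 2 * Real.log |ξ| : ℝ) : ℂ)) *
          conj (up (-ξ))) ∧
      -- the pointwise behaviour of the Fourier transform of `J(t) ω(t)`
      (∀ ξ : ℝ, ξ ≠ 0 →
        ((DifferentiableAt ℝ W₀ ξ ∧ DifferentiableAt ℝ W₀ (-ξ)) ∨
          (DifferentiableAt ℝ up ξ ∧ DifferentiableAt ℝ up (-ξ))) →
        (∀ t, t₀ ≤ t → DifferentiableAt ℝ (W t) ξ) ∧
        DifferentiableAt ℝ Zp ξ ∧
        Tendsto (fun t : ℝ => fourierJ t (W t) ξ -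
            2 * Complex.I * Complex.exp (-(Complex.I * (PsiTilde a (t * ξ ^ 2) : ℂ))) *
              deriv Zp ξ +
            2 * (a : ℂ) ^ 2 / (ξ : ℂ) *
              (Complex.exp (Complex.I * (PsiTilde a (t * ξ ^ 2) : ℂ)) * Yp ξ +
                Complex.exp (-(Complex.I * (PsiTilde a (t * ξ ^ 2) : ℂ))) * Zp ξ))
          atTop (𝓝 0)) ∧
      -- `fourierJ` is indeed the Fourier transform of `J(t) ω(t)` when the latter is in `L²`
      (ContinuousOn W₀ {0}ᶜ → ∀ t, t₀ ≤ t → ∀ v : ℝ → ℂ, MemLp v 2 volume →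
        IsJ t (ω t) v → IsFourierTransform v (fourierJ t (W t))) ∧
      -- boundedness of `J(t) ω(t)` in `L²` forces the zero mode of the asymptotic state to vanish
      (JStaysBounded ω → ∃ g : ℝ → ℂ, Continuous g ∧ g =ᵐ[volume] up ∧ g 0 = 0) := by
  obtain ⟨f, f₁, h⟩ := exists_isJost a
  set c := waveCoeff f f₁ t₀ W₀ with hc
  refine ⟨waveRep f f₁ t₀ W₀, fun ξ => conj (c (-ξ)), c, asympState a c, ?_, fun t ht => ?_,
    fun ξ hξ => ?_, fun ξ hξ => ⟨?_, ?_⟩, fun ξ hξ => ⟨?_, ?_, ?_⟩, fun ξ hξ hd => ?_,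
    fun hW t ht v hv hJ => ?_, hω.exists_continuous_asympState ha ht₀ h hW₀⟩
  -- The Jost formula recovers the data only for ξ ≠ 0; at the origin `waveRep` keeps the prescribed
  -- value, so equality with W₀ holds everywhere.
  · funext ξ
    by_cases hξ : ξ = 0
    · rw [hξ, waveRep, if_pos rfl]
    · rw [waveRep_of_ne _ _ _ _ _ hξ, h.waveHat_waveCoeff ht₀ hξ]
  · exact isFourierTransform_of_ae (hω.memLp t ht) (hω.waveRep_ae_eq ht₀ h hW₀ ht)
  · simp only [waveRep_of_ne _ _ _ _ _ hξ]
    exact (h.continuousOn_waveHat c hξ).mono fun t ht => ht₀.trans_le ht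
  · exact (h.tendsto_ampY c hξ).congr fun t => ampY_congr (waveRep_of_ne _ _ _ _ _ hξ).symm
      (waveRep_of_ne _ _ _ _ _ (neg_ne_zero.2 hξ)).symm
  · exact (h.tendsto_ampZ c hξ).congr fun t => ampZ_congr (waveRep_of_ne _ _ _ _ _ hξ).symm
      (waveRep_of_ne _ _ _ _ _ (neg_ne_zero.2 hξ)).symm
  · simp only [waveRep_of_ne _ _ _ _ _ hξ]
    exact h.tendsto_waveHat_sub c hξ
  · exact coeff_eq_asympState a c ξ
  · exact conj_coeff_eq_asympState a c ξ
  · have hξ' : -ξ ≠ 0 := neg_ne_zero.2 hξ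
    have hcd : DifferentiableAt ℝ c ξ ∧ DifferentiableAt ℝ c (-ξ) := by
      rcases hd with ⟨h1, h2⟩ | ⟨h1, h2⟩
      · exact ⟨h.differentiableAt_waveCoeff ht₀ hξ h1 h2,
          h.differentiableAt_waveCoeff ht₀ hξ' h2 (by rwa [neg_neg])⟩
      · exact ⟨differentiableAt_coeff_of_asympState hξ h1,
          differentiableAt_coeff_of_asympState hξ' h2⟩
    refine ⟨fun t ht => ?_, hcd.1, ?_⟩
    · have hwd := (h.hasDerivAt_waveHat (ht₀.trans_le ht) hξ hcd.1 hcd.2).differentiableAt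
      exact hwd.congr_of_eventuallyEq (waveRep_eventuallyEq f f₁ t₀ W₀ t hξ)
    · simp only [fun t => fourierJ_congr (t := t) (waveRep_eventuallyEq f f₁ t₀ W₀ t hξ)]
      exact h.tendsto_fourierJ hξ hcd.1 hcd.2
  · refine isFourierTransform_fourierJ ?_ (hω.memLp t ht) (hω.waveRep_ae_eq ht₀ h hW₀ ht) hv hJ
    exact (h.continuousOn_waveHat_freq (ht₀.trans_le ht) (h.continuousOn_waveCoeff ht₀ hW)).congr
      fun ξ hξ => waveRep_of_ne f f₁ t₀ W₀ t hξ
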